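/- **Setting.** Let $P=(p_{xy})$ be an ergodic (irreducible, aperiodic) Markov chain on $X=\{1,\dots,n\}$, $n\ge 2$, that is reversible with respect to its stationary distribution $\pi$ and state-transitive (for all $x,y\in X$ some permutation $\sigma$ of $X$ with $p_{\sigma(u)\sigma(v)}=p_{uv}$ for all $u,v$ maps $x$ to $y$). Let $z\in X$ be any state. On $\mathbb C^{X\times X}$ put $|p_x\rangle=\sum_y\sqrt{p_{xy}}\,|y\rangle$, $|\mu\rangle=|z\rangle|p_z\rangle$, $|\phi_0\rangle=\sum_x\sqrt{\pi_x}\,|x\rangle|p_x\rangle$, $|\widetilde\phi_0\rangle=|\phi_0\rangle-\langle\mu|\phi_0\rangle|\mu\rangle$, $U_1=I-2|\mu\rangle\langle\mu|$, and let $U_2=\mathsf{SWAP}\cdot\bigl(2\sum_x |x,p_x\rangle\langle x,p_x|-I\bigr)$ be the quantum analogue of $P$, where $\mathsf{SWAP}|x\rangle|y\rangle=|y\rangle|x\rangle$. Let $\mathit{QH}$ be the random variable that takes the value $1/\alpha$, for each $\alpha\in(0,\pi]$, with probability the squared length of the projection of $|\widetilde\phi_0\rangle$ onto the sum of the eigenspaces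 of $U_2U_1$ for $e^{\pm i\alpha}$, and the value $0$ with the remaining probability. For $0<\varepsilon<1$ let $\mathsf{QHT}_\varepsilon(U_2,|\mu\rangle)=\min\{y:\Pr[\mathit{QH}>y]\le\varepsilon\}$. Let $\alpha_1\in(0,\pi]$ be the smallest positive eigenphase of $U_2U_1$, let $\theta\in[0,\pi/2)$ be given by $\tan\theta=\langle\mu|\phi_0\rangle\cot(\alpha_1/2)/10$, and put $|\theta\rangle=\cos\theta|0\rangle-\sin\theta|1\rangle$, $|\theta^\perp\rangle=\sin\theta|0\rangle+\cos\theta|1\rangle$. The modified walk is $$\mathbf T(U_1,U_2,\theta)=\bigl(|\theta\rangle\langle\theta|\otimes(-I)+|\theta^\perp\rangle\langle\theta^\perp|\otimes U_2\bigr)\bigl(|0\rangle\langle 0|\otimes I+|1\rangle\langle 1|\otimes U_1\bigr),$$ its start state is $|\widetilde\phi_{0,\theta}\rangle=|\theta^\perp\rangle|\widetilde\phi_0\rangle$, and its target state is $|1\rangle|\mu\rangle$. For a unitary $U$, $\Delta>0$, $0<\varepsilon'<1$ and a constant $\kappa>0$, the circuit $\mathbf{Rotate}(U,\Delta,\varepsilon')$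 applies $\lceil\kappa\ln(1/\varepsilon')\rceil$ times, to the same state and each time with a fresh ancilla register in the state $|0\cdots0\rangle$, the standard phase estimation circuit for $U$ (Hadamard gates, controlled powers of $U$, inverse quantum Fourier transform) on the least number $m$ of qubits with $2\pi/2^m\le\Delta$; it flips the sign if more than half of the estimated phases in $(-\pi,\pi]$ are negative; and it undoes the phase estimations. **Statement.** For every $\kappa>0$ there are constants $c,C>0$, depending only on $\kappa$, such that for all $P$ and $z$ as above, every $\varepsilon\in(0,1/2]$ (with $\varepsilon<1/2$ if $n=2$), and every real $T\ge\mathsf{QHT}_\varepsilon(U_2,|\mu\rangle)/0.78$: 1. $\mathbf{Rotate}(\mathbf T(U_1,U_2,\theta),1/T,1/4)$ maps $|0\cdots0\rangle|\widetilde\phi_{0,\theta}\rangle$ to a state whose inner product with $|0\cdots0\rangle|1\rangle|\mu\rangle$ has modulus at least $c$; 2. it uses at most $C\,T$ applications of the controlled operator $\text{c-}\mathbf T(U_1,U_2,\theta)$ and its inverse. In particular, with $T=\mathsf{QHT}_\varepsilon(U_2,|\mu\rangle)/0.78$, finding costs $O(\mathsf{QHT}_\varepsilon(U_2,|\mu\rangle))$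 applications, the same order as the bound for detection. -/

import Mathlib

open scoped Matrix Kronecker

noncomputable section

/-! ### Markov chains on a finite state space -/

section Chain

variable {X : Type*} [Fintype X] [DecidableEq X]

/-- An ergodic (irreducible and aperiodic) chain on a finite state space: `P` is a stochastic
matrix, some positive power of which has only positive entries. -/
structure IsErgodicChain (P : Matrix X X ℝ) : Prop where
  stochastic : P ∈ Matrix.rowStochastic ℝ X
  primitive : P.IsPrimitive

/-- `π` is a stationary probability distribution of `P`. -/
structure IsStationaryDistribution (P : Matrix X X ℝ) (π : X → ℝ) : Prop where
  nonneg : ∀ x, 0 ≤ π x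
  sum_one : ∑ x, π x = 1
  stationary : π ᵥ* P = π

/-- Reversibility with respect to the stationary distribution (`P` is its own time-reversal). -/
def IsReversibleChain (P : Matrix X X ℝ) (π : X → ℝ) : Prop :=
  ∀ x y, π x * P x y = π y * P y x

/-- The automorphisms of the chain act transitively on its states. -/
def IsStateTransitive (P : Matrix X X ℝ) : Prop :=
  ∀ x y, ∃ σ : Equiv.Perm X, σ x = y ∧ ∀ u v, P (σ u) (σ v) = P u v

end Chain

/-! ### Vectors, reflections and eigenphases

Column vectors `ι → ℂ` stand for kets in the standard basis indexed by `ι`; the inner product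
`⟨u|v⟩` is `star u ⬝ᵥ v`. -/

section Abstract

variable {ι : Type*} [Fintype ι] [DecidableEq ι]

/-- The inner product `⟨u|v⟩`. -/
def bra (u v : ι → ℂ) : ℂ := star u ⬝ᵥ v

/-- The operator `|v⟩⟨v|`. -/
def ketbra (v : ι → ℂ) : Matrix ι ι ℂ := Matrix.vecMulVec v (star v)

/-- `|u⟩|v⟩`. -/
def tensorVec {κ : Type*} (u : κ → ℂ) (v : ι → ℂ) : κ × ι → ℂ := fun p => u p.1 * v p.2

/-- `U₁ = I - 2|μ⟩⟨μ|`. -/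
def markedReflection (μ : ι → ℂ) : Matrix ι ι ℂ := 1 - (2 : ℂ) • ketbra μ

/-- The (unnormalized) start state `φ₀ - ⟨μ|φ₀⟩ μ`. -/
def startState (φ₀ μ : ι → ℂ) : ι → ℂ := φ₀ - bra μ φ₀ • μ

/-- The eigenspace of the matrix `U` for the number `l` (the zero space if `l` is not an
eigenvalue). -/
def eigSpace (U : Matrix ι ι ℂ) (l : ℂ) : Submodule ℂ (EuclideanSpace ℂ ι) :=
  Module.End.eigenspace (Matrix.toEuclideanLin U) l

/-- The squared length of the projection of `ψ` onto the eigenspace of `U` for `l`. -/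
def eigWeight (U : Matrix ι ι ℂ) (ψ : ι → ℂ) (l : ℂ) : ℝ :=
  ‖(eigSpace U l).starProjection (WithLp.toLp 2 ψ)‖ ^ 2

/-- `Pr[QH > y]`, where the random variable `QH` takes the value `1/|α|` with probability the
total squared length of the projections of `ψ` onto the eigenspaces of `U` with eigenphases
`±α ≠ 0`, `α ∈ (-π, π]`, and the value `0` with the remaining probability. -/
def qhTail (U : Matrix ι ι ℂ) (ψ : ι → ℂ) (y : ℝ) : ℝ :=
  if y < 0 then 1
  else ∑ᶠ l ∈ {l : ℂ | l ≠ 1 ∧ y < 1 / |Complex.arg l|}, eigWeight U ψ l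

/-- The `ε`-error `|μ⟩`-hitting time of `U₂`, whose `1`-eigenvector is `φ₀`: the least `y` with
`Pr[QH > y] ≤ ε`, for the operator `U₂ U₁` and its start state. -/
def quantumHittingTime (U₂ : Matrix ι ι ℂ) (φ₀ μ : ι → ℂ) (ε : ℝ) : ℝ :=
  sInf {y : ℝ | qhTail (U₂ * markedReflection μ) (startState φ₀ μ) y ≤ ε}

/-- The smallest `α ∈ (0, π]` such that `exp (iα)` is an eigenvalue of `U`. -/
def principalPhase (U : Matrix ι ι ℂ) : ℝ :=
  sInf {α : ℝ | 0 < α ∧ α ≤ Real.pi ∧ eigSpace U (Complex.exp (Complex.I * α)) ≠ ⊥}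

/-! ### The modified walk -/

/-- `|θ⟩ = R_θ† |0⟩`, where `R_θ` is the rotation of the plane by the angle `θ`. -/
def thetaVec (θ : ℝ) : Fin 2 → ℂ := ![(Real.cos θ : ℂ), -(Real.sin θ : ℂ)]

/-- `|θ^⊥⟩ = R_θ† |1⟩`. -/
def thetaPerp (θ : ℝ) : Fin 2 → ℂ := ![(Real.sin θ : ℂ), (Real.cos θ : ℂ)]

/-- `T(U₁, U₂, θ)`, i.e.
`(|θ⟩⟨θ| ⊗ (-I) + |θ^⊥⟩⟨θ^⊥| ⊗ U₂) (|0⟩⟨0| ⊗ I + |1⟩⟨1| ⊗ U₁)`. -/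
def tulsiWalk (U₁ U₂ : Matrix ι ι ℂ) (θ : ℝ) : Matrix (Fin 2 × ι) (Fin 2 × ι) ℂ :=
  (ketbra (thetaVec θ) ⊗ₖ (-1 : Matrix ι ι ℂ) + ketbra (thetaPerp θ) ⊗ₖ U₂) *
    (ketbra ![1, 0] ⊗ₖ (1 : Matrix ι ι ℂ) + ketbra ![0, 1] ⊗ₖ U₁)

end Abstract

/-! ### The quantum analogue of a reversible chain -/

section Szegedy

variable {X : Type*} [Fintype X] [DecidableEq X]

/-- The vector `|x⟩|p_x⟩` of `ℂ^(X × X)`, where `|p_x⟩ = ∑ y, √(p_xy) |y⟩`. -/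
def edgeVec (P : Matrix X X ℝ) (x : X) : X × X → ℂ :=
  fun p => if p.1 = x then (Real.sqrt (P x p.2) : ℂ) else 0

/-- The reflection `ref(A)` through the span `A` of the orthonormal vectors `|x⟩|p_x⟩`. -/
def refA (P : Matrix X X ℝ) : Matrix (X × X) (X × X) ℂ :=
  (2 : ℂ) • ∑ x, ketbra (edgeVec P x) - 1

/-- The operator `|x⟩|y⟩ ↦ |y⟩|x⟩`. -/
def swapOp (X : Type*) [DecidableEq X] : Matrix (X × X) (X × X) ℂ :=
  fun p q => if p = q.swap then 1 else 0

/-- The quantum analogue `SWAP · ref(A)` of a reversible chain. -/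
def quantumAnalogue (P : Matrix X X ℝ) : Matrix (X × X) (X × X) ℂ := swapOp X * refA P

/-- The `1`-eigenvector `∑ x, √(π_x) |x⟩|p_x⟩` of the quantum analogue. -/
def stationaryVec (P : Matrix X X ℝ) (π : X → ℝ) : X × X → ℂ :=
  ∑ x, (Real.sqrt (π x) : ℂ) • edgeVec P x

end Szegedy

/-! ### Quantum circuits with calls to a controlled operator -/

section Circuits

/-- Basis states of `k` ancilla registers of `m` qubits each. -/
abbrev Anc (k m : ℕ) := Fin k → Fin m → Bool

/-- A circuit with `k` ancilla registers of `m` qubits is built from operations on the ancillas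
alone, and from the operator `U` (or its inverse) on the work space controlled by one ancilla
qubit. -/
inductive OracleGate (k m : ℕ) where
  | onAncilla (V : Matrix (Anc k m) (Anc k m) ℂ)
  | ctrlU (i : Fin k) (j : Fin m)
  | ctrlUInv (i : Fin k) (j : Fin m)

/-- A circuit; the head of the list is applied first. -/
abbrev OracleCircuit (k m : ℕ) := List (OracleGate k m)

variable {k m : ℕ} {ι : Type*} [Fintype ι] [DecidableEq ι]

/-- The projector onto the ancilla states whose qubit `j` of register `i` is `b`. -/
def qubitProj (i : Fin k) (j : Fin m) (b : Bool) : Matrix (Anc k m) (Anc k m) ℂ :=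
  Matrix.diagonal fun a => if a i j = b then 1 else 0

/-- The operator that a gate performs when the work operator is `U`. -/
def OracleGate.eval (U : Matrix ι ι ℂ) :
    OracleGate k m → Matrix (Anc k m × ι) (Anc k m × ι) ℂ
  | .onAncilla V => V ⊗ₖ (1 : Matrix ι ι ℂ)
  | .ctrlU i j => qubitProj i j false ⊗ₖ (1 : Matrix ι ι ℂ) + qubitProj i j true ⊗ₖ U
  | .ctrlUInv i j => qubitProj i j false ⊗ₖ (1 : Matrix ι ι ℂ) + qubitProj i j true ⊗ₖ Uᴴ

/-- The inverse of a (unitary) gate. -/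
def OracleGate.inv : OracleGate k m → OracleGate k m
  | .onAncilla V => .onAncilla Vᴴ
  | .ctrlU i j => .ctrlUInv i j
  | .ctrlUInv i j => .ctrlU i j

/-- Number of applications of the controlled operator or its inverse made by a gate. -/
def OracleGate.calls : OracleGate k m → ℕ
  | .onAncilla _ => 0
  | .ctrlU _ _ => 1
  | .ctrlUInv _ _ => 1

/-- The operator that a circuit performs when the work operator is `U`. -/
def OracleCircuit.eval (U : Matrix ι ι ℂ) :
    OracleCircuit k m → Matrix (Anc k m × ι) (Anc k m × ι) ℂ
  | [] => 1
  | g :: c => OracleCircuit.eval U c * g.eval U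

/-- The inverse circuit. -/
def OracleCircuit.inv (c : OracleCircuit k m) : OracleCircuit k m :=
  (c.map OracleGate.inv).reverse

/-- Number of applications of the controlled operator or its inverse made by a circuit. -/
def OracleCircuit.calls (c : OracleCircuit k m) : ℕ := (c.map OracleGate.calls).sum

/-! ### Phase estimation -/

/-- The number in `{0, …, 2^m - 1}` written in the bits `b`, qubit `j` having weight `2^j`. -/
def bitsVal (b : Fin m → Bool) : ℕ := ∑ j, if b j then 2 ^ (j : ℕ) else 0

/-- The operator `V` on register `i`, and the identity on the other registers. -/
def onRegister (i : Fin k) (V : Matrix (Fin m → Bool) (Fin m → Bool) ℂ) :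
    Matrix (Anc k m) (Anc k m) ℂ :=
  fun a b => if ∀ i', i' ≠ i → a i' = b i' then V (a i) (b i) else 0

/-- The Hadamard gate on each of `m` qubits. -/
def hadamards (m : ℕ) : Matrix (Fin m → Bool) (Fin m → Bool) ℂ :=
  fun a b => ∏ j, (if a j && b j then -1 else 1) / (Real.sqrt 2 : ℂ)

/-- The inverse quantum Fourier transform on `m` qubits. -/
def inverseQFT (m : ℕ) : Matrix (Fin m → Bool) (Fin m → Bool) ℂ :=
  fun a b => Complex.exp (-(2 * Real.pi * Complex.I * bitsVal a * bitsVal b / 2 ^ m)) /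
    (Real.sqrt (2 ^ m) : ℂ)

/-- The phase estimation circuit on ancilla register `i` (initially in the state `|0…0⟩`):
Hadamard gates, then `U ^ (2^j)` controlled by qubit `j` for each `j`, then the inverse quantum
Fourier transform. -/
def estimate (i : Fin k) : OracleCircuit k m :=
  [OracleGate.onAncilla (onRegister i (hadamards m))] ++
  (List.finRange m).flatMap (fun j : Fin m => List.replicate (2 ^ (j : ℕ)) (OracleGate.ctrlU i j)) ++
  [OracleGate.onAncilla (onRegister i (inverseQFT m))]

/-- Phase estimation applied to the same work state with each of the `k` registers. -/
def estimates (k m : ℕ) : OracleCircuit k m := (List.finRange k).flatMap estimate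

/-- The phase in `(-π, π]` that is the outcome of phase estimation when the register reads `b`. -/
def estimatedPhase (b : Fin m → Bool) : ℝ :=
  if 2 * bitsVal b ≤ 2 ^ m then 2 * Real.pi * bitsVal b / 2 ^ m
  else 2 * Real.pi * bitsVal b / 2 ^ m - 2 * Real.pi

/-- The phase flip controlled by the event that the majority of estimated phases are negative. -/
def majorityFlip (k m : ℕ) : Matrix (Anc k m) (Anc k m) ℂ :=
  Matrix.diagonal fun a =>
    if k < 2 * (Finset.univ.filter fun i => estimatedPhase (a i) < 0).card then -1 else 1

/-- The number of qubits with which phase estimation has precision `Δ` (the least `m` with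
`2π / 2^m ≤ Δ`). -/
def precisionBits (Δ : ℝ) : ℕ := Nat.clog 2 ⌈2 * Real.pi / Δ⌉₊

/-- The number of repetitions `⌈κ log (1/ε)⌉`. -/
def repetitions (κ ε : ℝ) : ℕ := ⌈κ * Real.log (1 / ε)⌉₊

/-- The circuit `Rotate(·, Δ, ε)` in which phase estimation with precision `Δ` is applied
`⌈κ log (1/ε)⌉` times, followed by a phase flip if the majority of estimated phases are negative,
after which the phase estimations are undone. -/
def rotate (κ Δ ε : ℝ) : OracleCircuit (repetitions κ ε) (precisionBits Δ) :=
  estimates _ _ ++ [OracleGate.onAncilla (majorityFlip _ _)] ++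
    OracleCircuit.inv (estimates _ _)

/-- The ancilla state `|0…0⟩`. -/
def ancZero (k m : ℕ) : Anc k m → ℂ := Pi.single (fun _ _ => false) 1

end Circuits

end

/-! Transitivity makes the stationary distribution uniform, so reversibility says that `P` is
symmetric. It also makes the diagonal of every function of `P` constant: ∑ vᵢ(z)² f(lᵢ) = (∑
f(lᵢ))/n (`exists_spectralChain`). What happens at the marked state is therefore governed by the
eigenvalues lᵢ alone. The largest zero ℓ of x ↦ ∑ 1/(x - lᵢ) is the top eigenvalue of the chain
absorbed at z. The walk `U₂ U₁` acts as a plane rotation on lifts of eigenvectors of that chain, so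
α₁ = arccos ℓ (`SpectralChain.principalPhase_eq`). Moreover ℓ ≥ 0, since the trace of `P` is
nonnegative.

The hitting time enters only through 1/α₁ ≤ QHT (`SpectralChain.le_hittingTime`). The explicit
vector (ℓ - P)⁻¹ e_z shows that the eigenspaces for e^{±iα₁} carry weight at least 1/2, and more
than 1/2 if n ≥ 3. Hence T ≥ 1/(0.78 α₁).

The modified walk is again a reflection in a single vector, |1⟩|μ⟩, followed by a shift whose
discriminant is -1 ⊕ P. An eigenpair (q, x) of the compression of -1 ⊕ P to the complement of the
marked vector, with coupling r to that vector, lifts to a plane that the walk rotates by arccos x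
(`tulsiWalk_realLift`). If r ≠ 0, x solves a secular equation; the choice of θ then keeps 1 - x ≥
0.99 (1 - ℓ), so every relevant phase exceeds 0.78 α₁ and precision 1/T resolves it from 0.

On an eigenvector, `rotate` is an ancilla circuit, and the overlap with the target is multiplied by
an expected sign (`bra_rotate`). With δ = ⟨μ|φ₀⟩, s = sin θ, p = r²/(1 - x²), y = tan θ · tan(arccos
x / 2) and σ the difference of the expected signs at the phases arccos x and -arccos x, the overlap
has modulus |(δ s / 2) ∑ p σ (1/y - y)|. Terms with y > 1 are harmful, and phases near π have
unreliable signs because π and -π are neighbouring outcomes. Still, 0 ≤ σ ≤ 2 always, and σ ≥ 1.24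
for phases up to 3π/4 (`signGap_ge`). The weights obey ∑ p = 1, ∑ p y² ≤ 1 and ∑ p (1/y² - 1) = (n -
1)/s², and y is at least about 0.099 δ. Linear programming duality, with different multipliers for n
= 2, for large θ and for small θ, then gives the absolute bound 0.004 (`overlap_ge`). The call bound
counts the controlled powers: 2ᵐ is at most 16 T. -/

noncomputable section

set_option linter.unusedSectionVars false

/-! ### Real symmetric matrices -/

section Symmetric

variable {ι : Type*} [Fintype ι] [DecidableEq ι]

/-- A real symmetric matrix has an orthonormal eigenbasis, indexed by the index type. -/
theorem exists_eigenbasis (A : Matrix ι ι ℝ) (hA : A.IsSymm) :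
    ∃ (v : ι → ι → ℝ) (l : ι → ℝ), (∀ i, A *ᵥ v i = l i • v i) ∧
      (∀ i j, v i ⬝ᵥ v j = if i = j then 1 else 0) ∧
      (∀ a, a = ∑ i, (v i ⬝ᵥ a) • v i) := by
  have hH : A.IsHermitian := by
    rw [Matrix.IsHermitian, Matrix.conjTranspose_eq_transpose_of_trivial]; exact hA
  refine ⟨fun i => hH.eigenvectorBasis i, hH.eigenvalues, fun i => hH.mulVec_eigenvectorBasis i,
    fun i j => ?_, fun a => ?_⟩
  · have := (orthonormal_iff_ite.1 hH.eigenvectorBasis.orthonormal) j i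
    rw [EuclideanSpace.inner_eq_star_dotProduct] at this
    simpa [eq_comm] using this
  · have := hH.eigenvectorBasis.sum_repr' (WithLp.toLp 2 a)
    have h2 := congrArg (WithLp.ofLp) this
    simp only [WithLp.ofLp_sum, WithLp.ofLp_smul] at h2
    refine h2.symm.trans (Finset.sum_congr rfl fun i _ => ?_)
    rw [EuclideanSpace.inner_eq_star_dotProduct, dotProduct_comm]
    simp [dotProduct_comm]

theorem parseval_of_expansion {v : ι → ι → ℝ} (hv : ∀ a, a = ∑ i, (v i ⬝ᵥ a) • v i)
    (a b : ι → ℝ) : a ⬝ᵥ b = ∑ i, (v i ⬝ᵥ a) * (v i ⬝ᵥ b) := by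
  conv_lhs => rw [hv a]
  simp [sum_dotProduct]

theorem dotProduct_mulVec_symm {A : Matrix ι ι ℝ} (hA : A.IsSymm) (a b : ι → ℝ) :
    a ⬝ᵥ (A *ᵥ b) = (A *ᵥ a) ⬝ᵥ b := by
  rw [Matrix.dotProduct_mulVec, ← Matrix.mulVec_transpose, hA]

theorem eigen_dotProduct {A : Matrix ι ι ℝ} (hA : A.IsSymm) {v : ι → ℝ} {l : ℝ}
    (h : A *ᵥ v = l • v) (a : ι → ℝ) : v ⬝ᵥ (A *ᵥ a) = l * (v ⬝ᵥ a) := by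
  rw [dotProduct_mulVec_symm hA, h, smul_dotProduct, smul_eq_mul]

end Symmetric

/-! ### Ergodic chains -/

section Ergodic

variable {X : Type*} [Fintype X] [DecidableEq X]

theorem pow_mulVec_eigen {A : Matrix X X ℝ} {v : X → ℝ} {l : ℝ} (h : A *ᵥ v = l • v) (k : ℕ) :
    (A ^ k) *ᵥ v = l ^ k • v := by
  induction k with
  | zero => simp
  | succ k ih => rw [pow_succ, ← Matrix.mulVec_mulVec, h, Matrix.mulVec_smul, ih, smul_smul, pow_succ']

/-- An eigenvector of a primitive stochastic matrix for an eigenvalue of modulus at least one is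
constant. -/
theorem eigenvector_constant {P : Matrix X X ℝ} (hP : P ∈ Matrix.rowStochastic ℝ X)
    (hprim : P.IsPrimitive) {v : X → ℝ} {l : ℝ} (h : P *ᵥ v = l • v) (hl : 1 ≤ |l|) (x y : X) :
    v x = v y := by
  obtain ⟨k, -, hk⟩ := hprim.exists_pos_pow
  set Q := P ^ k with hQ
  have hQs : Q *ᵥ 1 = 1 := ((Matrix.rowStochastic ℝ X).pow_mem hP k).2
  have hQ1 : ∀ a, ∑ b, Q a b = 1 := fun a => by
    have := congrFun hQs a
    simpa [Matrix.mulVec, dotProduct] using this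
  have hv : Q *ᵥ v = l ^ k • v := pow_mulVec_eigen h k
  have hlk : 1 ≤ |l ^ k| := by rw [abs_pow]; exact one_le_pow₀ hl
  have : Nonempty X := ⟨x⟩
  -- Maximum principle at a state `m` of largest modulus: |v m| ≤ |lᵏ v m| is an average, with
  -- strictly positive weights, of numbers `s * v b` ≤ |v m|, so all of them equal |v m|.
  obtain ⟨m, hm⟩ := Finite.exists_max fun a => |v a|
  obtain ⟨s, hs, hsv⟩ : ∃ s : ℝ, (s = 1 ∨ s = -1) ∧ |l ^ k * v m| = s * (l ^ k * v m) := by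
    rcases abs_cases (l ^ k * v m) with h | h
    · exact ⟨1, Or.inl rfl, by rw [h.1]; ring⟩
    · exact ⟨-1, Or.inr rfl, by rw [h.1]; ring⟩
  have hsle : ∀ b, s * v b ≤ |v m| := fun b => by
    refine le_trans ?_ (hm b)
    rcases hs with rfl | rfl
    · simpa using le_abs_self (v b)
    · simpa using neg_le_abs (v b)
  have hrow : l ^ k * v m = ∑ b, Q m b * v b := by
    have := congrFun hv m
    simpa [Matrix.mulVec, dotProduct] using this.symm
  have hsum : ∑ b, Q m b * (|v m| - s * v b) ≤ 0 := by
    have h1 : ∑ b, Q m b * (|v m| - s * v b) = |v m| - s * (l ^ k * v m) := by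
      rw [hrow, Finset.mul_sum]
      simp only [mul_sub, Finset.sum_sub_distrib, ← Finset.sum_mul, hQ1, one_mul]
      congr 1
      exact Finset.sum_congr rfl fun b _ => by ring
    rw [h1, ← hsv, abs_mul]
    nlinarith [abs_nonneg (v m)]
  have hnn : ∀ b ∈ Finset.univ, 0 ≤ Q m b * (|v m| - s * v b) := fun b _ =>
    mul_nonneg (hk m b).le (sub_nonneg.2 (hsle b))
  have hz := (Finset.sum_eq_zero_iff_of_nonneg hnn).1 (le_antisymm hsum (Finset.sum_nonneg hnn))
  have hconst : ∀ b, s * v b = |v m| := fun b => by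
    rcases mul_eq_zero.1 (hz b (Finset.mem_univ _)) with h | h
    · exact absurd h (hk m b).ne'
    · linarith
  have := (hconst x).trans (hconst y).symm
  rcases hs with rfl | rfl <;> linarith

theorem row_sum_one {P : Matrix X X ℝ} (hP : P ∈ Matrix.rowStochastic ℝ X) (x : X) :
    ∑ y, P x y = 1 := by
  simpa [Matrix.mulVec, dotProduct] using congrFun hP.2 x

theorem card_mul_of_transitive {P : Matrix X X ℝ} (h : IsStateTransitive P) {f : X → ℝ}
    (hf : ∀ σ : Equiv.Perm X, (∀ u v, P (σ u) (σ v) = P u v) → ∀ x, f (σ x) = f x) (z : X) :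
    (Fintype.card X : ℝ) * f z = ∑ x, f x := by
  have : ∀ x, f x = f z := fun x => by
    obtain ⟨σ, hσ, hP⟩ := h z x
    rw [← hσ, hf σ hP]
  simp [this]

theorem col_sum_one [Nonempty X] {P : Matrix X X ℝ} (hP : P ∈ Matrix.rowStochastic ℝ X)
    (h : IsStateTransitive P) (y : X) : ∑ x, P x y = 1 := by
  have := card_mul_of_transitive h (f := fun y => ∑ x, P x y) (fun σ hσ y => by
    rw [← Equiv.sum_comp σ]
    exact Finset.sum_congr rfl fun x _ => hσ x y) y
  rw [Finset.sum_comm] at this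
  simp only [row_sum_one hP, Finset.sum_const, Finset.card_univ, nsmul_eq_mul, mul_one] at this
  have hc : (Fintype.card X : ℝ) ≠ 0 := by exact_mod_cast Fintype.card_ne_zero
  exact mul_left_cancel₀ hc (by rw [this, mul_one])

/-- The stationary distribution of a state-transitive ergodic chain is uniform. -/
theorem stationary_uniform {P : Matrix X X ℝ} (hP : IsErgodicChain P) (h : IsStateTransitive P)
    {π : X → ℝ} (hπ : IsStationaryDistribution P π) (x : X) : π x = 1 / Fintype.card X := by
  have : Nonempty X := ⟨x⟩
  -- By transitivity the column sums agree, so `P` is doubly stochastic; `π` is then a 1-eigenvector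
  -- of the primitive stochastic matrix `Pᵀ`, hence constant.
  have hT : Pᵀ ∈ Matrix.rowStochastic ℝ X := by
    refine ⟨fun i j => hP.stochastic.1 j i, ?_⟩
    ext y
    simpa [Matrix.mulVec, dotProduct] using col_sum_one hP.stochastic h y
  have hprim : Pᵀ.IsPrimitive := by
    obtain ⟨k, hk, hpos⟩ := hP.primitive.exists_pos_pow
    exact ⟨fun i j => hP.stochastic.1 j i, k, hk, fun i j => by
      rw [← Matrix.transpose_pow]; exact hpos j i⟩
  have he : Pᵀ *ᵥ π = (1 : ℝ) • π := by
    rw [Matrix.mulVec_transpose, hπ.stationary, one_smul]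
  have hc := fun y => eigenvector_constant hT hprim he (by simp) y x
  have hs := hπ.sum_one
  simp only [hc, Finset.sum_const, Finset.card_univ, nsmul_eq_mul] at hs
  rw [eq_div_iff (by exact_mod_cast Fintype.card_ne_zero), mul_comm]
  exact hs

theorem isSymm_of_reversible {P : Matrix X X ℝ} (hP : IsErgodicChain P) (h : IsStateTransitive P)
    {π : X → ℝ} (hπ : IsStationaryDistribution P π) (hr : IsReversibleChain P π) : P.IsSymm := by
  ext x y
  have : Nonempty X := ⟨x⟩
  have := hr x y
  rw [stationary_uniform hP h hπ, stationary_uniform hP h hπ] at this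
  have hc : (1 / (Fintype.card X : ℝ)) ≠ 0 := by
    have : (Fintype.card X : ℝ) ≠ 0 := by exact_mod_cast Fintype.card_ne_zero
    positivity
  exact (mul_left_cancel₀ hc this).symm

end Ergodic

/-! ### Spectral data of a symmetric, ergodic, state-transitive chain -/

/-- An orthonormal eigenbasis of a symmetric ergodic state-transitive chain on `X`, with a
distinguished index `i₀` for the constant eigenvector. -/
structure SpectralChain {X : Type*} [Fintype X] [DecidableEq X] (P : Matrix X X ℝ)
    (v : X → X → ℝ) (l : X → ℝ) (i₀ : X) : Prop where
  symm : P.IsSymm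
  nonneg : ∀ x y, 0 ≤ P x y
  row_sum : ∀ x, ∑ y, P x y = 1
  eigen : ∀ i, P *ᵥ v i = l i • v i
  orthonormal : ∀ i j, v i ⬝ᵥ v j = if i = j then 1 else 0
  expansion : ∀ a, a = ∑ i, (v i ⬝ᵥ a) • v i
  top : l i₀ = 1
  lt_one : ∀ i, i ≠ i₀ → l i < 1
  neg_one_lt : ∀ i, -1 < l i
  const_top : ∀ x y, v i₀ x = v i₀ y
  diag : ∀ (f : ℝ → ℝ) (z : X), ∑ i, v i z ^ 2 * f (l i) = (∑ i, f (l i)) / Fintype.card X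

section Spectral

variable {X : Type*} [Fintype X] [DecidableEq X]

theorem aeval_mulVec_eigen {A : Matrix X X ℝ} {v : X → ℝ} {l : ℝ} (h : A *ᵥ v = l • v)
    (q : Polynomial ℝ) : (Polynomial.aeval A q) *ᵥ v = (q.eval l) • v := by
  induction q using Polynomial.induction_on' with
  | add p q hp hq => simp [Matrix.add_mulVec, hp, hq, add_smul]
  | monomial k a =>
    rw [Polynomial.aeval_monomial, Polynomial.eval_monomial, ← Matrix.mulVec_mulVec,
      pow_mulVec_eigen h, Algebra.algebraMap_eq_smul_one, Matrix.smul_mulVec, Matrix.one_mulVec,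
      smul_smul]

/-- Conjugation by an automorphism is an algebra homomorphism fixing `A`, so it fixes every
polynomial in `A`. On a transitive chain such polynomials have constant diagonal. -/
theorem aeval_diag_perm {A : Matrix X X ℝ} {σ : Equiv.Perm X} (h : ∀ u v, A (σ u) (σ v) = A u v)
    (q : Polynomial ℝ) (u v : X) :
    (Polynomial.aeval A q) (σ u) (σ v) = (Polynomial.aeval A q) u v := by
  have hA : Matrix.reindexAlgEquiv ℝ ℝ σ.symm A = A := by
    ext u v; simp [h]
  have := Polynomial.aeval_algHom_apply (Matrix.reindexAlgEquiv ℝ ℝ σ.symm).toAlgHom A q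
  have h2 : (Matrix.reindexAlgEquiv ℝ ℝ σ.symm).toAlgHom A = A := hA
  rw [h2] at this
  have h3 := congrFun (congrFun this u) v
  rw [h3]
  simp

theorem exists_spectralChain [Nonempty X] {P : Matrix X X ℝ} (hP : IsErgodicChain P)
    (ht : IsStateTransitive P) (hs : P.IsSymm) :
    ∃ v l i₀, SpectralChain P v l i₀ := by
  obtain ⟨v, l, he, ho, hx⟩ := exists_eigenbasis P hs
  have hone : P *ᵥ 1 = 1 := hP.stochastic.2
  have hconst : ∀ i, 1 ≤ |l i| → ∀ x y, v i x = v i y := fun i hi x y =>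
    eigenvector_constant hP.stochastic hP.primitive (he i) hi x y
  obtain ⟨i₀, hi₀⟩ : ∃ i, v i ⬝ᵥ (1 : X → ℝ) ≠ 0 := by
    by_contra! hcon
    have := hx 1
    simp only [hcon, zero_smul, Finset.sum_const_zero] at this
    exact one_ne_zero this
  have htop : l i₀ = 1 := by
    have := eigen_dotProduct hs (he i₀) 1
    rw [hone] at this
    exact (mul_right_cancel₀ hi₀ (by rw [← this, one_mul])).symm
  -- A second eigenvalue of modulus at least 1 would give two constant unit vectors that are
  -- orthogonal.
  have huniq : ∀ i, i ≠ i₀ → |l i| < 1 := fun i hi => by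
    by_contra! hcon
    obtain ⟨x⟩ := ‹Nonempty X›
    have h0 := ho i i₀
    rw [if_neg hi] at h0
    have c1 : v i = fun _ => v i x := funext fun y => hconst i hcon y x
    have c2 : v i₀ = fun _ => v i₀ x := funext fun y => hconst i₀ (by simp [htop]) y x
    have n1 := ho i i
    have n2 := ho i₀ i₀
    rw [c1] at n1 h0
    rw [c2] at n2 h0
    simp only [dotProduct, Finset.sum_const, nsmul_eq_mul, if_true] at n1 n2 h0
    have hc : (Finset.univ.card (α := X) : ℝ) ≠ 0 := by
      rw [Finset.card_univ]; exact_mod_cast Fintype.card_ne_zero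
    rcases mul_eq_zero.1 h0 with h | h
    · exact hc h
    · rcases mul_eq_zero.1 h with h | h <;> simp [h] at n1 n2
  refine ⟨v, l, i₀, hs, hP.stochastic.1, row_sum_one hP.stochastic, he, ho, hx, htop,
    fun i hi => (abs_lt.1 (huniq i hi)).2, fun i => ?_, hconst i₀ (by simp [htop]), fun f z => ?_⟩
  · by_cases hi : i = i₀
    · rw [hi, htop]; norm_num
    · exact (abs_lt.1 (huniq i hi)).1
  -- Replacing `f` by a polynomial `q` that agrees with it on the spectrum, the left side becomes
  -- the diagonal entry of `q(P)` at `z`, which transitivity makes independent of `z`; hence it is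
  -- the trace divided by n.
  · set q := Lagrange.interpolate (Finset.univ.image l) id f with hq
    have hqe : ∀ i, q.eval (l i) = f (l i) := fun i =>
      Lagrange.eval_interpolate_at_node (v := id) f (Function.injective_id.injOn)
        (Finset.mem_image_of_mem l (Finset.mem_univ i))
    have hdiag : ∀ z, (Polynomial.aeval P q) z z = ∑ i, v i z ^ 2 * f (l i) := fun z => by
      have h1 := congrArg (fun w => ((Polynomial.aeval P q) *ᵥ w) z) (hx (Pi.single z 1))
      simp only [Matrix.mulVec_sum, Matrix.mulVec_smul, aeval_mulVec_eigen (he _), hqe] at h1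
      rw [Matrix.mulVec_single_one] at h1
      simp only [Matrix.col_apply, Finset.sum_apply, Pi.smul_apply, smul_eq_mul,
        dotProduct_single, mul_one] at h1
      rw [h1]
      exact Finset.sum_congr rfl fun i _ => by ring
    have h2 := card_mul_of_transitive ht (f := fun z => (Polynomial.aeval P q) z z)
      (fun σ hσ x => aeval_diag_perm hσ q x x) z
    have hc : (Fintype.card X : ℝ) ≠ 0 := by exact_mod_cast Fintype.card_ne_zero
    rw [eq_div_iff hc, mul_comm, ← hdiag, h2]
    simp only [hdiag]
    rw [Finset.sum_comm]
    refine Finset.sum_congr rfl fun i _ => ?_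
    rw [← Finset.sum_mul]
    have := ho i i
    rw [if_pos rfl] at this
    simp only [dotProduct, ← sq] at this
    rw [this, one_mul]

end Spectral

/-! ### The principal root: the top eigenvalue of the absorbed chain -/

section Root

variable {X : Type*} [Fintype X] [DecidableEq X] {P : Matrix X X ℝ} {v : X → X → ℝ} {l : X → ℝ}
  {i₀ : X}

/-- `ℓ` is the largest zero of the diagonal of the resolvent of a state-transitive chain with
eigenvalues `l`, i.e. the largest eigenvalue of the chain absorbed at one state. -/
structure IsPrincipalRoot (l : X → ℝ) (i₀ : X) (ℓ : ℝ) : Prop where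
  lt_one : ℓ < 1
  lt : ∀ i, i ≠ i₀ → l i < ℓ
  sum_eq : ∑ i ∈ Finset.univ.erase i₀, 1 / (ℓ - l i) = 1 / (1 - ℓ)

namespace SpectralChain

variable (H : SpectralChain P v l i₀)
include H

theorem sum_split (f : X → ℝ) : ∑ i, f i = f i₀ + ∑ i ∈ Finset.univ.erase i₀, f i :=
  (Finset.add_sum_erase _ _ (Finset.mem_univ i₀)).symm

theorem diag_split (f : ℝ → ℝ) (z : X) :
    ∑ i, v i z ^ 2 * f (l i) =
      (f 1 + ∑ i ∈ Finset.univ.erase i₀, f (l i)) / Fintype.card X := by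
  rw [H.diag, H.sum_split, H.top]

theorem top_sq (z : X) : v i₀ z ^ 2 = 1 / Fintype.card X := by
  have h := H.orthonormal i₀ i₀
  rw [if_pos rfl] at h
  have : Nonempty X := ⟨z⟩
  have hc : (Fintype.card X : ℝ) ≠ 0 := by exact_mod_cast Fintype.card_ne_zero
  have h2 : v i₀ = fun _ => v i₀ z := funext fun y => H.const_top y z
  rw [h2] at h
  simp only [dotProduct, Finset.sum_const, Finset.card_univ, nsmul_eq_mul] at h
  rw [eq_div_iff hc]; linarith

theorem top_ne_zero (z : X) : v i₀ z ≠ 0 := by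
  intro h
  have := H.top_sq z
  have hn : Nonempty X := ⟨z⟩
  have hc : (Fintype.card X : ℝ) ≠ 0 := by exact_mod_cast Fintype.card_ne_zero
  rw [h] at this
  field_simp at this
  simp at this

theorem apply_eq (a : X → ℝ) (z : X) : a z = ∑ i, (v i ⬝ᵥ a) * v i z := by
  conv_lhs => rw [H.expansion a]
  simp

theorem eq_zero_of_coeff {a : X → ℝ} (h : ∀ i, v i ⬝ᵥ a = 0) : a = 0 := by
  rw [H.expansion a]; simp [h]

/-- By transitivity the sum is n times the entry `P z z`, which is nonnegative. -/
theorem sum_eigenvalues_nonneg [Nonempty X] : 0 ≤ ∑ i, l i := by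
  obtain ⟨z⟩ := ‹Nonempty X›
  have h := H.diag id z
  have h2 : ∑ i, v i z ^ 2 * id (l i) = P z z := by
    have : P z z = (P *ᵥ Pi.single z 1) z := by simp
    rw [this, H.apply_eq (P *ᵥ Pi.single z 1) z]
    refine Finset.sum_congr rfl fun i _ => ?_
    rw [eigen_dotProduct H.symm (H.eigen i)]
    simp only [id, dotProduct_single, mul_one]
    ring
  have hn : Nonempty X := ⟨z⟩
  have hc : (0 : ℝ) < Fintype.card X := by exact_mod_cast Fintype.card_pos
  rw [h2, eq_div_iff hc.ne'] at h
  simp only [id] at h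
  rw [← h]
  exact mul_nonneg (H.nonneg z z) hc.le

/-- Multiplied by 1 - x to clear the pole at 1, the equation reads ∑ (1 - x)/(x - lᵢ) = 1. The left
side vanishes at 1 and is at least 1 at the midpoint between 1 and the second largest eigenvalue, so
the intermediate value theorem applies. -/
theorem exists_principalRoot (hn : 2 ≤ Fintype.card X) : ∃ ℓ, IsPrincipalRoot l i₀ ℓ := by
  set s := Finset.univ.erase i₀ with hs
  have hcard : s.card = Fintype.card X - 1 := by
    rw [hs, Finset.card_erase_of_mem (Finset.mem_univ _), Finset.card_univ]
  have hne : s.Nonempty := by rw [← Finset.card_pos]; omega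
  obtain ⟨m, hm, hmax⟩ := s.exists_max_image l hne
  have hlt : ∀ i ∈ s, l i < 1 := fun i hi => H.lt_one i (Finset.ne_of_mem_erase hi)
  set a := (1 + l m) / 2 with ha
  have hm1 := hlt m hm
  have hpos : ∀ i ∈ s, ∀ x, a ≤ x → 0 < x - l i := fun i hi x hx => by
    have := hmax i hi
    linarith
  have hcont : ContinuousOn (fun x => ∑ i ∈ s, (1 - x) / (x - l i)) (Set.Icc a 1) := by
    refine continuousOn_finsetSum _ fun i hi => ?_
    exact ContinuousOn.div (by fun_prop) (by fun_prop) fun x hx => (hpos i hi x hx.1).ne'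
  have h1 : (1 : ℝ) ∈ Set.Icc ((fun x => ∑ i ∈ s, (1 - x) / (x - l i)) 1)
      ((fun x => ∑ i ∈ s, (1 - x) / (x - l i)) a) := by
    constructor
    · simp
    · have : (1 - a) / (a - l m) = 1 := by
        rw [div_eq_one_iff_eq (by linarith)]; linarith
      refine this.symm.le.trans ?_
      exact Finset.single_le_sum (f := fun i => (1 - a) / (a - l i))
        (fun i hi => div_nonneg (by linarith) (hpos i hi a le_rfl).le) hm
  obtain ⟨ℓ, hℓ, hval⟩ := intermediate_value_Icc' (by linarith) hcont h1
  have hℓ1 : ℓ < 1 := by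
    refine lt_of_le_of_ne hℓ.2 fun h => ?_
    rw [h] at hval
    simp at hval
  refine ⟨ℓ, hℓ1, fun i hi => ?_, ?_⟩
  · have := hpos i (Finset.mem_erase.2 ⟨hi, Finset.mem_univ _⟩) ℓ hℓ.1
    linarith
  · rw [eq_div_iff (by linarith), Finset.sum_mul]
    refine Eq.trans ?_ hval
    exact Finset.sum_congr rfl fun i _ => by ring

/-- Cauchy–Schwarz applied to the root equation gives (n - 1)²(1 - ℓ) ≤ ∑ (ℓ - lᵢ), and the trace
bound makes the right side at most (n - 1)ℓ + 1. The consequence is that the principal phase is at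
most π/2. -/
theorem principalRoot_nonneg {ℓ : ℝ} (hn : 2 ≤ Fintype.card X) (hℓ : IsPrincipalRoot l i₀ ℓ) :
    0 ≤ ℓ := by
  have hne : Nonempty X := ⟨i₀⟩
  set s := Finset.univ.erase i₀ with hs
  have hcard : (s.card : ℝ) = Fintype.card X - 1 := by
    rw [hs, Finset.card_erase_of_mem (Finset.mem_univ _), Finset.card_univ, Nat.cast_sub (by omega)]
    simp
  have hn' : (2 : ℝ) ≤ Fintype.card X := by exact_mod_cast hn
  have hpos : ∀ i ∈ s, 0 < ℓ - l i := fun i hi => sub_pos.2 (hℓ.lt i (Finset.ne_of_mem_erase hi))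
  have h1 := Finset.sq_sum_div_le_sum_sq_div s (fun _ => (1 : ℝ)) hpos
  simp only [one_pow] at h1
  rw [hℓ.sum_eq] at h1
  simp only [Finset.sum_const, nsmul_eq_mul, mul_one, Finset.sum_sub_distrib] at h1
  have h2 := H.sum_eigenvalues_nonneg
  rw [H.sum_split, H.top] at h2
  have h3 : 0 < ∑ i ∈ s, (ℓ - l i) := Finset.sum_pos hpos (by
    rw [← Finset.card_pos]
    have : (0 : ℝ) < s.card := by rw [hcard]; linarith
    exact_mod_cast this)
  rw [Finset.sum_sub_distrib, Finset.sum_const, nsmul_eq_mul] at h3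
  rw [div_le_div_iff₀ h3 (by linarith [hℓ.lt_one])] at h1
  rw [hcard] at h1 h3
  by_contra! hneg
  nlinarith

/-- `(ℓ - P)⁻¹ e_z`. -/
theorem exists_principal_vector {ℓ : ℝ} (hℓ : IsPrincipalRoot l i₀ ℓ) (z : X) :
    ∃ g : X → ℝ, g z = 0 ∧ (∀ x, (P *ᵥ g) x = ℓ * g x - if x = z then 1 else 0) ∧
      g ⬝ᵥ g = (1 / (1 - ℓ) ^ 2 + ∑ i ∈ Finset.univ.erase i₀, (1 / (ℓ - l i)) ^ 2) /
        Fintype.card X ∧ ∑ x, g x = -(1 / (1 - ℓ)) := by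
  have h1 : (1 - ℓ) ≠ 0 := by linarith [hℓ.lt_one]
  have hne : ∀ i, ℓ - l i ≠ 0 := fun i => by
    by_cases hi : i = i₀
    · rw [hi, H.top]; intro h; apply h1; linarith
    · linarith [hℓ.lt i hi]
  set g : X → ℝ := ∑ i, (v i z / (ℓ - l i)) • v i with hg
  have hcoef : ∀ i, v i ⬝ᵥ g = v i z / (ℓ - l i) := fun i => by
    simp [hg, dotProduct_sum, H.orthonormal]
  refine ⟨g, ?_, fun x => ?_, ?_, ?_⟩
  -- `g z` is the diagonal of the resolvent at ℓ, and the equation defining ℓ says that it vanishes.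
  · rw [H.apply_eq g z]
    simp only [hcoef]
    have := H.diag_split (fun x => 1 / (ℓ - x)) z
    simp only [hℓ.sum_eq] at this
    rw [show (1 / (ℓ - 1) + 1 / (1 - ℓ)) = 0 by
      rw [← neg_sub 1 ℓ, div_neg]; ring, zero_div] at this
    rw [← this]
    exact Finset.sum_congr rfl fun i _ => by ring
  · have : P *ᵥ g - ℓ • g + Pi.single z 1 = 0 := H.eq_zero_of_coeff fun i => by
      rw [dotProduct_add, dotProduct_sub, eigen_dotProduct H.symm (H.eigen i), dotProduct_smul,
        hcoef, dotProduct_single, smul_eq_mul, mul_one]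
      field_simp [hne i]
      ring
    have := congrFun this x
    simp only [Pi.add_apply, Pi.sub_apply, Pi.smul_apply, smul_eq_mul, Pi.zero_apply,
      Pi.single_apply] at this
    linarith
  · rw [parseval_of_expansion H.expansion]
    simp only [hcoef]
    have := H.diag_split (fun x => (1 / (ℓ - x)) ^ 2) z
    rw [show (1 / (ℓ - 1)) ^ 2 = 1 / (1 - ℓ) ^ 2 by
      rw [← neg_sub 1 ℓ, div_neg, neg_sq, div_pow, one_pow]] at this
    rw [← this]
    exact Finset.sum_congr rfl fun i _ => by ring
  · have htop := hcoef i₀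
    rw [H.top] at htop
    have h2 : v i₀ ⬝ᵥ g = v i₀ z * ∑ x, g x := by
      simp only [dotProduct, Finset.mul_sum]
      exact Finset.sum_congr rfl fun x _ => by rw [H.const_top x z]
    rw [h2, ← neg_sub 1 ℓ, div_neg, div_eq_mul_one_div, ← mul_neg] at htop
    exact mul_left_cancel₀ (H.top_ne_zero z) htop

theorem sum_inv_pos {ℓ x : ℝ} (hn : 2 ≤ Fintype.card X) (hℓ : IsPrincipalRoot l i₀ ℓ)
    (hx : ℓ ≤ x) :
    0 < ∑ i ∈ Finset.univ.erase i₀, 1 / (x - l i) := by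
  refine Finset.sum_pos (fun i hi => ?_) ?_
  · have := hℓ.lt i (Finset.ne_of_mem_erase hi)
    exact one_div_pos.2 (by linarith)
  · rw [← Finset.card_pos, Finset.card_erase_of_mem (Finset.mem_univ _), Finset.card_univ]
    omega

theorem sum_inv_le {ℓ x : ℝ} (hℓ : IsPrincipalRoot l i₀ ℓ) (hx : ℓ ≤ x) :
    ∑ i ∈ Finset.univ.erase i₀, 1 / (x - l i) ≤ 1 / (1 - ℓ) := by
  rw [← hℓ.sum_eq]
  refine Finset.sum_le_sum fun i hi => ?_
  have := hℓ.lt i (Finset.ne_of_mem_erase hi)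
  exact one_div_le_one_div_of_le (by linarith) (by linarith)

/-- The principal root bounds the eigenvalues of the absorbed chain. -/
theorem absorbed_eigenvalue_le {ℓ : ℝ} (hn : 2 ≤ Fintype.card X) (hℓ : IsPrincipalRoot l i₀ ℓ)
    {z : X} {w : X → ℝ} {x : ℝ} (hz : w z = 0) (hw : w ≠ 0)
    (he : ∀ y, y ≠ z → (P *ᵥ w) y = x * w y) : x ≤ ℓ := by
  by_contra! hlt
  set c := (P *ᵥ w) z with hc
  have hPw : P *ᵥ w = x • w + c • Pi.single z 1 := by
    ext y
    by_cases hy : y = z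
    · rw [hy, ← hc]; simp [hz]
    · simp [he y hy, hy]
  have hco : ∀ i, (x - l i) * (v i ⬝ᵥ w) = -(c * v i z) := fun i => by
    have := eigen_dotProduct H.symm (H.eigen i) w
    rw [hPw, dotProduct_add, dotProduct_smul, dotProduct_smul, dotProduct_single] at this
    simp only [smul_eq_mul, mul_one] at this
    linarith
  have hlx : ∀ i, i ≠ i₀ → x - l i ≠ 0 := fun i hi => by linarith [hℓ.lt i hi]
  have hc0 : c = 0 → w = 0 := fun h0 => H.eq_zero_of_coeff fun i => by
    have hne : ∀ i, i ≠ i₀ → v i ⬝ᵥ w = 0 := fun i hi => by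
      have := hco i
      rw [h0, zero_mul, neg_zero] at this
      exact (mul_eq_zero.1 this).resolve_left (hlx i hi)
    by_cases hi : i = i₀
    · rw [H.apply_eq w z, H.sum_split, Finset.sum_eq_zero, add_zero] at hz
      · rw [hi]; exact (mul_eq_zero.1 hz).resolve_right (H.top_ne_zero z)
      · intro j hj; rw [hne j (Finset.ne_of_mem_erase hj), zero_mul]
    · exact hne i hi
  -- If `c` were nonzero, `w` would be a multiple of a resolvent column and `w z = 0` would force
  -- 1/(x - 1) + ∑ 1/(x - lᵢ) = 0. For x > ℓ this is impossible: the expression is negative for x <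
  -- 1 and positive for x > 1. At x = 1 the coefficient along the constant vector gives `c = 0`
  -- directly.
  refine hw (hc0 ?_)
  by_cases hx1 : x = 1
  · have := hco i₀
    rw [H.top, hx1, sub_self, zero_mul, eq_comm, neg_eq_zero] at this
    exact (mul_eq_zero.1 this).resolve_right (H.top_ne_zero z)
  · have hne : ∀ i, x - l i ≠ 0 := fun i => by
      by_cases hi : i = i₀
      · rw [hi, H.top]; exact sub_ne_zero.2 hx1
      · exact hlx i hi
    have hn0 : Nonempty X := ⟨z⟩
    have hcard : (Fintype.card X : ℝ) ≠ 0 := by exact_mod_cast Fintype.card_ne_zero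
    have hw2 : ∀ i, v i ⬝ᵥ w = -(c * v i z) / (x - l i) := fun i => by
      rw [eq_div_iff (hne i), mul_comm]; exact hco i
    have hd := H.diag_split (fun y => 1 / (x - y)) z
    rw [H.apply_eq w z] at hz
    have h3 : ∑ i, (v i ⬝ᵥ w) * v i z = -c * ∑ i, v i z ^ 2 * (1 / (x - l i)) := by
      rw [Finset.mul_sum]
      exact Finset.sum_congr rfl fun i _ => by rw [hw2]; ring
    rw [h3, hd] at hz
    rcases mul_eq_zero.1 hz with h | h
    · linarith
    exfalso
    have h4 := (div_eq_zero_iff.1 h).resolve_right hcard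
    have hp := H.sum_inv_pos hn hℓ hlt.le
    rcases lt_or_gt_of_ne hx1 with h5 | h5
    · have h6 := H.sum_inv_le hℓ hlt.le
      have h7 : 1 / (1 - ℓ) < 1 / (1 - x) := one_div_lt_one_div_of_lt (by linarith) (by linarith)
      have h8 : 1 / (x - 1) = - (1 / (1 - x)) := by rw [← neg_sub 1 x, div_neg]
      linarith
    · have : 0 < 1 / (x - 1) := one_div_pos.2 (by linarith)
      linarith

/-- The stationary weight of the principal vector of the absorbed chain. -/
theorem principal_weight {ℓ : ℝ} (hℓ : IsPrincipalRoot l i₀ ℓ) :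
    ∑ i ∈ Finset.univ.erase i₀, (1 / (ℓ - l i)) ^ 2 ≤ 1 / (1 - ℓ) ^ 2 := by
  have hpos : ∀ i ∈ Finset.univ.erase i₀, 0 ≤ 1 / (ℓ - l i) := fun i hi =>
    (one_div_pos.2 (sub_pos.2 (hℓ.lt i (Finset.ne_of_mem_erase hi)))).le
  calc _ ≤ (∑ i ∈ Finset.univ.erase i₀, 1 / (ℓ - l i)) ^ 2 :=
        Finset.sum_sq_le_sq_sum_of_nonneg hpos
    _ = _ := by rw [hℓ.sum_eq, div_pow, one_pow]

/-- A square of a sum of at least two positive terms strictly exceeds the sum of squares. With n = 2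
there is a single term and equality, which is why ε = 1/2 is excluded there. -/
theorem principal_weight_lt {ℓ : ℝ} (hn : 3 ≤ Fintype.card X) (hℓ : IsPrincipalRoot l i₀ ℓ) :
    ∑ i ∈ Finset.univ.erase i₀, (1 / (ℓ - l i)) ^ 2 < 1 / (1 - ℓ) ^ 2 := by
  set s := Finset.univ.erase i₀ with hs
  have hcard : s.card = Fintype.card X - 1 := by
    rw [hs, Finset.card_erase_of_mem (Finset.mem_univ _), Finset.card_univ]
  have hpos : ∀ i ∈ s, 0 < 1 / (ℓ - l i) := fun i hi =>
    (one_div_pos.2 (sub_pos.2 (hℓ.lt i (Finset.ne_of_mem_erase hi))))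
  have hlt : ∀ i ∈ s, 1 / (ℓ - l i) < 1 / (1 - ℓ) := fun i hi => by
    rw [← hℓ.sum_eq, ← Finset.add_sum_erase s _ hi]
    refine lt_add_of_pos_right _ (Finset.sum_pos (fun j hj => hpos j (Finset.mem_of_mem_erase hj)) ?_)
    rw [← Finset.card_pos, Finset.card_erase_of_mem hi]; omega
  have hne : s.Nonempty := by rw [← Finset.card_pos]; omega
  calc _ < ∑ i ∈ s, (1 / (ℓ - l i)) * (1 / (1 - ℓ)) := by
        refine Finset.sum_lt_sum_of_nonempty hne fun i hi => ?_
        rw [sq]; exact mul_lt_mul_of_pos_left (hlt i hi) (hpos i hi)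
    _ = _ := by rw [← Finset.sum_mul, hℓ.sum_eq, one_div_mul_one_div, sq]

end SpectralChain

end Root

/-! ### Brackets, eigenspaces and hitting times -/

section Brackets

variable {ι : Type*} [Fintype ι] [DecidableEq ι]

theorem bra_eq_sum (u v : ι → ℂ) : bra u v = ∑ i, star (u i) * v i := rfl

theorem bra_add_right (u v w : ι → ℂ) : bra u (v + w) = bra u v + bra u w := dotProduct_add _ _ _

theorem bra_sub_right (u v w : ι → ℂ) : bra u (v - w) = bra u v - bra u w := dotProduct_sub _ _ _

theorem bra_smul_right (c : ℂ) (u v : ι → ℂ) : bra u (c • v) = c * bra u v := by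
  simp [bra]

theorem bra_sub_left (u v w : ι → ℂ) : bra (u - v) w = bra u w - bra v w := by
  simp [bra, sub_dotProduct]

theorem bra_add_left (u v w : ι → ℂ) : bra (u + v) w = bra u w + bra v w := by
  simp [bra, add_dotProduct]

theorem bra_smul_left (c : ℂ) (u v : ι → ℂ) : bra (c • u) v = star c * bra u v := by
  simp [bra]

theorem star_bra (u v : ι → ℂ) : star (bra u v) = bra v u := by
  rw [bra, Matrix.star_dotProduct, star_star, dotProduct_comm, bra, dotProduct_comm]

theorem bra_mulVec (A : Matrix ι ι ℂ) (u v : ι → ℂ) : bra u (A *ᵥ v) = bra (Aᴴ *ᵥ u) v := by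
  rw [bra, bra, Matrix.star_mulVec, Matrix.conjTranspose_conjTranspose, Matrix.dotProduct_mulVec]

theorem ketbra_mulVec (v w : ι → ℂ) : ketbra v *ᵥ w = bra v w • v := by
  ext i
  simp [ketbra, Matrix.vecMulVec_mulVec, bra, mul_comm]

theorem markedReflection_mulVec (μ w : ι → ℂ) :
    markedReflection μ *ᵥ w = w - (2 * bra μ w) • μ := by
  rw [markedReflection, Matrix.sub_mulVec, Matrix.one_mulVec, Matrix.smul_mulVec, ketbra_mulVec,
    smul_smul]

theorem mem_eigSpace {U : Matrix ι ι ℂ} {l : ℂ} {f : ι → ℂ} :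
    WithLp.toLp 2 f ∈ eigSpace U l ↔ U *ᵥ f = l • f := by
  rw [eigSpace, Module.End.mem_eigenspace_iff, Matrix.toLpLin_apply, ← WithLp.toLp_smul]
  exact (WithLp.toLp_injective 2).eq_iff

theorem eigWeight_nonneg (U : Matrix ι ι ℂ) (ψ : ι → ℂ) (l : ℂ) : 0 ≤ eigWeight U ψ l :=
  sq_nonneg _

/-- An eigenvector gives a lower bound on the weight of its eigenspace. -/
theorem le_eigWeight {U : Matrix ι ι ℂ} {l : ℂ} {f : ι → ℂ} (hf : U *ᵥ f = l • f) (ψ : ι → ℂ) :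
    ‖bra f ψ‖ ^ 2 ≤ (bra f f).re * eigWeight U ψ l := by
  have hm := mem_eigSpace.2 hf
  have h1 : bra f ψ = inner ℂ (WithLp.toLp 2 f) (WithLp.toLp 2 ψ) := by
    rw [EuclideanSpace.inner_eq_star_dotProduct, bra, dotProduct_comm]
  have h2 : inner ℂ (WithLp.toLp 2 f) (WithLp.toLp 2 ψ) =
      inner ℂ (WithLp.toLp 2 f) ((eigSpace U l).starProjection (WithLp.toLp 2 ψ)) := by
    rw [← Submodule.inner_starProjection_left_eq_right,
      Submodule.starProjection_eq_self_iff.2 hm]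
  have h3 : (bra f f).re = ‖WithLp.toLp 2 f‖ ^ 2 := by
    rw [← inner_self_eq_norm_sq (𝕜 := ℂ), EuclideanSpace.inner_eq_star_dotProduct, bra,
      dotProduct_comm]
    rfl
  rw [h1, h2, h3, eigWeight, ← mul_pow]
  exact pow_le_pow_left₀ (norm_nonneg _) (norm_inner_le_norm _ _) 2

theorem finite_eigWeight_support (U : Matrix ι ι ℂ) (ψ : ι → ℂ) :
    {l | eigWeight U ψ l ≠ 0}.Finite := by
  refine (Module.End.finite_hasEigenvalue (f := Matrix.toEuclideanLin U)).subset fun l hl => ?_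
  simp only [Set.mem_ofPred_eq] at hl ⊢
  intro h
  apply hl
  have : eigSpace U l = ⊥ := h
  simp [eigWeight, this]

theorem qhTail_eq_sum (U : Matrix ι ι ℂ) (ψ : ι → ℂ) {y : ℝ} (hy : 0 ≤ y) (s : Finset ℂ)
    (hs : ∀ l, eigWeight U ψ l ≠ 0 → l ∈ s) :
    qhTail U ψ y = ∑ l ∈ s, if l ≠ 1 ∧ y < 1 / |Complex.arg l| then eigWeight U ψ l else 0 := by
  classical
  rw [qhTail, if_neg (not_lt.2 hy), finsum_mem_def, finsum_eq_sum_of_support_subset (s := s)]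
  · refine Finset.sum_congr rfl fun l _ => ?_
    simp [Set.indicator_apply]
  · intro l hl
    apply hs
    intro h
    simp [h] at hl

/-- The hitting time is at least `1/α` if the eigenspaces for `exp (±iα)` carry weight more than
`ε`. -/
theorem le_quantumHittingTime {U₂ : Matrix ι ι ℂ} {φ₀ μ : ι → ℂ} {ε α : ℝ} (hε0 : 0 < ε)
    (hε1 : ε < 1)
    (h0 : 0 < α) (hπ : α < Real.pi)
    (hw : ε < eigWeight (U₂ * markedReflection μ) (startState φ₀ μ) (Complex.exp (α * Complex.I)) +
      eigWeight (U₂ * markedReflection μ) (startState φ₀ μ) (Complex.exp (-α * Complex.I))) :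
    1 / α ≤ quantumHittingTime U₂ φ₀ μ ε := by
  classical
  set U := U₂ * markedReflection μ
  set ψ := startState φ₀ μ
  set l₁ := Complex.exp (α * Complex.I) with hl₁
  set l₂ := Complex.exp (-α * Complex.I) with hl₂
  have a1 : Complex.arg l₁ = α := by
    rw [hl₁, Complex.arg_exp_mul_I, toIocMod_eq_self]
    constructor <;> linarith
  have a2 : Complex.arg l₂ = -α := by
    rw [hl₂, ← Complex.ofReal_neg, Complex.arg_exp_mul_I, toIocMod_eq_self]
    constructor <;> linarith
  set s := (finite_eigWeight_support U ψ).toFinset ∪ {l₁, l₂} with hs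
  have hsup : ∀ l, eigWeight U ψ l ≠ 0 → l ∈ s := fun l hl => by simp [hs, hl]
  refine le_csInf ?_ ?_
  -- The infimum is over a nonempty set: no value taken with positive probability exceeds `B`.
  · set B := ∑ l ∈ s, 1 / |Complex.arg l| with hB
    have hB0 : 0 ≤ B := Finset.sum_nonneg fun l _ => by positivity
    refine ⟨B, ?_⟩
    rw [Set.mem_ofPred_eq, qhTail_eq_sum U ψ hB0 s hsup, Finset.sum_eq_zero]
    · exact hε0.le
    · intro l hl
      rw [if_neg]
      rintro ⟨-, h⟩
      exact not_le.2 h (Finset.single_le_sum (f := fun l => 1 / |Complex.arg l|)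
        (fun l _ => by positivity) hl)
  · intro y hy
    by_contra! hlt
    rw [Set.mem_ofPred_eq] at hy
    by_cases hy0 : y < 0
    · rw [qhTail, if_pos hy0] at hy; linarith
    rw [qhTail_eq_sum U ψ (not_lt.1 hy0) s hsup] at hy
    -- Below 1/α the tail counts both eigenspaces; they are distinct because 0 < α < π.
    have hne : l₁ ≠ l₂ := fun h => by
      have := congrArg Complex.arg h
      rw [a1, a2] at this; linarith
    have h1 : l₁ ≠ 1 := fun h => by
      have := congrArg Complex.arg h
      rw [a1, Complex.arg_one] at this; linarith
    have h2 : l₂ ≠ 1 := fun h => by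
      have := congrArg Complex.arg h
      rw [a2, Complex.arg_one] at this; linarith
    have hsub : ({l₁, l₂} : Finset ℂ) ⊆ s := Finset.subset_union_right
    have := Finset.sum_le_sum_of_subset_of_nonneg hsub
      (f := fun l => if l ≠ 1 ∧ y < 1 / |Complex.arg l| then eigWeight U ψ l else 0)
      (fun l _ _ => by split_ifs <;> simp [eigWeight_nonneg])
    rw [Finset.sum_pair hne, if_pos ⟨h1, by rwa [a1, abs_of_pos h0]⟩,
      if_pos ⟨h2, by rwa [a2, abs_neg, abs_of_pos h0]⟩] at this
    linarith

/-- A plane on which `U` acts as a rotation contains an eigenvector of `U`. -/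
theorem rotation_eigenvector {U : Matrix ι ι ℂ} {b s : ι → ℂ} {x l l' : ℂ} (hb : U *ᵥ b = s)
    (hs : U *ᵥ s = (2 * x) • s - b) (h1 : l * l' = 1) (h2 : l + l' = 2 * x) :
    U *ᵥ (s - l' • b) = l • (s - l' • b) := by
  rw [Matrix.mulVec_sub, Matrix.mulVec_smul, hb, hs, smul_sub, smul_smul, h1, one_smul, ← h2,
    add_smul]
  abel

end Brackets

/-! ### The quantum analogue of a symmetric chain -/

section Lift

variable {X : Type*} [Fintype X] [DecidableEq X]

/-- The isometry `|x⟩ ↦ |x⟩|p_x⟩`. -/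
def edgeLift (P : Matrix X X ℝ) (a : X → ℂ) : X × X → ℂ := fun p => a p.1 * (Real.sqrt (P p.1 p.2) : ℂ)

/-- The adjoint of `edgeLift`. -/
def edgeProj (P : Matrix X X ℝ) (w : X × X → ℂ) : X → ℂ :=
  fun x => ∑ y, (Real.sqrt (P x y) : ℂ) * w (x, y)

/-- `P` as a complex matrix. -/
def complexify (P : Matrix X X ℝ) : Matrix X X ℂ := P.map Complex.ofReal

variable {P : Matrix X X ℝ}

theorem edgeLift_single (x : X) : edgeLift P (Pi.single x 1) = edgeVec P x := by
  ext ⟨a, b⟩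
  by_cases h : a = x
  · subst h; simp [edgeLift, edgeVec]
  · simp [edgeLift, edgeVec, h]

theorem edgeLift_sub (a b : X → ℂ) : edgeLift P (a - b) = edgeLift P a - edgeLift P b := by
  ext p; simp [edgeLift, sub_mul]

theorem edgeLift_smul (c : ℂ) (a : X → ℂ) : edgeLift P (c • a) = c • edgeLift P a := by
  ext p; simp [edgeLift, mul_assoc]

theorem edgeProj_sub (a b : X × X → ℂ) : edgeProj P (a - b) = edgeProj P a - edgeProj P b := by
  ext x; simp [edgeProj, mul_sub]

theorem edgeProj_smul (c : ℂ) (a : X × X → ℂ) : edgeProj P (c • a) = c • edgeProj P a := by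
  ext x; simp [edgeProj, Finset.mul_sum, mul_left_comm]

theorem bra_edgeLift (a : X → ℂ) (w : X × X → ℂ) :
    bra (edgeLift P a) w = bra a (edgeProj P w) := by
  rw [bra_eq_sum, bra_eq_sum, Fintype.sum_prod_type]
  refine Finset.sum_congr rfl fun x _ => ?_
  simp only [edgeLift, edgeProj, Finset.mul_sum]
  refine Finset.sum_congr rfl fun y _ => ?_
  simp [mul_assoc]

theorem bra_edgeVec (x : X) (w : X × X → ℂ) : bra (edgeVec P x) w = edgeProj P w x := by
  rw [← edgeLift_single, bra_edgeLift, bra_eq_sum]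
  rw [Finset.sum_eq_single x] <;> simp +contextual

theorem edgeProj_edgeLift (h0 : ∀ x y, 0 ≤ P x y) (h1 : ∀ x, ∑ y, P x y = 1) (a : X → ℂ) :
    edgeProj P (edgeLift P a) = a := by
  ext x
  have : ∀ y, (Real.sqrt (P x y) : ℂ) * edgeLift P a (x, y) = a x * (P x y : ℂ) := fun y => by
    have := Real.mul_self_sqrt (h0 x y)
    conv_rhs => rw [← this]
    rw [edgeLift]; push_cast; ring
  simp only [edgeProj, this]
  rw [← Finset.mul_sum, ← Complex.ofReal_sum, h1]; simp

/-- The discriminant of the walk is `P` itself, since √(P x y) √(P y x) = P x y by symmetry. -/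
theorem edgeProj_swap_edgeLift (h0 : ∀ x y, 0 ≤ P x y) (hs : P.IsSymm) (a : X → ℂ) :
    edgeProj P (edgeLift P a ∘ Prod.swap) = complexify P *ᵥ a := by
  ext x
  simp only [edgeProj, Matrix.mulVec, dotProduct]
  refine Finset.sum_congr rfl fun y _ => ?_
  have := Real.mul_self_sqrt (h0 x y)
  have h2 : P y x = P x y := hs.apply x y
  simp only [edgeLift, complexify, Function.comp, Prod.swap, Matrix.map_apply, h2]
  conv_rhs => rw [← this]
  push_cast; ring

theorem swapOp_mulVec (w : X × X → ℂ) : swapOp X *ᵥ w = w ∘ Prod.swap := by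
  ext p
  simp only [Matrix.mulVec, dotProduct, swapOp, Function.comp]
  rw [Finset.sum_eq_single p.swap]
  · simp
  · intro q _ hq
    rw [if_neg, zero_mul]
    rintro rfl
    simp at hq
  · simp

theorem sum_ketbra_edgeVec_mulVec (w : X × X → ℂ) :
    (∑ x, ketbra (edgeVec P x)) *ᵥ w = edgeLift P (edgeProj P w) := by
  rw [Matrix.sum_mulVec]
  ext ⟨a, b⟩
  simp only [ketbra_mulVec, Finset.sum_apply, Pi.smul_apply, smul_eq_mul, edgeVec, edgeLift,
    bra_edgeVec]
  simp

theorem refA_mulVec (w : X × X → ℂ) :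
    refA P *ᵥ w = (2 : ℂ) • edgeLift P (edgeProj P w) - w := by
  rw [refA, Matrix.sub_mulVec, Matrix.one_mulVec, Matrix.smul_mulVec, sum_ketbra_edgeVec_mulVec]

theorem quantumAnalogue_mulVec (w : X × X → ℂ) :
    quantumAnalogue P *ᵥ w = ((2 : ℂ) • edgeLift P (edgeProj P w) - w) ∘ Prod.swap := by
  rw [quantumAnalogue, ← Matrix.mulVec_mulVec, refA_mulVec, swapOp_mulVec]

theorem bra_swap (u w : X × X → ℂ) : bra (u ∘ Prod.swap) (w ∘ Prod.swap) = bra u w := by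
  simp only [bra_eq_sum]
  exact Equiv.sum_comp (Equiv.prodComm X X) (fun p => star (u p) * w p)

theorem stationaryVec_eq (π : X → ℝ) :
    stationaryVec P π = edgeLift P (fun x => (Real.sqrt (π x) : ℂ)) := by
  ext ⟨a, b⟩
  simp [stationaryVec, edgeLift, edgeVec]

theorem complexify_mulVec_ofReal (g : X → ℝ) :
    complexify P *ᵥ (fun x => (g x : ℂ)) = fun x => ((P *ᵥ g) x : ℂ) := by
  ext x
  simp [complexify, Matrix.mulVec, dotProduct]

theorem bra_ofReal (a b : X → ℝ) :
    bra (fun x => (a x : ℂ)) (fun x => (b x : ℂ)) = ((a ⬝ᵥ b : ℝ) : ℂ) := by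
  simp [bra_eq_sum, dotProduct]

end Lift

/-! ### The walk with a marked state -/

section Marked

variable {X : Type*} [Fintype X] [DecidableEq X] {P : Matrix X X ℝ}

/-- The quantum walk of a symmetric chain with the marked state `z`. -/
def markedWalk (P : Matrix X X ℝ) (z : X) : Matrix (X × X) (X × X) ℂ :=
  quantumAnalogue P * markedReflection (edgeVec P z)

/-- The marked reflection amounts to deleting the coordinate `z` of the projection, so the walk is
SWAP times the reflection through the span of the unmarked edge vectors only. -/
theorem markedWalk_mulVec (h0 : ∀ x y, 0 ≤ P x y) (h1 : ∀ x, ∑ y, P x y = 1) (z : X)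
    (w : X × X → ℂ) :
    markedWalk P z *ᵥ w = ((2 : ℂ) • edgeLift P (Function.update (edgeProj P w) z 0) - w) ∘
      Prod.swap := by
  rw [markedWalk, ← Matrix.mulVec_mulVec, markedReflection_mulVec, quantumAnalogue_mulVec,
    bra_edgeVec, ← edgeLift_single, edgeProj_sub, edgeProj_smul, edgeProj_edgeLift h0 h1]
  have : Function.update (edgeProj P w) z 0 = edgeProj P w - edgeProj P w z • Pi.single z 1 := by
    ext x
    by_cases h : x = z
    · subst h; simp
    · simp [h]
  rw [this, edgeLift_sub, edgeLift_sub, edgeLift_smul, edgeLift_smul]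
  congr 1
  ext p
  simp only [Pi.sub_apply, Pi.smul_apply, smul_eq_mul]
  ring

theorem markedWalk_edgeLift (h0 : ∀ x y, 0 ≤ P x y) (h1 : ∀ x, ∑ y, P x y = 1) {z : X}
    {a : X → ℂ} (ha : a z = 0) :
    markedWalk P z *ᵥ edgeLift P a = edgeLift P a ∘ Prod.swap := by
  rw [markedWalk_mulVec h0 h1, edgeProj_edgeLift h0 h1,
    show Function.update a z 0 = a by rw [← ha]; exact Function.update_eq_self z a]
  congr 1
  rw [two_smul, add_sub_cancel_right]

theorem markedWalk_swap_edgeLift (h0 : ∀ x y, 0 ≤ P x y) (h1 : ∀ x, ∑ y, P x y = 1)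
    (hs : P.IsSymm) {z : X} {a : X → ℂ} {x : ℂ} (ha : a z = 0)
    (he : ∀ y, y ≠ z → (complexify P *ᵥ a) y = x * a y) :
    markedWalk P z *ᵥ (edgeLift P a ∘ Prod.swap) =
      (2 * x) • (edgeLift P a ∘ Prod.swap) - edgeLift P a := by
  have : Function.update (complexify P *ᵥ a) z 0 = x • a := by
    ext y
    by_cases h : y = z
    · subst h; simp [ha]
    · simp [h, he y h]
  rw [markedWalk_mulVec h0 h1, edgeProj_swap_edgeLift h0 hs, this, edgeLift_smul, smul_smul]
  ext p
  simp

variable {v : X → X → ℝ} {l : X → ℝ} {i₀ : X}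

theorem SpectralChain.complex_absorbed_eigenvalue_le (H : SpectralChain P v l i₀) {ℓ : ℝ}
    (hn : 2 ≤ Fintype.card X) (hℓ : IsPrincipalRoot l i₀ ℓ) {z : X} {b : X → ℂ} {x : ℝ}
    (hz : b z = 0) (hb : b ≠ 0) (he : ∀ y, y ≠ z → (complexify P *ᵥ b) y = x * b y) : x ≤ ℓ := by
  have hre : ∀ y, (complexify P *ᵥ b) y =
      ⟨(P *ᵥ fun x => (b x).re) y, (P *ᵥ fun x => (b x).im) y⟩ := fun y => by
    apply Complex.ext <;> simp [complexify, Matrix.mulVec, dotProduct]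
  have h1 : ∀ y, y ≠ z → (P *ᵥ fun x => (b x).re) y = x * (b y).re := fun y hy => by
    have := congrArg Complex.re (he y hy)
    rw [hre] at this
    simpa using this
  have h2 : ∀ y, y ≠ z → (P *ᵥ fun x => (b x).im) y = x * (b y).im := fun y hy => by
    have := congrArg Complex.im (he y hy)
    rw [hre] at this
    simpa using this
  by_cases h : (fun x => (b x).re) = 0
  · refine H.absorbed_eigenvalue_le hn hℓ (w := fun x => (b x).im) (by simp [hz]) (fun h' => ?_) h2
    apply hb
    ext y
    exact Complex.ext (congrFun h y) (congrFun h' y)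
  · exact H.absorbed_eigenvalue_le hn hℓ (w := fun x => (b x).re) (by simp [hz]) h h1

theorem exp_phase_mul (α : ℝ) :
    Complex.exp (α * Complex.I) * Complex.exp (-α * Complex.I) = 1 := by
  rw [← Complex.exp_add]; simp

theorem exp_phase_add (α : ℝ) :
    Complex.exp (α * Complex.I) + Complex.exp (-α * Complex.I) = 2 * (Real.cos α : ℂ) := by
  rw [Complex.ofReal_cos, Complex.cos]; ring

theorem star_exp_phase (α : ℝ) :
    star (Complex.exp (α * Complex.I)) = Complex.exp (-α * Complex.I) := by
  rw [Complex.star_def, ← Complex.exp_conj]; simp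

/-- Projecting the eigenvector to the unmarked edge vectors yields an eigenvector of the absorbed
chain for cos α, unless the projection vanishes. -/
theorem SpectralChain.eigenphase_le (H : SpectralChain P v l i₀) {ℓ : ℝ}
    (hn : 2 ≤ Fintype.card X) (hℓ : IsPrincipalRoot l i₀ ℓ) {z : X} {α : ℝ} (h0 : 0 < α)
    (hπ : α ≤ Real.pi) {w : X × X → ℂ} (hw : w ≠ 0)
    (he : markedWalk P z *ᵥ w = Complex.exp (α * Complex.I) • w) : Real.cos α ≤ ℓ := by
  have hℓ0 := H.principalRoot_nonneg hn hℓ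
  set e := Complex.exp (α * Complex.I) with he_def
  set e' := Complex.exp (-α * Complex.I) with he'_def
  have hee : e * e' = 1 := exp_phase_mul α
  rw [markedWalk_mulVec H.nonneg H.row_sum] at he
  set b := Function.update (edgeProj P w) z 0 with hb
  have hswap : (2 : ℂ) • edgeLift P b - w = e • (w ∘ Prod.swap) := by
    have := congrArg (fun f => f ∘ Prod.swap) he
    ext p
    have := congrFun this p
    simpa using this
  -- With vanishing projection the walk acts on `w` as -SWAP, so e² = 1; as 0 < α ≤ π this leaves
  -- cos α = -1, below ℓ ≥ 0.
  by_cases hb0 : b = 0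
  · have h1 : ∀ p, -(w p) = e * w p.swap := fun p => by
      have := congrFun hswap p
      simpa [hb0, edgeLift] using this
    obtain ⟨p, hp⟩ : ∃ p, w p ≠ 0 := by
      by_contra! h; exact hw (funext h)
    have h2 := h1 p
    have h3 := h1 p.swap
    rw [Prod.swap_swap] at h3
    have hsq : e * e = 1 := by
      apply mul_right_cancel₀ hp
      linear_combination (-e) * h3 + h2
    have hc : Real.cos α * Real.cos α * 2 - 1 = 1 := by
      have h4 : e' = e := by
        calc e' = e * e * e' := by rw [hsq, one_mul]
          _ = e := by rw [mul_assoc, hee, mul_one]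
      have h5 := exp_phase_add α
      rw [← he_def, ← he'_def, h4] at h5
      have h6 : e = (Real.cos α : ℂ) := by linear_combination h5 / 2
      rw [h6] at hsq
      have : Real.cos α * Real.cos α = 1 := by exact_mod_cast hsq
      linarith
    have hlt : Real.cos α < 1 := by
      rw [← Real.cos_zero]
      exact Real.cos_lt_cos_of_nonneg_of_le_pi le_rfl hπ h0
    nlinarith
  · have hq1 : ∀ x, x ≠ z → b x = e * edgeProj P (w ∘ Prod.swap) x := fun x hx => by
      have h := congrArg (fun f => edgeProj P f x) hswap
      simp only [edgeProj_sub, edgeProj_smul, edgeProj_edgeLift H.nonneg H.row_sum, Pi.sub_apply,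
        Pi.smul_apply, smul_eq_mul] at h
      rw [← h, hb]
      simp [hx]; ring
    have hq2 : ∀ x, x ≠ z →
        2 * (complexify P *ᵥ b) x - edgeProj P (w ∘ Prod.swap) x = e * b x := fun x hx => by
      have h : edgeProj P ((2 : ℂ) • (edgeLift P b ∘ Prod.swap) - w ∘ Prod.swap) x =
        edgeProj P (e • w) x := congrArg (fun f => edgeProj P f x) he
      simp only [edgeProj_sub, edgeProj_smul, edgeProj_swap_edgeLift H.nonneg H.symm, Pi.sub_apply,
        Pi.smul_apply, smul_eq_mul] at h
      rw [h, hb]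
      simp [hx]
    refine H.complex_absorbed_eigenvalue_le hn hℓ (z := z) (b := b) (by simp [hb]) hb0
      fun y hy => ?_
    have h1 := hq1 y hy
    have h2 := hq2 y hy
    have h5 := exp_phase_add α
    rw [← he_def, ← he'_def] at h5
    have h6 : edgeProj P (w ∘ Prod.swap) y = e' * b y := by
      rw [h1]; linear_combination (- edgeProj P (w ∘ Prod.swap) y) * hee
    rw [h6] at h2
    linear_combination h2 / 2 + (b y) / 2 * h5

/-- The principal eigenvectors of the marked walk, and their overlap with the start state. -/
theorem SpectralChain.principal_eigenvector (H : SpectralChain P v l i₀) {ℓ : ℝ}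
    (hn : 2 ≤ Fintype.card X) (hℓ : IsPrincipalRoot l i₀ ℓ) {z : X} {e e' : ℂ}
    (hee : e * e' = 1) (hadd : e + e' = 2 * (ℓ : ℂ)) (hstar : star e' = e) :
    ∃ f : X × X → ℂ, markedWalk P z *ᵥ f = e • f ∧ 0 < (bra f f).re ∧
      ‖bra f (edgeLift P (fun x => if x = z then 0 else (Real.sqrt (1 / Fintype.card X) : ℂ)))‖ ^ 2
        = (bra f f).re / (2 * (1 + (1 - ℓ) ^ 2 * ∑ i ∈ Finset.univ.erase i₀,
            (1 / (ℓ - l i)) ^ 2)) := by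
  obtain ⟨g, hgz, hPg, hgg, hg1⟩ := H.exists_principal_vector hℓ z
  set S := ∑ i ∈ Finset.univ.erase i₀, (1 / (ℓ - l i)) ^ 2 with hS
  have hℓ0 := H.principalRoot_nonneg hn hℓ
  have hℓ1 := hℓ.lt_one
  have hS0 : 0 ≤ S := Finset.sum_nonneg fun i _ => sq_nonneg _
  have hcard : (0 : ℝ) < Fintype.card X := by
    have : (2 : ℝ) ≤ Fintype.card X := by exact_mod_cast hn
    linarith
  set G : X → ℂ := fun x => (g x : ℂ) with hG
  have hPG : ∀ y, (complexify P *ᵥ G) y = ℓ * G y - if y = z then 1 else 0 := fun y => by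
    rw [hG, complexify_mulVec_ofReal]
    simp only [hPg]
    split_ifs <;> simp
  have hb := markedWalk_edgeLift H.nonneg H.row_sum (a := G) (z := z) (by simp [hG, hgz])
  have hs := markedWalk_swap_edgeLift H.nonneg H.row_sum H.symm (a := G) (z := z) (x := (ℓ : ℂ))
    (by simp [hG, hgz]) (fun y hy => by rw [hPG, if_neg hy, sub_zero])
  set b := edgeLift P G with hbdef
  set s := edgeLift P G ∘ Prod.swap with hsdef
  have hGG : bra G G = ((g ⬝ᵥ g : ℝ) : ℂ) := bra_ofReal g g
  have hbb : bra b b = ((g ⬝ᵥ g : ℝ) : ℂ) := by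
    rw [hbdef, bra_edgeLift, edgeProj_edgeLift H.nonneg H.row_sum, hGG]
  have hss : bra s s = ((g ⬝ᵥ g : ℝ) : ℂ) := by rw [hsdef, bra_swap, ← hbdef, hbb]
  have hPgv : P *ᵥ g = fun x => ℓ * g x - if x = z then 1 else 0 := funext hPg
  have hPgdot : ∀ a : X → ℝ, a z = 0 → a ⬝ᵥ (P *ᵥ g) = ℓ * (a ⬝ᵥ g) := fun a ha => by
    rw [hPgv]
    simp only [dotProduct, mul_sub, Finset.sum_sub_distrib, Finset.mul_sum, mul_ite, mul_one,
      mul_zero, Finset.sum_ite_eq', Finset.mem_univ, if_true, ha, sub_zero]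
    exact Finset.sum_congr rfl fun x _ => by ring
  have hbs : ∀ a : X → ℝ, a z = 0 → bra (edgeLift P fun x => (a x : ℂ)) s =
      ((ℓ * (a ⬝ᵥ g) : ℝ) : ℂ) := fun a ha => by
    rw [hsdef, bra_edgeLift, edgeProj_swap_edgeLift H.nonneg H.symm, hG,
      complexify_mulVec_ofReal, bra_ofReal, hPgdot a ha]
  have hbs1 := hbs g hgz
  rw [← hG, ← hbdef] at hbs1
  have hsb1 : bra s b = ((ℓ * (g ⬝ᵥ g) : ℝ) : ℂ) := by
    rw [← star_bra, hbs1]; simp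
  have hff : bra (s - e' • b) (s - e' • b) = ((2 * (1 - ℓ ^ 2) * (g ⬝ᵥ g) : ℝ) : ℂ) := by
    rw [bra_sub_left, bra_sub_right, bra_sub_right, bra_smul_left, bra_smul_left, bra_smul_right,
      bra_smul_right, hss, hsb1, hbs1, hbb, hstar]
    push_cast
    linear_combination ((g ⬝ᵥ g : ℝ) : ℂ) * hee - (ℓ : ℂ) * ((g ⬝ᵥ g : ℝ) : ℂ) * hadd
  have hggpos : 0 < g ⬝ᵥ g := by
    rw [hgg]
    have : 0 < 1 / (1 - ℓ) ^ 2 := by have : 0 < 1 - ℓ := by linarith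
                                     positivity
    positivity
  -- Since `g z = 0` and `g` satisfies the eigenvalue equation away from `z`, the walk acts on the
  -- span of the lift `b` and its swap `s` as a rotation with trace 2ℓ.
  refine ⟨s - e' • b, rotation_eigenvector hb hs hee hadd, ?_, ?_⟩
  · rw [hff, Complex.ofReal_re]
    have : 0 < 1 - ℓ ^ 2 := by nlinarith
    positivity
  · set δ := Real.sqrt (1 / Fintype.card X) with hδ
    set u : X → ℝ := fun x => if x = z then 0 else δ with hu
    have huz : u z = 0 := by simp [hu]
    have hcast : (fun x => if x = z then (0 : ℂ) else (δ : ℂ)) = fun x => (u x : ℂ) := by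
      ext x; simp only [hu]; split_ifs <;> simp
    have hug : u ⬝ᵥ g = -(δ / (1 - ℓ)) := by
      have : ∀ x, u x * g x = δ * g x := fun x => by
        by_cases h : x = z
        · rw [h, huz, hgz]; simp
        · simp [hu, h]
      simp only [dotProduct, this, ← Finset.mul_sum, hg1]
      ring
    rw [hcast, hff, Complex.ofReal_re]
    have h1 : bra (s - e' • b) (edgeLift P fun x => (u x : ℂ)) =
        ((ℓ : ℂ) - e) * ((u ⬝ᵥ g : ℝ) : ℂ) := by
      rw [← star_bra, bra_sub_right, bra_smul_right, hbs u huz, hbdef, bra_edgeLift,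
        edgeProj_edgeLift H.nonneg H.row_sum, hG, bra_ofReal, star_sub, star_mul', hstar]
      simp only [Complex.star_def, Complex.conj_ofReal]
      push_cast; ring
    have h2 : ‖(ℓ : ℂ) - e‖ ^ 2 = 1 - ℓ ^ 2 := by
      have h3 : ((‖(ℓ : ℂ) - e‖ ^ 2 : ℝ) : ℂ) = ((1 - ℓ ^ 2 : ℝ) : ℂ) := by
        rw [← Complex.normSq_eq_norm_sq, ← Complex.mul_conj, map_sub, Complex.conj_ofReal]
        have : (starRingEnd ℂ) e = e' := by rw [← hstar]; simp
        rw [this]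
        push_cast
        linear_combination hee - (ℓ : ℂ) * hadd
      exact_mod_cast h3
    have hδ2 : δ ^ 2 = 1 / Fintype.card X := Real.sq_sqrt (by positivity)
    rw [h1, norm_mul, mul_pow, h2, Complex.norm_real, Real.norm_eq_abs, sq_abs, hug, neg_sq,
      div_pow, hδ2, hgg]
    have h4 : (1 - ℓ) ≠ 0 := by linarith
    have h5 : (1 + (1 - ℓ) ^ 2 * S) ≠ 0 := by positivity
    field_simp

theorem startState_uniform (h0 : ∀ x y, 0 ≤ P x y) (h1 : ∀ x, ∑ y, P x y = 1) {π : X → ℝ}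
    (hπ : ∀ x, π x = 1 / Fintype.card X) (z : X) :
    startState (stationaryVec P π) (edgeVec P z) =
      edgeLift P (fun x => if x = z then 0 else (Real.sqrt (1 / Fintype.card X) : ℂ)) := by
  rw [startState, bra_edgeVec, stationaryVec_eq, edgeProj_edgeLift h0 h1, ← edgeLift_single,
    ← edgeLift_smul, ← edgeLift_sub]
  congr 1
  ext x
  by_cases h : x = z
  · subst h; simp
  · simp [h, hπ]

theorem SpectralChain.principalPhase_eq (H : SpectralChain P v l i₀) {ℓ : ℝ}
    (hn : 2 ≤ Fintype.card X) (hℓ : IsPrincipalRoot l i₀ ℓ) (z : X) :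
    principalPhase (markedWalk P z) = Real.arccos ℓ := by
  have hℓ0 := H.principalRoot_nonneg hn hℓ
  have hℓ1 := hℓ.lt_one
  have hcos := Real.cos_arccos (x := ℓ) (by linarith) hℓ1.le
  refine IsLeast.csInf_eq ⟨⟨Real.arccos_pos.2 hℓ1, Real.arccos_le_pi ℓ, ?_⟩, ?_⟩
  · obtain ⟨f, hf, hff, -⟩ := H.principal_eigenvector hn hℓ (z := z)
      (exp_phase_mul (Real.arccos ℓ)) (by rw [exp_phase_add, hcos])
      (by have := star_exp_phase (-Real.arccos ℓ); simpa using this)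
    intro hbot
    rw [mul_comm] at hf
    have hm := mem_eigSpace.2 hf
    rw [hbot, Submodule.mem_bot] at hm
    have : f = 0 := by simpa using hm
    rw [this] at hff
    simp [bra] at hff
  · rintro α ⟨h0, hπ, hne⟩
    obtain ⟨w, hw, hw0⟩ := Submodule.exists_mem_ne_zero_of_ne_bot hne
    have hw2 : markedWalk P z *ᵥ w.ofLp = Complex.exp (Complex.I * α) • w.ofLp :=
      mem_eigSpace.1 (by simpa using hw)
    have hw3 : w.ofLp ≠ 0 := fun h => hw0 (by
      apply WithLp.ofLp_injective 2; simpa using h)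
    rw [mul_comm] at hw2
    have := H.eigenphase_le hn hℓ h0 hπ hw3 hw2
    rw [← Real.arccos_cos h0.le hπ]
    exact Real.arccos_le_arccos this

/-- Each of the two eigenspaces carries weight at least 1/(2(1 + (1 - ℓ)² S)) with S = ∑ 1/(ℓ -
lᵢ)², and (1 - ℓ)² S ≤ 1. Together they carry at least 1/2, strictly more if n ≥ 3. -/
theorem SpectralChain.le_hittingTime (H : SpectralChain P v l i₀) {ℓ : ℝ}
    (hn : 2 ≤ Fintype.card X) (hℓ : IsPrincipalRoot l i₀ ℓ) {π : X → ℝ}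
    (hπ : ∀ x, π x = 1 / Fintype.card X) (z : X) {ε : ℝ} (h0 : 0 < ε) (h1 : ε ≤ 1 / 2)
    (h2 : Fintype.card X = 2 → ε < 1 / 2) :
    1 / Real.arccos ℓ ≤
      quantumHittingTime (quantumAnalogue P) (stationaryVec P π) (edgeVec P z) ε := by
  have hℓ0 := H.principalRoot_nonneg hn hℓ
  have hℓ1 := hℓ.lt_one
  have hcos := Real.cos_arccos (x := ℓ) (by linarith) hℓ1.le
  refine le_quantumHittingTime h0 (by linarith) (Real.arccos_pos.2 hℓ1)
    (lt_of_le_of_lt (Real.arccos_le_pi_div_two.2 hℓ0) (by linarith [Real.pi_pos])) ?_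
  rw [startState_uniform H.nonneg H.row_sum hπ]
  change _ < eigWeight (markedWalk P z) _ _ + eigWeight (markedWalk P z) _ _
  set S := ∑ i ∈ Finset.univ.erase i₀, (1 / (ℓ - l i)) ^ 2 with hS
  have hS0 : 0 ≤ S := Finset.sum_nonneg fun i _ => sq_nonneg _
  have hpos : 0 < 1 + (1 - ℓ) ^ 2 * S := by positivity
  have key : ∀ e e' : ℂ, e * e' = 1 → e + e' = 2 * (ℓ : ℂ) → star e' = e →
      1 / (2 * (1 + (1 - ℓ) ^ 2 * S)) ≤ eigWeight (markedWalk P z)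
        (edgeLift P (fun x => if x = z then 0 else (Real.sqrt (1 / Fintype.card X) : ℂ))) e := by
    intro e e' ha hb hc
    obtain ⟨f, hf, hff, hfu⟩ := H.principal_eigenvector hn hℓ (z := z) ha hb hc
    have := le_eigWeight hf
      (edgeLift P (fun x => if x = z then 0 else (Real.sqrt (1 / Fintype.card X) : ℂ)))
    rw [hfu, div_eq_mul_one_div] at this
    exact le_of_mul_le_mul_left this hff
  have k1 := key _ _ (exp_phase_mul (Real.arccos ℓ)) (by rw [exp_phase_add, hcos])
      (by have := star_exp_phase (-Real.arccos ℓ); simpa using this)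
  have k2 := key _ _ ((mul_comm _ _).trans (exp_phase_mul (Real.arccos ℓ)))
    (by rw [add_comm, exp_phase_add, hcos]) (star_exp_phase _)
  refine lt_of_lt_of_le ?_ (add_le_add k1 k2)
  rw [← add_div, one_add_one_eq_two, ← div_div, div_self two_ne_zero]
  have hq : 0 < (1 - ℓ) ^ 2 := by have : 0 < 1 - ℓ := by linarith
                                  positivity
  have hw := H.principal_weight hℓ
  rw [← hS, le_div_iff₀ hq] at hw
  by_cases hc : Fintype.card X = 2
  · refine (h2 hc).trans_le (one_div_le_one_div_of_le hpos (by linarith))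
  · have hw' := H.principal_weight_lt (by omega) hℓ
    rw [← hS, lt_div_iff₀ hq] at hw'
    exact h1.trans_lt (one_div_lt_one_div_of_lt hpos (by linarith))

end Marked

/-! ### Compression of a symmetric contraction to a hyperplane -/

section Compression

variable {ι : Type*} [Fintype ι] [DecidableEq ι]

/-- The compression of a symmetric contraction `M` to the orthogonal complement of a unit vector
`e` has an orthonormal eigenbasis. -/
theorem exists_compression_eigenbasis {M : Matrix ι ι ℝ} (hM : M.IsSymm)
    (hle : ∀ a, |a ⬝ᵥ (M *ᵥ a)| ≤ a ⬝ᵥ a) {e : ι → ℝ} (he : e ⬝ᵥ e = 1) :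
    ∃ (J : Finset ι) (q : ι → ι → ℝ) (x : ι → ℝ),
      (∀ j ∈ J, e ⬝ᵥ q j = 0 ∧ q j ⬝ᵥ q j = 1 ∧
        M *ᵥ q j = x j • q j + (e ⬝ᵥ (M *ᵥ q j)) • e ∧ |x j| ≤ 1) ∧
      ∀ a, a = (e ⬝ᵥ a) • e + ∑ j ∈ J, (q j ⬝ᵥ a) • q j := by
  set w := M *ᵥ e with hw
  -- `Q` is the compression of `M` to the complement of `e`, with `e` itself moved to the eigenvalue
  -- -5. Any value outside [-1, 1] would separate it from the spectrum of the compression.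
  set Q : Matrix ι ι ℝ := M - Matrix.vecMulVec e w - Matrix.vecMulVec w e +
    (e ⬝ᵥ w - 5) • Matrix.vecMulVec e e with hQ
  have hQs : Q.IsSymm := by
    ext i j
    have := hM.apply i j
    simp only [hQ, Matrix.transpose_apply, Matrix.add_apply, Matrix.sub_apply, Matrix.smul_apply,
      Matrix.vecMulVec_apply, smul_eq_mul, this]
    ring
  have hQa : ∀ a, Q *ᵥ a = M *ᵥ a - (w ⬝ᵥ a) • e - (e ⬝ᵥ a) • w +
      ((e ⬝ᵥ w - 5) * (e ⬝ᵥ a)) • e := fun a => by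
    simp only [hQ, Matrix.add_mulVec, Matrix.sub_mulVec, Matrix.smul_mulVec,
      Matrix.vecMulVec_mulVec, op_smul_eq_smul, smul_smul]
  have hQe : Q *ᵥ e = (-5 : ℝ) • e := by
    rw [hQa, he, ← hw, dotProduct_comm w e]
    ext i
    simp only [Pi.add_apply, Pi.sub_apply, Pi.smul_apply, smul_eq_mul]
    ring
  obtain ⟨q, x, hq, ho, hx⟩ := exists_eigenbasis Q hQs
  have hwM : ∀ a, w ⬝ᵥ a = e ⬝ᵥ (M *ᵥ a) := fun a => by
    rw [hw, ← dotProduct_mulVec_symm hM]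
  have horth : ∀ (a : ι → ℝ) (y : ℝ), Q *ᵥ a = y • a → y ≠ -5 → e ⬝ᵥ a = 0 := fun a y ha hy => by
    have := eigen_dotProduct hQs hQe a
    rw [ha, dotProduct_smul, smul_eq_mul] at this
    have h : (y + 5) * (e ⬝ᵥ a) = 0 := by linarith
    exact (mul_eq_zero.1 h).resolve_left fun h => hy (by linarith)
  have hMq : ∀ (a : ι → ℝ) (y : ℝ), Q *ᵥ a = y • a → e ⬝ᵥ a = 0 →
      M *ᵥ a = y • a + (e ⬝ᵥ (M *ᵥ a)) • e := fun a y ha h0 => by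
    rw [hQa, h0, hwM] at ha
    rw [← ha]
    simp
  have hcontr : ∀ (a : ι → ℝ) (y : ℝ), Q *ᵥ a = y • a → e ⬝ᵥ a = 0 → |y| * (a ⬝ᵥ a) ≤ a ⬝ᵥ a :=
      fun a y ha h0 => by
    have h1 := hle a
    rw [hMq a y ha h0, dotProduct_add, dotProduct_smul, dotProduct_smul, dotProduct_comm a e, h0,
      smul_eq_mul, smul_zero, add_zero, abs_mul] at h1
    have : 0 ≤ a ⬝ᵥ a := dotProduct_self_star_nonneg a
    rwa [abs_of_nonneg this] at h1
  refine ⟨Finset.univ.filter fun j => x j ≠ -5, q, x, fun j hj => ?_, fun a => ?_⟩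
  · have hj5 : x j ≠ -5 := (Finset.mem_filter.1 hj).2
    have h0 := horth _ _ (hq j) hj5
    have h1 : q j ⬝ᵥ q j = 1 := by rw [ho, if_pos rfl]
    refine ⟨h0, h1, hMq _ _ (hq j) h0, ?_⟩
    have := hcontr _ _ (hq j) h0
    rwa [h1, mul_one] at this
  -- The part of such an eigenvector orthogonal to `e` would be an eigenvector of a contraction for
  -- -5, so it is zero.
  · have hpar : ∀ j, x j = -5 → q j = (e ⬝ᵥ q j) • e := fun j hj => by
      set q' := q j - (e ⬝ᵥ q j) • e with hq'
      have h0 : e ⬝ᵥ q' = 0 := by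
        rw [hq', dotProduct_sub, dotProduct_smul, he, smul_eq_mul, mul_one, sub_self]
      have h1 : Q *ᵥ q' = (-5 : ℝ) • q' := by
        rw [hq', Matrix.mulVec_sub, Matrix.mulVec_smul, hq, hQe, hj, smul_sub, smul_comm]
      have h2 := hcontr _ _ h1 h0
      have h3 : q' ⬝ᵥ q' = 0 := by
        have : 0 ≤ q' ⬝ᵥ q' := dotProduct_self_star_nonneg q'
        norm_num at h2
        linarith
      have h4 : q' = 0 := dotProduct_self_eq_zero.1 h3
      rw [hq', sub_eq_zero] at h4
      exact h4
    have hsplit : ∀ a, a = ∑ j ∈ Finset.univ.filter (fun j => ¬ x j ≠ -5), (q j ⬝ᵥ a) • q j +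
        ∑ j ∈ Finset.univ.filter (fun j => x j ≠ -5), (q j ⬝ᵥ a) • q j := fun a => by
      rw [add_comm, Finset.sum_filter_add_sum_filter_not]
      exact hx a
    have hS : ∀ a, ∑ j ∈ Finset.univ.filter (fun j => ¬ x j ≠ -5), (q j ⬝ᵥ a) • q j =
        (∑ j ∈ Finset.univ.filter (fun j => ¬ x j ≠ -5), (e ⬝ᵥ q j) ^ 2 * (e ⬝ᵥ a)) • e :=
        fun a => by
      rw [Finset.sum_smul]
      refine Finset.sum_congr rfl fun j hj => ?_
      have hj5 : x j = -5 := not_not.1 (Finset.mem_filter.1 hj).2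
      have := hpar j hj5
      set c := e ⬝ᵥ q j
      rw [this, smul_dotProduct, smul_smul, smul_eq_mul]
      congr 1; ring
    have hone : ∑ j ∈ Finset.univ.filter (fun j => ¬ x j ≠ -5), (e ⬝ᵥ q j) ^ 2 = 1 := by
      have h1 := hsplit e
      rw [hS, Finset.sum_eq_zero (s := Finset.univ.filter (fun j => x j ≠ -5)), add_zero] at h1
      · have h2 := congrArg (fun a => e ⬝ᵥ a) h1
        simp only [dotProduct_smul, he, smul_eq_mul, mul_one] at h2
        exact h2.symm
      · intro j hj
        rw [dotProduct_comm, horth _ _ (hq j) (Finset.mem_filter.1 hj).2, zero_smul]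
    conv_lhs => rw [hsplit a, hS, ← Finset.sum_mul, hone, one_mul]

end Compression

/-! ### The discriminant of the modified walk -/

section Discriminant

variable {X : Type*} [Fintype X] [DecidableEq X] {P : Matrix X X ℝ} {v : X → X → ℝ} {l : X → ℝ}
  {i₀ : X}

/-- `-1 ⊕ P`. -/
def blockChain (P : Matrix X X ℝ) : Matrix (X ⊕ X) (X ⊕ X) ℝ := Matrix.fromBlocks (-1) 0 0 P

/-- The coordinates of the marked state of the modified walk. -/
def markedVec (z : X) (c s : ℝ) : X ⊕ X → ℝ :=
  Sum.elim (-(s • Pi.single z 1)) (c • Pi.single z 1)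

theorem blockChain_mulVec (a : X ⊕ X → ℝ) :
    blockChain P *ᵥ a = Sum.elim (-(a ∘ Sum.inl)) (P *ᵥ (a ∘ Sum.inr)) := by
  rw [blockChain, Matrix.fromBlocks_mulVec]
  simp [Matrix.neg_mulVec]

theorem dotProduct_sum_type (a b : X ⊕ X → ℝ) :
    a ⬝ᵥ b = (a ∘ Sum.inl) ⬝ᵥ (b ∘ Sum.inl) + (a ∘ Sum.inr) ⬝ᵥ (b ∘ Sum.inr) := by
  simp [dotProduct]

theorem markedVec_dotProduct (z : X) (c s : ℝ) (a : X ⊕ X → ℝ) :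
    markedVec z c s ⬝ᵥ a = -(s * a (Sum.inl z)) + c * a (Sum.inr z) := by
  rw [dotProduct_sum_type]
  simp [markedVec]

theorem SpectralChain.abs_blockChain_le (H : SpectralChain P v l i₀) (a : X ⊕ X → ℝ) :
    |a ⬝ᵥ (blockChain P *ᵥ a)| ≤ a ⬝ᵥ a := by
  have h1 : ∀ b : X → ℝ, |b ⬝ᵥ (P *ᵥ b)| ≤ b ⬝ᵥ b := fun b => by
    rw [parseval_of_expansion H.expansion b (P *ᵥ b), parseval_of_expansion H.expansion b b]
    refine (Finset.abs_sum_le_sum_abs _ _).trans (Finset.sum_le_sum fun i _ => ?_)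
    rw [eigen_dotProduct H.symm (H.eigen i), mul_left_comm, abs_mul, abs_mul_self]
    have : |l i| ≤ 1 := by
      rw [abs_le]
      refine ⟨(H.neg_one_lt i).le, ?_⟩
      by_cases hi : i = i₀
      · rw [hi, H.top]
      · exact (H.lt_one i hi).le
    exact mul_le_of_le_one_left (mul_self_nonneg _) this
  rw [dotProduct_sum_type a a, dotProduct_sum_type, blockChain_mulVec, Sum.elim_comp_inl,
    Sum.elim_comp_inr, dotProduct_neg]
  refine (abs_add_le _ _).trans (add_le_add ?_ (h1 _))
  have h0 : 0 ≤ (a ∘ Sum.inl) ⬝ᵥ (a ∘ Sum.inl) := dotProduct_self_star_nonneg (a ∘ Sum.inl)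
  rw [abs_neg, abs_of_nonneg h0]

/-- An eigenvector of the compression of `-1 ⊕ P` to the complement of the marked vector. -/
structure IsCompressedEigen (P : Matrix X X ℝ) (z : X) (c s : ℝ) (q : X ⊕ X → ℝ) (x r : ℝ) :
    Prop where
  orth : markedVec z c s ⬝ᵥ q = 0
  norm_one : q ⬝ᵥ q = 1
  left : ∀ y, (1 + x) * q (Sum.inl y) = r * s * (Pi.single z 1 : X → ℝ) y
  right : ∀ y, (P *ᵥ (q ∘ Sum.inr)) y = x * q (Sum.inr y) + r * c * (Pi.single z 1 : X → ℝ) y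

section

variable {z : X} {c s : ℝ} {q : X ⊕ X → ℝ} {x r : ℝ}

theorem SpectralChain.compressed_coeff (H : SpectralChain P v l i₀)
    (h : IsCompressedEigen P z c s q x r) (i : X) :
    (l i - x) * (v i ⬝ᵥ (q ∘ Sum.inr)) = r * c * v i z := by
  have h1 := eigen_dotProduct H.symm (H.eigen i) (q ∘ Sum.inr)
  have h2 : P *ᵥ (q ∘ Sum.inr) = x • (q ∘ Sum.inr) + (r * c) • Pi.single z 1 := by
    ext y; simpa using h.right y
  rw [h2, dotProduct_add, dotProduct_smul, dotProduct_smul, dotProduct_single, smul_eq_mul,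
    smul_eq_mul, mul_one] at h1
  linarith

theorem IsCompressedEigen.right_eq (h : IsCompressedEigen P z c s q x r) (hc : c ≠ 0)
    (hx : 1 + x ≠ 0) : q (Sum.inr z) = r * s ^ 2 / (c * (1 + x)) := by
  have h1 := h.left z
  have h2 := h.orth
  rw [markedVec_dotProduct] at h2
  simp only [Pi.single_eq_same, mul_one] at h1
  rw [eq_div_iff (mul_ne_zero hc hx)]
  linear_combination (1 + x) * h2 + s * h1

/-- The value of `q` at `z` in the second block is computed twice: from orthogonality and the first
block, and from the spectral expansion, where transitivity turns the weights vᵢ(z)² into 1/n. -/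
theorem SpectralChain.secular_equation (H : SpectralChain P v l i₀)
    (h : IsCompressedEigen P z c s q x r) (hc : c ≠ 0) (hx : 1 + x ≠ 0) (hr : r ≠ 0)
    (hl : ∀ i, l i ≠ x) :
    1 / (1 - x) + ∑ i ∈ Finset.univ.erase i₀, 1 / (l i - x) =
      Fintype.card X * (s / c) ^ 2 / (1 + x) := by
  have hn : Nonempty X := ⟨z⟩
  have hcard : (Fintype.card X : ℝ) ≠ 0 := by exact_mod_cast Fintype.card_ne_zero
  have h1 := H.diag_split (fun y => 1 / (y - x)) z
  have h2 : q (Sum.inr z) = r * c * ∑ i, v i z ^ 2 * (1 / (l i - x)) := by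
    have := H.apply_eq (q ∘ Sum.inr) z
    rw [Function.comp_apply] at this
    rw [this, Finset.mul_sum]
    refine Finset.sum_congr rfl fun i _ => ?_
    have h3 := H.compressed_coeff h i
    have h4 := sub_ne_zero.2 (hl i)
    rw [mul_comm, ← eq_div_iff h4] at h3
    rw [h3]; ring
  rw [h1, h.right_eq hc hx] at h2
  field_simp at h2 ⊢
  linarith

/-- For x > ℓ the sum in the secular equation is at least -1/(1 - ℓ), while the right side is at
most 1/(100(1 - ℓ)) by the division by 10 in the definition of θ. Hence 1/(1 - x) ≤ 1.01/(1 - ℓ). -/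
theorem SpectralChain.compressed_eigenvalue_le (H : SpectralChain P v l i₀) {ℓ : ℝ}
    (hℓ : IsPrincipalRoot l i₀ ℓ) (hℓ0 : 0 ≤ ℓ)
    (h : IsCompressedEigen P z c s q x r) (hc : c ≠ 0) (hr : r ≠ 0) (hx1 : x < 1)
    (hτ : Fintype.card X * (s / c) ^ 2 = (1 + ℓ) / (1 - ℓ) / 100) :
    99 / 100 * (1 - ℓ) ≤ 1 - x := by
  have hℓ1 := hℓ.lt_one
  rcases le_or_gt x ℓ with hle | hlt
  · linarith
  have hl : ∀ i, l i ≠ x := fun i => by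
    by_cases hi : i = i₀
    · rw [hi, H.top]; exact hx1.ne'
    · exact ((hℓ.lt i hi).trans hlt).ne
  have h1 := H.secular_equation h hc (by linarith) hr hl
  have h2 := H.sum_inv_le hℓ hlt.le
  have h3 : ∑ i ∈ Finset.univ.erase i₀, 1 / (l i - x) =
      - ∑ i ∈ Finset.univ.erase i₀, 1 / (x - l i) := by
    rw [← Finset.sum_neg_distrib]
    exact Finset.sum_congr rfl fun i _ => by rw [← neg_sub, div_neg]
  rw [h3, hτ] at h1
  have h4 : (1 + ℓ) / (1 - ℓ) / 100 / (1 + x) ≤ 1 / 100 * (1 / (1 - ℓ)) := by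
    have ha : (1 + ℓ) / (1 + x) ≤ 1 := (div_le_one (by linarith)).2 (by linarith)
    have hb : 0 < 1 / (1 - ℓ) := one_div_pos.2 (by linarith)
    calc (1 + ℓ) / (1 - ℓ) / 100 / (1 + x) = (1 + ℓ) / (1 + x) * (1 / 100 * (1 / (1 - ℓ))) := by
          ring
      _ ≤ 1 * (1 / 100 * (1 / (1 - ℓ))) := by gcongr
      _ = _ := one_mul _
  have h5 : 1 / (1 - x) ≤ 101 / 100 / (1 - ℓ) := by
    have : 101 / 100 / (1 - ℓ) = 1 / (1 - ℓ) + 1 / 100 * (1 / (1 - ℓ)) := by ring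
    linarith
  rw [div_le_div_iff₀ (by linarith) (by linarith)] at h5
  linarith

/-- Only one nontrivial eigenvalue l₁ exists. For l₁ < x < ℓ the left side of the secular equation
is negative; for x < l₁ it is at least 2/(1 - x), which forces the second alternative, i.e. y ≥ 1
for the scaled half-angle tangent y. -/
theorem SpectralChain.compressed_two_states (H : SpectralChain P v l i₀) {ℓ : ℝ}
    (hn : Fintype.card X = 2) (hℓ : IsPrincipalRoot l i₀ ℓ)
    (h : IsCompressedEigen P z c s q x r) (hc : c ≠ 0) (hr : r ≠ 0) (hx0 : -1 < x) (hx1 : x < 1) :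
    ℓ ≤ x ∨ 1 + x ≤ (s / c) ^ 2 * (1 - x) := by
  by_contra! hcon
  obtain ⟨hlt, hlt2⟩ := hcon
  have hcard : (Finset.univ.erase i₀).card = 1 := by
    rw [Finset.card_erase_of_mem (Finset.mem_univ _), Finset.card_univ, hn]
  obtain ⟨i₁, hi₁⟩ := Finset.card_eq_one.1 hcard
  have hne : i₁ ≠ i₀ := Finset.ne_of_mem_erase (hi₁ ▸ Finset.mem_singleton_self i₁)
  have hroot := hℓ.sum_eq
  rw [hi₁, Finset.sum_singleton] at hroot
  have hℓ1 := hℓ.lt_one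
  have hi1ℓ := hℓ.lt i₁ hne
  -- The pole cannot be an eigenvalue with r ≠ 0: it would force `v i₁ z = 0`, but the squares of
  -- the two entries at `z` are both 1/2.
  have hlne : l i₁ ≠ x := fun heq => by
    have h1 := H.compressed_coeff h i₁
    rw [heq, sub_self, zero_mul, eq_comm] at h1
    have hv : v i₁ z = 0 := (mul_eq_zero.1 h1).resolve_left (mul_ne_zero hr hc)
    have h2 := H.diag_split (fun _ => 1) z
    rw [hi₁, Finset.sum_singleton, H.sum_split, hi₁, Finset.sum_singleton, hv, H.top_sq, hn] at h2
    norm_num at h2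
  have hl : ∀ i, l i ≠ x := fun i => by
    by_cases hi : i = i₀
    · rw [hi, H.top]; exact hx1.ne'
    · have : i ∈ Finset.univ.erase i₀ := Finset.mem_erase.2 ⟨hi, Finset.mem_univ _⟩
      rw [hi₁, Finset.mem_singleton] at this
      rw [this]; exact hlne
  have heq := H.secular_equation h hc (by linarith) hr hl
  rw [hi₁, Finset.sum_singleton, hn] at heq
  have hpos : (0 : ℝ) ≤ (2 : ℕ) * (s / c) ^ 2 / (1 + x) := by
    have : 0 < 1 + x := by linarith
    positivity
  have hx1' : 1 / (1 - x) < 1 / (1 - ℓ) := one_div_lt_one_div_of_lt (by linarith) (by linarith)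
  rcases lt_or_gt_of_ne hlne with hgt | hgt
  · have h1 : 1 / (ℓ - l i₁) ≤ 1 / (x - l i₁) :=
      one_div_le_one_div_of_le (by linarith) (by linarith)
    have h2 : 1 / (l i₁ - x) = - (1 / (x - l i₁)) := by rw [← neg_sub, div_neg]
    linarith
  · have h1 : 1 / (1 - x) ≤ 1 / (l i₁ - x) :=
      one_div_le_one_div_of_le (by linarith) (by linarith [H.lt_one i₁ hne])
    have h3 : 2 * (1 / (1 - x)) ≤ 2 * (s / c) ^ 2 / (1 + x) := by
      push_cast at heq; linarith
    rw [mul_one_div, div_le_div_iff₀ (by linarith) (by linarith)] at h3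
    linarith

end

/-- Spectral decomposition of the start state of the modified walk in the coordinates of the
discriminant. The weights are `p = r² / (1 - x²)`, and `(s / c)² (1 - x) / (1 + x)` is the square
of the rescaled half-angle tangent. -/
theorem SpectralChain.exists_modified_spectrum (H : SpectralChain P v l i₀) (z : X) {c s δ : ℝ}
    (hc : 0 < c) (hs : 0 < s) (hcs : c ^ 2 + s ^ 2 = 1) (hδ : δ ^ 2 = 1 / Fintype.card X)
    (hδ0 : 0 < δ) :
    ∃ (J : Finset (X ⊕ X)) (q : X ⊕ X → X ⊕ X → ℝ) (x r : X ⊕ X → ℝ),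
      (∀ j ∈ J, IsCompressedEigen P z c s (q j) (x j) (r j) ∧ r j ≠ 0 ∧ -1 < x j ∧ x j < 1) ∧
      (∀ a : X → ℝ, (a = fun y => if y = z then 0 else δ) → Sum.elim (0 : X → ℝ) a =
        ∑ j ∈ J, (δ * c * r j * (1 / (1 - x j) - (s / c) ^ 2 / (1 + x j))) • q j) ∧
      ∑ j ∈ J, r j ^ 2 / (1 - x j ^ 2) = 1 ∧
      ∑ j ∈ J, r j ^ 2 / (1 + x j) ^ 2 ≤ c ^ 2 / s ^ 2 ∧
      ∑ j ∈ J, r j ^ 2 / (1 - x j) ^ 2 = (1 - δ ^ 2 * c ^ 2) / (δ ^ 2 * c ^ 2) := by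
  classical
  have hnX : Nonempty X := ⟨z⟩
  have hcard : (Fintype.card X : ℝ) ≠ 0 := by exact_mod_cast Fintype.card_ne_zero
  set M := blockChain P with hM
  set e := markedVec z c s with he
  have hMs : M.IsSymm := by
    rw [hM, blockChain, Matrix.IsSymm, Matrix.fromBlocks_transpose]
    simp [H.symm.eq]
  have hee : e ⬝ᵥ e = 1 := by
    rw [he, markedVec_dotProduct]
    simp [markedVec]
    linarith
  obtain ⟨J, q, x, hJ, hexp⟩ := exists_compression_eigenbasis hMs H.abs_blockChain_le hee
  set r : X ⊕ X → ℝ := fun j => e ⬝ᵥ (M *ᵥ q j) with hr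
  have hpar : ∀ a b, a ⬝ᵥ b = (e ⬝ᵥ a) * (e ⬝ᵥ b) + ∑ j ∈ J, (q j ⬝ᵥ a) * (q j ⬝ᵥ b) :=
      fun a b => by
    conv_lhs => rw [hexp a]
    rw [add_dotProduct, smul_dotProduct, sum_dotProduct]
    simp
  have hCE : ∀ j ∈ J, IsCompressedEigen P z c s (q j) (x j) (r j) := fun j hj => by
    obtain ⟨h0, h1, h2, -⟩ := hJ j hj
    have h2' : Sum.elim (-(q j ∘ Sum.inl)) (P *ᵥ (q j ∘ Sum.inr)) = x j • q j + r j • e := by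
      rw [← blockChain_mulVec]; exact h2
    refine ⟨h0, h1, fun y => ?_, fun y => ?_⟩
    · have := congrFun h2' (Sum.inl y)
      simp only [he, markedVec, Sum.elim_inl, Pi.neg_apply, Function.comp, Pi.add_apply,
        Pi.smul_apply, smul_eq_mul] at this
      linear_combination -this
    · have := congrFun h2' (Sum.inr y)
      simp only [he, markedVec, Sum.elim_inr, Pi.add_apply,
        Pi.smul_apply, smul_eq_mul] at this
      linear_combination this
  -- `h` and `k` are unit eigenvectors of `M` for -1 and 1. Symmetry of `M` therefore gives their
  -- coefficients along `q j` explicitly, as r s/(1 + x) and r c δ/(1 - x).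
  set h : X ⊕ X → ℝ := Sum.elim (Pi.single z 1) 0 with hh
  set k : X ⊕ X → ℝ := Sum.elim 0 (fun _ => δ) with hk
  have hMh : M *ᵥ h = (-1 : ℝ) • h := by
    rw [hM, blockChain_mulVec, hh, Sum.elim_comp_inl, Sum.elim_comp_inr, Matrix.mulVec_zero,
      neg_one_smul]
    ext y
    rcases y with y | y
    · rfl
    · exact neg_zero.symm
  have hMk : M *ᵥ k = (1 : ℝ) • k := by
    rw [hM, blockChain_mulVec]
    ext y
    rcases y with y | y
    · simp [hk]
    · simp [hk, Matrix.mulVec, dotProduct, ← Finset.sum_mul, H.row_sum]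
  have heh : e ⬝ᵥ h = -s := by rw [he, markedVec_dotProduct]; simp [hh]
  have hek : e ⬝ᵥ k = c * δ := by rw [he, markedVec_dotProduct]; simp [hk]
  have hhh : h ⬝ᵥ h = 1 := by
    rw [dotProduct_sum_type, hh, Sum.elim_comp_inl, Sum.elim_comp_inr]
    simp
  have hkk : k ⬝ᵥ k = 1 := by
    rw [dotProduct_sum_type]
    simp [hk, dotProduct, ← sq, hδ, hcard]
  have hrel : ∀ j ∈ J, ∀ a : X ⊕ X → ℝ, ∀ y, M *ᵥ a = y • a →
      (y - x j) * (q j ⬝ᵥ a) = r j * (e ⬝ᵥ a) := fun j hj a y ha => by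
    have h1 := dotProduct_mulVec_symm hMs (q j) a
    rw [ha, (hJ j hj).2.2.1, dotProduct_smul, add_dotProduct, smul_dotProduct, smul_dotProduct,
      smul_eq_mul, smul_eq_mul, smul_eq_mul] at h1
    linear_combination h1
  have hhj : ∀ j ∈ J, (1 + x j) * (q j ⬝ᵥ h) = r j * s := fun j hj => by
    have := hrel j hj h _ hMh
    rw [heh] at this
    linear_combination -this
  have hkj : ∀ j ∈ J, (1 - x j) * (q j ⬝ᵥ k) = r j * (c * δ) := fun j hj => by
    have := hrel j hj k _ hMk
    rw [hek] at this
    linear_combination this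
  have hrj : ∀ a, ∑ j ∈ J, r j * (q j ⬝ᵥ a) = (M *ᵥ e) ⬝ᵥ a - (e ⬝ᵥ (M *ᵥ e)) * (e ⬝ᵥ a) :=
      fun a => by
    rw [hpar (M *ᵥ e) a, add_sub_cancel_left]
    refine Finset.sum_congr rfl fun j _ => ?_
    rw [dotProduct_mulVec_symm hMs (q j) e, dotProduct_comm (M *ᵥ q j)]
  -- At x = 1 the overlap with `k` forces r = 0; then the first block vanishes and the second is a
  -- constant vector that is zero at `z`, so `q j` would be zero.
  have hx1 : ∀ j ∈ J, x j ≠ 1 := fun j hj hx => by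
    have hce := hCE j hj
    have h1 := hkj j hj
    rw [hx, sub_self, zero_mul, eq_comm] at h1
    have hr0 : r j = 0 := (mul_eq_zero.1 h1).resolve_right (mul_ne_zero hc.ne' hδ0.ne')
    have hl0 : ∀ y, q j (Sum.inl y) = 0 := fun y => by
      have := hce.left y
      rw [hx, hr0, zero_mul, zero_mul] at this
      exact (mul_eq_zero.1 this).resolve_left (by norm_num)
    have hz0 : q j (Sum.inr z) = 0 := by
      have := hce.orth
      rw [markedVec_dotProduct, hl0] at this
      have h2 : c * q j (Sum.inr z) = 0 := by linarith
      exact (mul_eq_zero.1 h2).resolve_left hc.ne'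
    have hne : ∀ i, i ≠ i₀ → v i ⬝ᵥ (q j ∘ Sum.inr) = 0 := fun i hi => by
      have := H.compressed_coeff hce i
      rw [hr0, zero_mul, zero_mul, hx] at this
      exact (mul_eq_zero.1 this).resolve_left (sub_ne_zero.2 (H.lt_one i hi).ne)
    have h0 : q j ∘ Sum.inr = 0 := H.eq_zero_of_coeff fun i => by
      by_cases hi : i = i₀
      · have h3 := H.apply_eq (q j ∘ Sum.inr) z
        rw [Function.comp_apply, hz0, H.sum_split, Finset.sum_eq_zero, add_zero, eq_comm] at h3
        · rw [hi]; exact (mul_eq_zero.1 h3).resolve_right (H.top_ne_zero z)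
        · intro i hi; rw [hne i (Finset.ne_of_mem_erase hi), zero_mul]
      · exact hne i hi
    have h4 := hce.norm_one
    rw [dotProduct_sum_type, h0, show q j ∘ Sum.inl = 0 from funext hl0] at h4
    simp at h4
  have hxm : ∀ j ∈ J, x j = -1 → r j = 0 ∧ q j ∘ Sum.inr = 0 := fun j hj hx => by
    have h1 := hhj j hj
    rw [hx, add_neg_cancel, zero_mul, eq_comm] at h1
    have hr0 : r j = 0 := (mul_eq_zero.1 h1).resolve_right hs.ne'
    refine ⟨hr0, H.eq_zero_of_coeff fun i => ?_⟩
    have := H.compressed_coeff (hCE j hj) i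
    rw [hr0, zero_mul, zero_mul, hx] at this
    exact (mul_eq_zero.1 this).resolve_left (by have := H.neg_one_lt i; linarith)
  have hbound : ∀ j ∈ J, r j ≠ 0 → -1 < x j ∧ x j < 1 := fun j hj hr0 => by
    have h1 := abs_le.1 (hJ j hj).2.2.2
    exact ⟨lt_of_le_of_ne h1.1 fun h => hr0 (hxm j hj h.symm).1,
      lt_of_le_of_ne h1.2 (hx1 j hj)⟩
  have hk0 : ∀ j ∈ J, r j = 0 → q j ⬝ᵥ k = 0 := fun j hj hr0 => by
    have := hkj j hj
    rw [hr0, zero_mul] at this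
    exact (mul_eq_zero.1 this).resolve_left (sub_ne_zero.2 (hx1 j hj).symm)
  have hfilter : ∀ f : X ⊕ X → ℝ, (∀ j ∈ J, r j = 0 → f j = 0) →
      ∑ j ∈ J.filter (fun j => r j ≠ 0), f j = ∑ j ∈ J, f j := fun f hf => by
    refine Finset.sum_filter_of_ne fun j hj hfj hr0 => hfj (hf j hj hr0)
  have hheq : ∀ j ∈ J.filter (fun j => r j ≠ 0), q j ⬝ᵥ h = r j * s / (1 + x j) := fun j hj => by
    obtain ⟨hj, hr0⟩ := Finset.mem_filter.1 hj
    rw [eq_div_iff (by linarith [(hbound j hj hr0).1]), mul_comm]; exact hhj j hj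
  have hkeq : ∀ j ∈ J.filter (fun j => r j ≠ 0), q j ⬝ᵥ k = r j * (c * δ) / (1 - x j) :=
      fun j hj => by
    obtain ⟨hj, hr0⟩ := Finset.mem_filter.1 hj
    rw [eq_div_iff (by linarith [(hbound j hj hr0).2]), mul_comm]; exact hkj j hj
  refine ⟨J.filter (fun j => r j ≠ 0), q, x, r, fun j hj => ?_, fun a ha => ?_, ?_, ?_, ?_⟩
  · obtain ⟨hj, hr0⟩ := Finset.mem_filter.1 hj
    exact ⟨hCE j hj, hr0, hbound j hj hr0⟩
  · have hea : e ⬝ᵥ Sum.elim (0 : X → ℝ) a = 0 := by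
      rw [he, markedVec_dotProduct]; simp [ha]
    -- In terms of `k`, `h` and `e` the coefficients of the start state are known, and the part
    -- along `e` is invisible to every `q j`.
    have hadec : (Sum.elim (0 : X → ℝ) a : X ⊕ X → ℝ) = k - (δ * s / c) • h - (δ / c) • e := by
      ext y
      rcases y with y | y
      · by_cases hy : y = z
        · subst hy; simp [hk, hh, he, markedVec]; ring
        · simp [hk, hh, he, markedVec, hy]
      · by_cases hy : y = z
        · subst hy; simp [hk, hh, he, markedVec, ha, hc.ne']
        · simp [hk, hh, he, markedVec, ha, hy]
    have hqa : ∀ j ∈ J, q j ⬝ᵥ Sum.elim (0 : X → ℝ) a = q j ⬝ᵥ k - (δ * s / c) * (q j ⬝ᵥ h) :=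
        fun j hj => by
      rw [hadec, dotProduct_sub, dotProduct_sub, dotProduct_smul, dotProduct_smul,
        dotProduct_comm (q j) e, (hJ j hj).1]
      simp
    conv_lhs => rw [hexp (Sum.elim (0 : X → ℝ) a), hea, zero_smul, zero_add]
    rw [← Finset.sum_filter_of_ne (p := fun j => r j ≠ 0)]
    · refine Finset.sum_congr rfl fun j hj => ?_
      rw [hqa j (Finset.mem_filter.1 hj).1, hheq j hj, hkeq j hj]
      congr 1
      field_simp
    · intro j hj hne hr0
      apply hne
      by_cases hx : x j = -1
      · rw [dotProduct_sum_type, (hxm j hj hx).2]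
        simp
      · have h1 := hhj j hj
        rw [hr0, zero_mul] at h1
        have h2 : q j ⬝ᵥ h = 0 := (mul_eq_zero.1 h1).resolve_left
          fun h => hx (by linarith)
        rw [hqa j hj, hk0 j hj hr0, h2]; simp
  -- Partial fractions express the weight through r⟨q, h⟩ and r⟨q, k⟩, whose sums are inner products
  -- with the compression of `M e`. The terms with ⟨e, M e⟩ cancel between the two.
  · have h1 : ∀ j ∈ J.filter (fun j => r j ≠ 0), r j ^ 2 / (1 - x j ^ 2) =
        1 / (2 * s) * (r j * (q j ⬝ᵥ h)) + 1 / (2 * (c * δ)) * (r j * (q j ⬝ᵥ k)) :=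
        fun j hj => by
      rw [hheq j hj, hkeq j hj]
      obtain ⟨hj, hr0⟩ := Finset.mem_filter.1 hj
      obtain ⟨ha, hb⟩ := hbound j hj hr0
      have ha' : (1 + x j) ≠ 0 := by linarith
      have hb' : (1 - x j) ≠ 0 := by linarith
      rw [show 1 - x j ^ 2 = (1 + x j) * (1 - x j) by ring]
      field_simp
      ring
    rw [Finset.sum_congr rfl h1, Finset.sum_add_distrib, ← Finset.mul_sum, ← Finset.mul_sum,
      hfilter (fun j => r j * (q j ⬝ᵥ h)) (fun j _ hr0 => by rw [hr0, zero_mul]),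
      hfilter (fun j => r j * (q j ⬝ᵥ k)) (fun j _ hr0 => by rw [hr0, zero_mul]), hrj, hrj,
      ← dotProduct_mulVec_symm hMs, ← dotProduct_mulVec_symm hMs, hMh, hMk, dotProduct_smul,
      dotProduct_smul, heh, hek]
    simp only [smul_eq_mul]
    field_simp
    ring
  · have h1 : ∀ j ∈ J.filter (fun j => r j ≠ 0), r j ^ 2 / (1 + x j) ^ 2 =
        1 / s ^ 2 * (q j ⬝ᵥ h) ^ 2 := fun j hj => by
      rw [hheq j hj]
      field_simp
    have h2 := hpar h h
    rw [hhh, heh] at h2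
    -- Over all of `J` the sum is 1 - s² = c²; dropping the indices with r = 0 can only lower it,
    -- and an upper bound is enough.
    have h3 : ∑ j ∈ J.filter (fun j => r j ≠ 0), (q j ⬝ᵥ h) ^ 2 ≤ c ^ 2 := by
      refine (Finset.sum_le_sum_of_subset_of_nonneg (Finset.filter_subset _ _)
        fun j _ _ => sq_nonneg _).trans ?_
      simp only [sq] at h2 hcs ⊢
      linarith
    rw [Finset.sum_congr rfl h1, ← Finset.mul_sum]
    calc _ ≤ 1 / s ^ 2 * c ^ 2 := mul_le_mul_of_nonneg_left h3 (by positivity)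
      _ = _ := by ring
  · have h1 : ∀ j ∈ J.filter (fun j => r j ≠ 0), r j ^ 2 / (1 - x j) ^ 2 =
        1 / (δ ^ 2 * c ^ 2) * (q j ⬝ᵥ k) ^ 2 := fun j hj => by
      rw [hkeq j hj]
      field_simp
    have h2 := hpar k k
    rw [hkk, hek] at h2
    rw [Finset.sum_congr rfl h1, ← Finset.mul_sum,
      hfilter (fun j => (q j ⬝ᵥ k) ^ 2) (fun j hj hr0 => by
        simp only [hk0 j hj hr0]; norm_num), div_mul_eq_mul_div, one_mul]
    congr 1
    simp only [sq]
    linarith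

end Discriminant

/-! ### The modified walk -/

section Tulsi

variable {ι : Type*} [Fintype ι] [DecidableEq ι]

theorem kronecker_mulVec_tensorVec {κ : Type*} [Fintype κ] (A : Matrix κ κ ℂ) (B : Matrix ι ι ℂ)
    (u : κ → ℂ) (w : ι → ℂ) :
    (A ⊗ₖ B) *ᵥ tensorVec u w = tensorVec (A *ᵥ u) (B *ᵥ w) := by
  ext ⟨i, j⟩
  simp only [Matrix.mulVec, dotProduct, tensorVec, Matrix.kroneckerMap_apply,
    Fintype.sum_prod_type, Finset.sum_mul_sum]
  exact Finset.sum_congr rfl fun a _ => Finset.sum_congr rfl fun b _ => by ring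

theorem bra_tensorVec {κ : Type*} [Fintype κ] (u v : κ → ℂ) (a b : ι → ℂ) :
    bra (tensorVec u a) (tensorVec v b) = bra u v * bra a b := by
  simp only [bra_eq_sum, tensorVec, Fintype.sum_prod_type, Finset.sum_mul_sum]
  refine Finset.sum_congr rfl fun i _ => Finset.sum_congr rfl fun j _ => ?_
  simp only [star_mul']; ring

theorem tensorVec_add_right {κ : Type*} (u : κ → ℂ) (a b : ι → ℂ) :
    tensorVec u (a + b) = tensorVec u a + tensorVec u b := by
  ext p; simp [tensorVec, mul_add]

theorem tensorVec_smul_right {κ : Type*} (u : κ → ℂ) (c : ℂ) (a : ι → ℂ) :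
    tensorVec u (c • a) = c • tensorVec u a := by
  ext p; simp [tensorVec]; ring

theorem tensorVec_add_left {κ : Type*} (u v : κ → ℂ) (a : ι → ℂ) :
    tensorVec (u + v) a = tensorVec u a + tensorVec v a := by
  ext p; simp [tensorVec, add_mul]

theorem tensorVec_smul_left {κ : Type*} (u : κ → ℂ) (c : ℂ) (a : ι → ℂ) :
    tensorVec (c • u) a = c • tensorVec u a := by
  ext p; simp [tensorVec]; ring

theorem tensorVec_zero_left {κ : Type*} (a : ι → ℂ) : tensorVec (0 : κ → ℂ) a = 0 := by
  ext p; simp [tensorVec]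

theorem ketbra_tensorVec {κ : Type*} [Fintype κ] [DecidableEq κ] (u : κ → ℂ) (a : ι → ℂ) :
    ketbra (tensorVec u a) = ketbra u ⊗ₖ ketbra a := by
  ext ⟨i, j⟩ ⟨i', j'⟩
  simp [ketbra, Matrix.vecMulVec_apply, tensorVec]
  ring

theorem ketbra_apply (u : ι → ℂ) (i j : ι) : ketbra u i j = u i * star (u j) := rfl

theorem conjTranspose_ketbra (u : ι → ℂ) : (ketbra u)ᴴ = ketbra u := by
  ext i j
  simp [ketbra, Matrix.vecMulVec_apply, mul_comm]

theorem ketbra_mul_self {u : ι → ℂ} (h : bra u u = 1) : ketbra u * ketbra u = ketbra u := by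
  rw [ketbra, Matrix.vecMulVec_mul_vecMulVec]
  have : star u ⬝ᵥ u = 1 := h
  rw [this]; simp

theorem ketbra_mul_of_orth {u v : ι → ℂ} (h : bra u v = 0) : ketbra u * ketbra v = 0 := by
  rw [ketbra, ketbra, Matrix.vecMulVec_mul_vecMulVec]
  have : star u ⬝ᵥ v = 0 := h
  rw [this]; simp

theorem bra_thetaVec_self (θ : ℝ) : bra (thetaVec θ) (thetaVec θ) = 1 := by
  simp only [bra_eq_sum, thetaVec, Fin.sum_univ_two, Matrix.cons_val_zero, Matrix.cons_val_one,
    Complex.star_def, map_neg, Complex.conj_ofReal]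
  have := Real.cos_sq_add_sin_sq θ
  rw [← Complex.ofReal_neg, ← Complex.ofReal_mul, ← Complex.ofReal_mul, ← Complex.ofReal_add]
  norm_cast
  linarith

theorem bra_thetaPerp_self (θ : ℝ) : bra (thetaPerp θ) (thetaPerp θ) = 1 := by
  simp only [bra_eq_sum, thetaPerp, Fin.sum_univ_two, Matrix.cons_val_zero, Matrix.cons_val_one,
    Complex.star_def, Complex.conj_ofReal]
  have := Real.cos_sq_add_sin_sq θ
  rw [← Complex.ofReal_mul, ← Complex.ofReal_mul, ← Complex.ofReal_add]
  norm_cast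
  linarith

theorem bra_thetaVec_thetaPerp (θ : ℝ) : bra (thetaVec θ) (thetaPerp θ) = 0 := by
  simp [bra_eq_sum, thetaVec, thetaPerp, Fin.sum_univ_two, Complex.conj_ofReal,
    -Complex.ofReal_cos, -Complex.ofReal_sin]
  ring

theorem bra_thetaPerp_thetaVec (θ : ℝ) : bra (thetaPerp θ) (thetaVec θ) = 0 := by
  rw [← star_bra, bra_thetaVec_thetaPerp, star_zero]

theorem ket_one_eq (θ : ℝ) :
    (![0, 1] : Fin 2 → ℂ) =
      (-(Real.sin θ : ℂ)) • thetaVec θ + (Real.cos θ : ℂ) • thetaPerp θ := by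
  have h := Real.cos_sq_add_sin_sq θ
  have h' : (Real.cos θ : ℂ) ^ 2 + (Real.sin θ : ℂ) ^ 2 = 1 := by exact_mod_cast h
  ext i
  fin_cases i
  · simp [thetaVec, thetaPerp, -Complex.ofReal_cos, -Complex.ofReal_sin]; ring
  · simp [thetaVec, thetaPerp, -Complex.ofReal_cos, -Complex.ofReal_sin]
    linear_combination -h'

theorem ketbra_theta_add (θ : ℝ) : ketbra (thetaVec θ) + ketbra (thetaPerp θ) = 1 := by
  have h := Real.cos_sq_add_sin_sq θ
  have h' : (Real.cos θ : ℂ) ^ 2 + (Real.sin θ : ℂ) ^ 2 = 1 := by exact_mod_cast h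
  ext i j
  rw [Matrix.add_apply, ketbra_apply, ketbra_apply]
  fin_cases i <;> fin_cases j <;>
    simp [thetaVec, thetaPerp, Complex.conj_ofReal, -Complex.ofReal_cos, -Complex.ofReal_sin]
  · linear_combination h'
  · ring
  · ring
  · linear_combination h'

/-- The first factor of the modified walk. -/
def tulsiShift (U₂ : Matrix ι ι ℂ) (θ : ℝ) : Matrix (Fin 2 × ι) (Fin 2 × ι) ℂ :=
  ketbra (thetaVec θ) ⊗ₖ (-1 : Matrix ι ι ℂ) + ketbra (thetaPerp θ) ⊗ₖ U₂

/-- The controlled `U₁` is a reflection in the single vector |1⟩|μ⟩, so the modified walk has the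
same form as the original one. -/
theorem tulsiWalk_eq (μ : ι → ℂ) (U₂ : Matrix ι ι ℂ) (θ : ℝ) :
    tulsiWalk (markedReflection μ) U₂ θ =
      tulsiShift U₂ θ * markedReflection (tensorVec ![0, 1] μ) := by
  rw [tulsiWalk, tulsiShift]
  congr 1
  have h : ketbra (![1, 0] : Fin 2 → ℂ) + ketbra ![0, 1] = 1 := by
    ext i j
    rw [Matrix.add_apply, ketbra_apply, ketbra_apply]
    fin_cases i <;> fin_cases j <;> simp
  rw [markedReflection, markedReflection, ketbra_tensorVec, sub_eq_add_neg, ← neg_smul,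
    Matrix.kronecker_add, Matrix.kronecker_smul, ← add_assoc, ← Matrix.add_kronecker, h,
    Matrix.one_kronecker_one, neg_smul, ← sub_eq_add_neg]

/-- `|θ⟩|a⟩ + |θ^⊥⟩|b⟩`. -/
def pairVec (θ : ℝ) (a b : ι → ℂ) : Fin 2 × ι → ℂ :=
  tensorVec (thetaVec θ) a + tensorVec (thetaPerp θ) b

theorem tulsiShift_pairVec (U₂ : Matrix ι ι ℂ) (θ : ℝ) (a b : ι → ℂ) :
    tulsiShift U₂ θ *ᵥ pairVec θ a b = pairVec θ (-a) (U₂ *ᵥ b) := by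
  rw [tulsiShift, pairVec, Matrix.mulVec_add, Matrix.add_mulVec, Matrix.add_mulVec]
  simp only [kronecker_mulVec_tensorVec, ketbra_mulVec, bra_thetaVec_self, bra_thetaPerp_self,
    bra_thetaVec_thetaPerp, bra_thetaPerp_thetaVec, one_smul, zero_smul, tensorVec_zero_left,
    Matrix.neg_mulVec, Matrix.one_mulVec, add_zero, zero_add]
  rfl

theorem bra_pairVec (θ : ℝ) (a b a' b' : ι → ℂ) :
    bra (pairVec θ a b) (pairVec θ a' b') = bra a a' + bra b b' := by
  simp only [pairVec, bra_add_left, bra_add_right, bra_tensorVec, bra_thetaVec_self,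
    bra_thetaPerp_self, bra_thetaVec_thetaPerp, bra_thetaPerp_thetaVec]
  ring

theorem ket_one_tensorVec (θ : ℝ) (μ : ι → ℂ) :
    tensorVec ![0, 1] μ = pairVec θ ((-(Real.sin θ : ℂ)) • μ) ((Real.cos θ : ℂ) • μ) := by
  rw [ket_one_eq θ, tensorVec_add_left, tensorVec_smul_left, tensorVec_smul_left, pairVec,
    tensorVec_smul_right, tensorVec_smul_right]

theorem conjTranspose_mul_self_tulsiShift {U₂ : Matrix ι ι ℂ} (h : U₂ᴴ * U₂ = 1) (θ : ℝ) :
    (tulsiShift U₂ θ)ᴴ * tulsiShift U₂ θ = 1 := by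
  rw [tulsiShift, Matrix.conjTranspose_add, Matrix.conjTranspose_kronecker,
    Matrix.conjTranspose_kronecker, conjTranspose_ketbra, conjTranspose_ketbra, add_mul, mul_add,
    mul_add, ← Matrix.mul_kronecker_mul, ← Matrix.mul_kronecker_mul, ← Matrix.mul_kronecker_mul,
    ← Matrix.mul_kronecker_mul, ketbra_mul_self (bra_thetaVec_self θ),
    ketbra_mul_self (bra_thetaPerp_self θ), ketbra_mul_of_orth (bra_thetaVec_thetaPerp θ),
    ketbra_mul_of_orth (bra_thetaPerp_thetaVec θ), h]
  simp only [Matrix.zero_kronecker, add_zero, zero_add, Matrix.conjTranspose_neg,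
    Matrix.conjTranspose_one, neg_mul_neg, mul_one]
  rw [← Matrix.add_kronecker, ketbra_theta_add, Matrix.one_kronecker_one]

theorem conjTranspose_mul_self_markedReflection {μ : ι → ℂ} (h : bra μ μ = 1) :
    (markedReflection μ)ᴴ * markedReflection μ = 1 := by
  have h1 : (markedReflection μ)ᴴ = markedReflection μ := by
    rw [markedReflection, Matrix.conjTranspose_sub, Matrix.conjTranspose_smul,
      conjTranspose_ketbra]
    simp
  rw [h1, markedReflection, sub_mul, one_mul, mul_sub, mul_one, smul_mul_smul_comm,
    ketbra_mul_self h]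
  module

theorem conjTranspose_mul_self_tulsiWalk {U₂ : Matrix ι ι ℂ} (h : U₂ᴴ * U₂ = 1) {μ : ι → ℂ}
    (hμ : bra μ μ = 1) (θ : ℝ) :
    (tulsiWalk (markedReflection μ) U₂ θ)ᴴ * tulsiWalk (markedReflection μ) U₂ θ = 1 := by
  have hm : bra (tensorVec (![0, 1] : Fin 2 → ℂ) μ) (tensorVec ![0, 1] μ) = 1 := by
    rw [bra_tensorVec, hμ]; simp [bra_eq_sum]
  rw [tulsiWalk_eq, Matrix.conjTranspose_mul, Matrix.mul_assoc, ← Matrix.mul_assoc _ _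
    (markedReflection _), conjTranspose_mul_self_tulsiShift h, Matrix.one_mul,
    conjTranspose_mul_self_markedReflection hm]

theorem conjTranspose_eigenvector {T : Matrix ι ι ℂ} (hT : Tᴴ * T = 1) {f : ι → ℂ} {l l' : ℂ}
    (hf : T *ᵥ f = l • f) (hl : l * l' = 1) : Tᴴ *ᵥ f = l' • f := by
  have h1 : f = l' • (T *ᵥ f) := by rw [hf, smul_smul, mul_comm, hl, one_smul]
  conv_lhs => rw [h1]
  rw [Matrix.mulVec_smul, Matrix.mulVec_mulVec, hT, Matrix.one_mulVec]

end Tulsi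

/-! ### The modified walk of a symmetric chain -/

section TulsiSzegedy

variable {X : Type*} [Fintype X] [DecidableEq X] {P : Matrix X X ℝ}

theorem conjTranspose_mul_self_quantumAnalogue (h0 : ∀ x y, 0 ≤ P x y)
    (h1 : ∀ x, ∑ y, P x y = 1) : (quantumAnalogue P)ᴴ * quantumAnalogue P = 1 := by
  have hA : (refA P)ᴴ = refA P := by
    rw [refA, Matrix.conjTranspose_sub, Matrix.conjTranspose_smul, Matrix.conjTranspose_sum]
    simp [conjTranspose_ketbra]
  have hAA : refA P * refA P = 1 := by
    refine Matrix.ext_of_mulVec_single fun i => ?_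
    rw [← Matrix.mulVec_mulVec, refA_mulVec, refA_mulVec, edgeProj_sub, edgeProj_smul,
      edgeProj_edgeLift h0 h1, edgeLift_sub, edgeLift_smul, Matrix.one_mulVec]
    module
  have hS : (swapOp X)ᴴ * swapOp X = 1 := by
    have hS1 : (swapOp X)ᴴ = swapOp X := by
      ext p q
      have : q = p.swap ↔ p = q.swap := by
        constructor <;> (rintro rfl; simp)
      simp [swapOp, Matrix.conjTranspose_apply, this]
    rw [hS1]
    refine Matrix.ext_of_mulVec_single fun i => ?_
    rw [← Matrix.mulVec_mulVec, swapOp_mulVec, swapOp_mulVec, Matrix.one_mulVec]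
    ext p; simp
  rw [quantumAnalogue, Matrix.conjTranspose_mul, Matrix.mul_assoc, ← Matrix.mul_assoc _ _ (refA P),
    hS, Matrix.one_mul, hA, hAA]

theorem bra_edgeVec_self (h0 : ∀ x y, 0 ≤ P x y) (h1 : ∀ x, ∑ y, P x y = 1) (z : X) :
    bra (edgeVec P z) (edgeVec P z) = 1 := by
  rw [bra_edgeVec, ← edgeLift_single, edgeProj_edgeLift h0 h1]; simp

/-- The lift of real coordinates to the space of the modified walk. -/
def realLift (P : Matrix X X ℝ) (θ : ℝ) (q : X ⊕ X → ℝ) : Fin 2 × (X × X) → ℂ :=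
  pairVec θ (edgeLift P fun y => (q (Sum.inl y) : ℂ)) (edgeLift P fun y => (q (Sum.inr y) : ℂ))

theorem realLift_sum {J : Finset (X ⊕ X)} (θ : ℝ) (a : X ⊕ X → ℝ) (q : X ⊕ X → X ⊕ X → ℝ) :
    realLift P θ (∑ j ∈ J, a j • q j) = ∑ j ∈ J, (a j : ℂ) • realLift P θ (q j) := by
  ext ⟨i, p⟩
  simp only [realLift, pairVec, tensorVec, edgeLift, Pi.add_apply, Finset.sum_apply,
    Pi.smul_apply, smul_eq_mul, Complex.ofReal_sum, Complex.ofReal_mul, Finset.sum_mul,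
    Finset.mul_sum, ← Finset.sum_add_distrib]
  exact Finset.sum_congr rfl fun j _ => by ring

variable {z : X} {θ : ℝ} {q : X ⊕ X → ℝ} {x r : ℝ}

theorem bra_marked_pairVec (a b : X × X → ℂ) :
    bra (tensorVec ![0, 1] (edgeVec P z)) (pairVec θ a b) =
      -(Real.sin θ : ℂ) * edgeProj P a z + (Real.cos θ : ℂ) * edgeProj P b z := by
  rw [ket_one_tensorVec θ, bra_pairVec, bra_smul_left, bra_smul_left, bra_edgeVec, bra_edgeVec]
  simp only [Complex.star_def, map_neg, Complex.conj_ofReal]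

/-- The modified walk acts on the lift of an eigenvector of the discriminant, and on its image,
as a plane rotation. -/
theorem tulsiWalk_realLift (h0 : ∀ x y, 0 ≤ P x y) (h1 : ∀ x, ∑ y, P x y = 1) (hs : P.IsSymm)
    (h : IsCompressedEigen P z (Real.cos θ) (Real.sin θ) q x r) :
    ∃ s : Fin 2 × (X × X) → ℂ,
      tulsiWalk (markedReflection (edgeVec P z)) (quantumAnalogue P) θ *ᵥ realLift P θ q = s ∧
      tulsiWalk (markedReflection (edgeVec P z)) (quantumAnalogue P) θ *ᵥ s =
        (2 * (x : ℂ)) • s - realLift P θ q ∧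
      bra (tensorVec ![0, 1] (edgeVec P z)) (realLift P θ q) = 0 ∧
      bra (tensorVec ![0, 1] (edgeVec P z)) s = r := by
  set a : X → ℂ := fun y => (q (Sum.inl y) : ℂ) with ha
  set b : X → ℂ := fun y => (q (Sum.inr y) : ℂ) with hb
  set m := tensorVec (![0, 1] : Fin 2 → ℂ) (edgeVec P z) with hm
  have horth := h.orth
  rw [markedVec_dotProduct] at horth
  have hleft := h.left z
  simp only [Pi.single_eq_same, mul_one] at hleft
  have hPb : ∀ y, (complexify P *ᵥ b) y = x * b y + r * Real.cos θ * (Pi.single z 1 : X → ℂ) y :=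
      fun y => by
    rw [hb, complexify_mulVec_ofReal]
    have := h.right y
    simp only [Function.comp_def] at this
    simp only [this]
    by_cases hy : y = z
    · subst hy; simp
    · simp [hy]
  have hcs : (Real.sin θ) ^ 2 + (Real.cos θ) ^ 2 = 1 := Real.sin_sq_add_cos_sq θ
  have hbm : bra m (realLift P θ q) = 0 := by
    rw [hm, realLift, bra_marked_pairVec, edgeProj_edgeLift h0 h1, edgeProj_edgeLift h0 h1]
    have : ((-(Real.sin θ * q (Sum.inl z)) + Real.cos θ * q (Sum.inr z) : ℝ) : ℂ) = 0 := by
      rw [horth]; simp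
    push_cast at this
    push_cast
    linear_combination this
  -- On vectors orthogonal to the marked one the walk is the shift alone: -1 on the first block, and
  -- SWAP on lifts in the second.
  set s := pairVec θ (-edgeLift P a) (edgeLift P b ∘ Prod.swap) with hsdef
  have hU2 : ∀ w : X → ℂ, quantumAnalogue P *ᵥ edgeLift P w = edgeLift P w ∘ Prod.swap :=
      fun w => by
    rw [quantumAnalogue_mulVec, edgeProj_edgeLift h0 h1, two_smul, add_sub_cancel_right]
  have hbs : bra m s = r := by
    rw [hm, hsdef, bra_marked_pairVec, edgeProj_swap_edgeLift h0 hs, hPb]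
    have hneg : edgeProj P (-edgeLift P a) = -a := by
      rw [← neg_one_smul ℂ, edgeProj_smul, edgeProj_edgeLift h0 h1, neg_one_smul]
    rw [hneg]
    have h2 : Real.sin θ * q (Sum.inl z) + Real.cos θ * (x * q (Sum.inr z) + r * Real.cos θ)
        = r := by
      linear_combination Real.sin θ * hleft + x * horth + r * hcs
    have h3 : ((Real.sin θ * q (Sum.inl z) + Real.cos θ * (x * q (Sum.inr z) + r * Real.cos θ)
        : ℝ) : ℂ) = r := by rw [h2]
    simp only [Pi.neg_apply, Pi.single_eq_same, mul_one, ha, hb]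
    push_cast at h3 ⊢
    linear_combination h3
  refine ⟨s, ?_, ?_, hbm, hbs⟩
  · rw [tulsiWalk_eq, ← Matrix.mulVec_mulVec, markedReflection_mulVec, ← hm, hbm, mul_zero,
      zero_smul, sub_zero, realLift, tulsiShift_pairVec, hU2]
  · rw [tulsiWalk_eq, ← Matrix.mulVec_mulVec, markedReflection_mulVec, ← hm, hbs,
      Matrix.mulVec_sub, Matrix.mulVec_smul, hm, ket_one_tensorVec θ, tulsiShift_pairVec,
      hsdef, tulsiShift_pairVec, Matrix.mulVec_smul, ← edgeLift_single, hU2,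
      quantumAnalogue_mulVec, edgeProj_swap_edgeLift h0 hs, realLift, ← ha, ← hb]
    have hPb' : complexify P *ᵥ b = (x : ℂ) • b + ((r : ℂ) * Real.cos θ) • Pi.single z 1 := by
      ext y; simpa using hPb y
    have hla : ∀ y, (1 + (x : ℂ)) * a y = (r : ℂ) * Real.sin θ * (Pi.single z 1 : X → ℂ) y :=
        fun y => by
      have h2 : (((1 + x) * q (Sum.inl y) : ℝ) : ℂ) =
        ((r * Real.sin θ * (Pi.single z 1 : X → ℝ) y : ℝ) : ℂ) := by rw [h.left y]
      simp only [ha]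
      push_cast at h2
      push_cast
      rw [h2]
      by_cases hy : y = z
      · subst hy; simp
      · simp [hy]
    rw [hPb']
    ext ⟨i, p⟩
    simp only [pairVec, tensorVec, edgeLift, Pi.add_apply, Pi.sub_apply, Pi.smul_apply,
      Pi.neg_apply, smul_eq_mul, Function.comp_apply, Prod.fst_swap, Prod.snd_swap]
    -- The second block cancels; what remains in the first is (1 + x) a = r sin θ e_z.
    linear_combination 2 * thetaVec θ i * (Real.sqrt (P p.1 p.2) : ℂ) * hla p.1

/-- A linear functional that on each eigenvector of the modified walk is a multiple `ρ` of the
overlap with the marked state, evaluated at the lift of an eigenvector of the discriminant. -/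
theorem functional_realLift (h0 : ∀ x y, 0 ≤ P x y) (h1 : ∀ x, ∑ y, P x y = 1) (hs : P.IsSymm)
    (h : IsCompressedEigen P z (Real.cos θ) (Real.sin θ) q x r) (hx0 : -1 < x) (hx1 : x < 1)
    (F : (Fin 2 × (X × X) → ℂ) →ₗ[ℂ] ℂ) (ρ : ℝ → ℂ)
    (hF : ∀ (α : ℝ) (f : Fin 2 × (X × X) → ℂ),
      tulsiWalk (markedReflection (edgeVec P z)) (quantumAnalogue P) θ *ᵥ f =
        Complex.exp (α * Complex.I) • f →
      (tulsiWalk (markedReflection (edgeVec P z)) (quantumAnalogue P) θ)ᴴ *ᵥ f =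
        Complex.exp (-α * Complex.I) • f →
      F f = ρ α * bra (tensorVec ![0, 1] (edgeVec P z)) f) :
    F (realLift P θ q) = (ρ (Real.arccos x) - ρ (-Real.arccos x)) * r /
      (2 * Complex.I * Real.sqrt (1 - x ^ 2)) := by
  obtain ⟨s, hb, hs', hbm, hsm⟩ := tulsiWalk_realLift h0 h1 hs h
  set α := Real.arccos x with hα
  have hcos : Real.cos α = x := Real.cos_arccos hx0.le hx1.le
  have hsin : Real.sin α = Real.sqrt (1 - x ^ 2) := Real.sin_arccos x
  have hsin0 : (Real.sqrt (1 - x ^ 2) : ℂ) ≠ 0 := by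
    have : 0 < Real.sqrt (1 - x ^ 2) := Real.sqrt_pos.2 (by nlinarith)
    exact_mod_cast this.ne'
  have hTT := conjTranspose_mul_self_tulsiWalk (conjTranspose_mul_self_quantumAnalogue h0 h1)
    (bra_edgeVec_self h0 h1 z) θ
  set e := Complex.exp (α * Complex.I) with he
  set e' := Complex.exp (-α * Complex.I) with he'
  have hee : e * e' = 1 := exp_phase_mul α
  have hadd : e + e' = 2 * (x : ℂ) := by rw [exp_phase_add, hcos]
  have f1 := rotation_eigenvector hb hs' hee hadd
  have f2 := rotation_eigenvector hb hs' ((mul_comm _ _).trans hee) ((add_comm _ _).trans hadd)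
  have F1 := hF α _ f1 (conjTranspose_eigenvector hTT f1 hee)
  have F2 := hF (-α) (s - e • realLift P θ q) (by push_cast; exact f2)
    (by push_cast; rw [neg_neg]
        exact conjTranspose_eigenvector hTT f2 ((mul_comm _ _).trans hee))
  rw [bra_sub_right, bra_smul_right, hbm, hsm, mul_zero, sub_zero, map_sub, map_smul, smul_eq_mul]
    at F1 F2
  -- The two eigenvectors have the same overlap r with the marked state, and their difference is e -
  -- e' times the lift, so only the difference of the values of ρ survives.
  have hdiff : e - e' = 2 * Complex.I * (Real.sqrt (1 - x ^ 2) : ℂ) := by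
    rw [← hsin, Complex.ofReal_sin, Complex.sin, he, he']
    linear_combination (Complex.exp (α * Complex.I) - Complex.exp (-α * Complex.I)) * Complex.I_sq
  rw [← hdiff, eq_div_iff (by rw [hdiff]; simp [hsin0])]
  linear_combination F1 - F2

end TulsiSzegedy

/-! ### Circuits on an eigenvector of the work operator -/

section Eigencircuit

variable {k m : ℕ} {ι : Type*} [Fintype ι] [DecidableEq ι]

/-- The action of a gate on the ancillas when the work space holds an eigenvector of the work
operator for `l` and of its adjoint for `l'`. -/
def OracleGate.phaseEval (l l' : ℂ) : OracleGate k m → Matrix (Anc k m) (Anc k m) ℂ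
  | .onAncilla V => V
  | .ctrlU i j => Matrix.diagonal fun a => if a i j then l else 1
  | .ctrlUInv i j => Matrix.diagonal fun a => if a i j then l' else 1

/-- The action of a circuit on the ancillas when the work space holds an eigenvector. -/
def OracleCircuit.phaseEval (l l' : ℂ) : OracleCircuit k m → Matrix (Anc k m) (Anc k m) ℂ
  | [] => 1
  | g :: c => OracleCircuit.phaseEval l l' c * g.phaseEval l l'

theorem controlled_mulVec {U : Matrix ι ι ℂ} {f : ι → ℂ} {l : ℂ} (hf : U *ᵥ f = l • f)
    (i : Fin k) (j : Fin m) (a : Anc k m → ℂ) :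
    (qubitProj i j false ⊗ₖ (1 : Matrix ι ι ℂ) + qubitProj i j true ⊗ₖ U) *ᵥ tensorVec a f =
      tensorVec ((Matrix.diagonal fun a => if a i j then l else 1) *ᵥ a) f := by
  rw [Matrix.add_mulVec, kronecker_mulVec_tensorVec, kronecker_mulVec_tensorVec, hf,
    Matrix.one_mulVec]
  ext ⟨b, x⟩
  simp only [Pi.add_apply, tensorVec, qubitProj, Matrix.mulVec_diagonal, Pi.smul_apply,
    smul_eq_mul]
  cases b i j <;> simp [mul_left_comm, mul_assoc]

theorem OracleGate.eval_eigenvector {U : Matrix ι ι ℂ} {f : ι → ℂ} {l l' : ℂ}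
    (hf : U *ᵥ f = l • f) (hf' : Uᴴ *ᵥ f = l' • f) (g : OracleGate k m) (a : Anc k m → ℂ) :
    g.eval U *ᵥ tensorVec a f = tensorVec (g.phaseEval l l' *ᵥ a) f := by
  cases g with
  | onAncilla V => rw [OracleGate.eval, kronecker_mulVec_tensorVec, Matrix.one_mulVec]; rfl
  | ctrlU i j => exact controlled_mulVec hf i j a
  | ctrlUInv i j => exact controlled_mulVec hf' i j a

/-- Phase kickback: a controlled call multiplies the control's branch by the eigenvalue and leaves
the work space alone. -/
theorem OracleCircuit.eval_eigenvector {U : Matrix ι ι ℂ} {f : ι → ℂ} {l l' : ℂ}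
    (hf : U *ᵥ f = l • f) (hf' : Uᴴ *ᵥ f = l' • f) (c : OracleCircuit k m) (a : Anc k m → ℂ) :
    OracleCircuit.eval U c *ᵥ tensorVec a f =
      tensorVec (OracleCircuit.phaseEval l l' c *ᵥ a) f := by
  induction c generalizing a with
  | nil => simp [OracleCircuit.eval, OracleCircuit.phaseEval]
  | cons g c ih =>
    rw [OracleCircuit.eval, ← Matrix.mulVec_mulVec, g.eval_eigenvector hf hf', ih,
      OracleCircuit.phaseEval, Matrix.mulVec_mulVec]

theorem OracleCircuit.phaseEval_append (l l' : ℂ) (c d : OracleCircuit k m) :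
    OracleCircuit.phaseEval l l' (c ++ d) =
      OracleCircuit.phaseEval l l' d * OracleCircuit.phaseEval l l' c := by
  induction c with
  | nil => simp [OracleCircuit.phaseEval]
  | cons g c ih =>
    rw [List.cons_append, OracleCircuit.phaseEval, ih, OracleCircuit.phaseEval, mul_assoc]

theorem OracleCircuit.phaseEval_singleton (l l' : ℂ) (g : OracleGate k m) :
    OracleCircuit.phaseEval l l' [g] = g.phaseEval l l' := by
  simp [OracleCircuit.phaseEval]

theorem OracleGate.phaseEval_inv {l l' : ℂ} (h : star l = l') (g : OracleGate k m) :
    g.inv.phaseEval l l' = (g.phaseEval l l')ᴴ := by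
  have h' : star l' = l := by rw [← h, star_star]
  cases g with
  | onAncilla V => rfl
  | ctrlU i j =>
    simp only [OracleGate.inv, OracleGate.phaseEval, Matrix.diagonal_conjTranspose]
    congr 1; ext a
    simp only [Pi.star_apply]; split_ifs <;> simp [h]
  | ctrlUInv i j =>
    simp only [OracleGate.inv, OracleGate.phaseEval, Matrix.diagonal_conjTranspose]
    congr 1; ext a
    simp only [Pi.star_apply]; split_ifs <;> simp [h']

theorem OracleCircuit.phaseEval_inv {l l' : ℂ} (h : star l = l') (c : OracleCircuit k m) :
    OracleCircuit.phaseEval l l' c.inv = (OracleCircuit.phaseEval l l' c)ᴴ := by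
  induction c with
  | nil => simp [OracleCircuit.inv, OracleCircuit.phaseEval]
  | cons g c ih =>
    have : OracleCircuit.inv (g :: c) = OracleCircuit.inv c ++ [g.inv] := by
      simp [OracleCircuit.inv]
    rw [this, OracleCircuit.phaseEval_append, ih, OracleCircuit.phaseEval_singleton,
      OracleGate.phaseEval_inv h, OracleCircuit.phaseEval, Matrix.conjTranspose_mul]

end Eigencircuit

/-! ### Phase estimation on independent ancilla registers -/

section ProductStates

variable {k m : ℕ}

/-- The product state of the ancilla registers. -/
def prodState (u : Fin k → (Fin m → Bool) → ℂ) : Anc k m → ℂ := fun a => ∏ i, u i (a i)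

theorem ancZero_eq_prodState :
    ancZero k m = prodState fun _ => Pi.single (fun _ => false) 1 := by
  ext a
  simp only [ancZero, prodState, Pi.single_apply]
  by_cases h : a = fun _ _ => false
  · subst h; simp
  · rw [if_neg h]
    obtain ⟨i, hi⟩ := Function.ne_iff.1 h
    exact (Finset.prod_eq_zero (Finset.mem_univ i) (if_neg hi)).symm

theorem prodState_update (u : Fin k → (Fin m → Bool) → ℂ) (i : Fin k) (w : (Fin m → Bool) → ℂ)
    (a : Anc k m) :
    prodState (Function.update u i w) a = w (a i) * ∏ j ∈ Finset.univ.erase i, u j (a j) := by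
  rw [prodState, ← Finset.mul_prod_erase _ _ (Finset.mem_univ i), Function.update_self]
  congr 1
  exact Finset.prod_congr rfl fun j hj => by
    rw [Function.update_of_ne (Finset.ne_of_mem_erase hj)]

theorem onRegister_prodState (i : Fin k) (V : Matrix (Fin m → Bool) (Fin m → Bool) ℂ)
    (u : Fin k → (Fin m → Bool) → ℂ) :
    onRegister i V *ᵥ prodState u = prodState (Function.update u i (V *ᵥ u i)) := by
  ext a
  rw [prodState_update]
  simp only [Matrix.mulVec, dotProduct, onRegister, Finset.sum_mul]
  symm
  refine Finset.sum_of_injOn (fun t => Function.update a i t)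
    (fun t _ t' _ h => Function.update_injective a i h) (fun _ _ => by simp) ?_ ?_
  · intro b _ hb
    rw [if_neg, zero_mul]
    intro h
    apply hb
    refine ⟨b i, by simp, ?_⟩
    ext1 i'
    by_cases hi : i' = i
    · subst hi; simp
    · simp [hi, h i' hi]
  · intro t _
    rw [if_pos (fun i' hi => by simp [hi])]
    simp only [Function.update_self, prodState]
    rw [← Finset.mul_prod_erase _ _ (Finset.mem_univ i), Function.update_self, mul_assoc]
    congr 2
    exact Finset.prod_congr rfl fun j hj => by
      rw [Function.update_of_ne (Finset.ne_of_mem_erase hj)]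

theorem diagonal_prodState (i : Fin k) (g : (Fin m → Bool) → ℂ)
    (u : Fin k → (Fin m → Bool) → ℂ) :
    (Matrix.diagonal fun a : Anc k m => g (a i)) *ᵥ prodState u =
      prodState (Function.update u i fun b => g b * u i b) := by
  ext a
  rw [prodState_update, Matrix.mulVec_diagonal, prodState,
    ← Finset.mul_prod_erase _ _ (Finset.mem_univ i), mul_assoc]

theorem phaseEval_replicate (l l' : ℂ) (i : Fin k) (j : Fin m) (N : ℕ) :
    OracleCircuit.phaseEval l l' (List.replicate N (OracleGate.ctrlU i j)) =
      Matrix.diagonal fun a => (if a i j then l else 1) ^ N := by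
  induction N with
  | zero => simp [OracleCircuit.phaseEval]
  | succ N ih =>
    rw [List.replicate_succ, OracleCircuit.phaseEval, ih, OracleGate.phaseEval,
      Matrix.diagonal_mul_diagonal]
    simp only [pow_succ]

theorem phaseEval_controlledPowers (l l' : ℂ) (i : Fin k) :
    OracleCircuit.phaseEval l l' ((List.finRange m).flatMap
      (fun j : Fin m => List.replicate (2 ^ (j : ℕ)) (OracleGate.ctrlU i j))) =
      Matrix.diagonal fun a : Anc k m => l ^ bitsVal (a i) := by
  have h : ∀ L : List (Fin m), OracleCircuit.phaseEval l l' (L.flatMap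
      (fun j : Fin m => List.replicate (2 ^ (j : ℕ)) (OracleGate.ctrlU i j))) =
      Matrix.diagonal fun a : Anc k m =>
        (L.map fun j => (if a i j then l else 1) ^ (2 ^ (j : ℕ))).prod := fun L => by
    induction L with
    | nil => simp [OracleCircuit.phaseEval]
    | cons j L ih =>
      rw [List.flatMap_cons, OracleCircuit.phaseEval_append, ih, phaseEval_replicate,
        Matrix.diagonal_mul_diagonal]
      simp only [List.map_cons, List.prod_cons, mul_comm]
  rw [h]
  congr 1
  ext a
  rw [← List.ofFn_eq_map, List.prod_ofFn, bitsVal, ← Finset.prod_pow_eq_pow_sum]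
  refine Finset.prod_congr rfl fun j _ => ?_
  split_ifs <;> simp

/-- The amplitudes of the outcomes of phase estimation on an eigenvector for `l`. -/
def outcomeAmplitude (m : ℕ) (l : ℂ) : (Fin m → Bool) → ℂ := fun b =>
  (∑ b' : Fin m → Bool, Complex.exp (-(2 * Real.pi * Complex.I * bitsVal b * bitsVal b' / 2 ^ m)) *
    l ^ bitsVal b') / 2 ^ m

theorem phaseEval_estimate (l l' : ℂ) (i : Fin k) (u : Fin k → (Fin m → Bool) → ℂ)
    (hu : u i = Pi.single (fun _ => false) 1) :
    OracleCircuit.phaseEval l l' (estimate i) *ᵥ prodState u =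
      prodState (Function.update u i (outcomeAmplitude m l)) := by
  rw [estimate, OracleCircuit.phaseEval_append, OracleCircuit.phaseEval_append,
    OracleCircuit.phaseEval_singleton, OracleCircuit.phaseEval_singleton,
    phaseEval_controlledPowers, ← Matrix.mulVec_mulVec, ← Matrix.mulVec_mulVec,
    OracleGate.phaseEval, OracleGate.phaseEval, onRegister_prodState,
    diagonal_prodState i (fun b => l ^ bitsVal b), onRegister_prodState]
  simp only [Function.update_idem, Function.update_self, hu]
  congr 2
  ext b
  rw [Matrix.mulVec_single_one]
  simp only [Matrix.mulVec, dotProduct, outcomeAmplitude, inverseQFT, hadamards,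
    Matrix.col_apply, Finset.sum_div, Bool.and_false, Bool.false_eq_true, if_false,
    Finset.prod_const, Finset.card_univ, Fintype.card_fin]
  refine Finset.sum_congr rfl fun b' _ => ?_
  have h1 : (Real.sqrt (2 ^ m) : ℂ) = (Real.sqrt 2 : ℂ) ^ m := by
    have : Real.sqrt (2 ^ m) = Real.sqrt 2 ^ m := by
      rw [Real.sqrt_eq_iff_mul_self_eq (by positivity) (by positivity), ← mul_pow,
        Real.mul_self_sqrt (by norm_num)]
    rw [this, Complex.ofReal_pow]
  have h2 : (Real.sqrt 2 : ℂ) ^ m * (Real.sqrt 2 : ℂ) ^ m = 2 ^ m := by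
    rw [← mul_pow, ← Complex.ofReal_mul, Real.mul_self_sqrt (by norm_num)]; norm_num
  rw [h1, ← h2, one_div, inv_pow]
  ring

theorem phaseEval_estimates (l l' : ℂ) :
    OracleCircuit.phaseEval l l' (estimates k m) *ᵥ ancZero k m =
      prodState fun _ => outcomeAmplitude m l := by
  have h : ∀ L : List (Fin k), L.Nodup → ∀ u : Fin k → (Fin m → Bool) → ℂ,
      (∀ i ∈ L, u i = Pi.single (fun _ => false) 1) →
      OracleCircuit.phaseEval l l' (L.flatMap estimate) *ᵥ prodState u =
        prodState fun i => if i ∈ L then outcomeAmplitude m l else u i := fun L hL => by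
    induction L with
    | nil => intro u _; simp [OracleCircuit.phaseEval]
    | cons i L ih =>
      intro u hu
      have hi := (List.nodup_cons.1 hL).1
      rw [List.flatMap_cons, OracleCircuit.phaseEval_append, ← Matrix.mulVec_mulVec,
        phaseEval_estimate l l' i u (hu i (by simp)), ih (List.nodup_cons.1 hL).2]
      · congr 1
        ext1 i'
        by_cases h1 : i' = i
        · subst h1; simp [hi]
        · simp [h1]
      · intro i' hi'
        have : i' ≠ i := fun h => hi (h ▸ hi')
        rw [Function.update_of_ne this]
        exact hu i' (by simp [hi'])
  rw [estimates, ancZero_eq_prodState, h _ (List.nodup_finRange k) _ (fun _ _ => rfl)]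
  simp

/-- The expected sign with which `rotate` multiplies an eigenvector of the work operator. -/
def rotateSign (k m : ℕ) (l : ℂ) : ℝ :=
  ∑ a : Anc k m, (if k < 2 * (Finset.univ.filter fun i => estimatedPhase (a i) < 0).card
    then -1 else 1) * ∏ i, ‖outcomeAmplitude m l (a i)‖ ^ 2

theorem bra_rotate {ι : Type*} [Fintype ι] [DecidableEq ι] {U : Matrix ι ι ℂ} {f g : ι → ℂ}
    {l l' : ℂ} (hf : U *ᵥ f = l • f) (hf' : Uᴴ *ᵥ f = l' • f) (hl : star l = l') (κ Δ ε : ℝ) :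
    bra (tensorVec (ancZero _ _) g)
      (OracleCircuit.eval U (rotate κ Δ ε) *ᵥ tensorVec (ancZero _ _) f) =
      (rotateSign (repetitions κ ε) (precisionBits Δ) l : ℂ) * bra g f := by
  rw [OracleCircuit.eval_eigenvector hf hf', bra_tensorVec, rotate]
  congr 1
  -- The ancilla operator is V† D V with D the majority flip. Moving V† to the bra leaves the
  -- expectation of D in the product of outcome distributions.
  rw [OracleCircuit.phaseEval_append, OracleCircuit.phaseEval_append,
    OracleCircuit.phaseEval_singleton, OracleCircuit.phaseEval_inv hl, ← Matrix.mulVec_mulVec,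
    ← Matrix.mulVec_mulVec, bra_mulVec, Matrix.conjTranspose_conjTranspose, phaseEval_estimates,
    OracleGate.phaseEval, majorityFlip, rotateSign, bra_eq_sum]
  push_cast
  refine Finset.sum_congr rfl fun a _ => ?_
  rw [Matrix.mulVec_diagonal, prodState, mul_left_comm]
  congr 1
  · split_ifs <;> simp
  · rw [star_prod, ← Finset.prod_mul_distrib]
    refine Finset.prod_congr rfl fun i _ => ?_
    rw [mul_comm, Complex.star_def, Complex.mul_conj, Complex.normSq_eq_norm_sq]
    push_cast; rfl

end ProductStates

/-! ### The binomial distribution -/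

section Binomial

/-- The expectation of `G` of the number of successes in `k` independent trials with success
probability `p`. -/
def binomialMean : ℕ → (ℕ → ℝ) → ℝ → ℝ
  | 0, G, _ => G 0
  | k + 1, G, p => p * binomialMean k (fun j => G (j + 1)) p + (1 - p) * binomialMean k G p

theorem binomialMean_mono {k : ℕ} {G G' : ℕ → ℝ} {p : ℝ} (h0 : 0 ≤ p) (h1 : p ≤ 1)
    (h : ∀ j, G j ≤ G' j) : binomialMean k G p ≤ binomialMean k G' p := by
  induction k generalizing G G' with
  | zero => exact h 0
  | succ k ih =>
    exact add_le_add (mul_le_mul_of_nonneg_left (ih fun j => h (j + 1)) h0)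
      (mul_le_mul_of_nonneg_left (ih h) (sub_nonneg.2 h1))

theorem binomialMean_const (k : ℕ) (a p : ℝ) : binomialMean k (fun _ => a) p = a := by
  induction k with
  | zero => rfl
  | succ k ih => rw [binomialMean, ih]; ring

theorem binomialMean_mul_left (k : ℕ) (a : ℝ) (G : ℕ → ℝ) (p : ℝ) :
    binomialMean k (fun j => a * G j) p = a * binomialMean k G p := by
  induction k generalizing G with
  | zero => rfl
  | succ k ih => rw [binomialMean, binomialMean, ih, ih G]; ring

theorem binomialMean_const_sub (k : ℕ) (a : ℝ) (G : ℕ → ℝ) (p : ℝ) :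
    binomialMean k (fun j => a - G j) p = a - binomialMean k G p := by
  induction k generalizing G with
  | zero => rfl
  | succ k ih => rw [binomialMean, binomialMean, ih, ih G]; ring

theorem binomialMean_pow (k : ℕ) (y p : ℝ) :
    binomialMean k (fun j => y ^ j) p = (p * y + (1 - p)) ^ k := by
  induction k with
  | zero => simp [binomialMean]
  | succ k ih =>
    have : (fun j => y ^ (j + 1)) = fun j => y * y ^ j := by ext j; ring
    rw [binomialMean, this, binomialMean_mul_left, ih]; ring

theorem binomialMean_mono_right {k : ℕ} {G : ℕ → ℝ} (hG : Monotone G) {p p' : ℝ} (h0 : 0 ≤ p)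
    (h : p ≤ p') (h1 : p' ≤ 1) : binomialMean k G p ≤ binomialMean k G p' := by
  induction k generalizing G with
  | zero => rfl
  | succ k ih =>
    have ha := ih (G := fun j => G (j + 1)) fun i j hij => hG (by omega)
    have hb := ih hG
    have hc : binomialMean k G p' ≤ binomialMean k (fun j => G (j + 1)) p' :=
      binomialMean_mono (h0.trans h) h1 fun j => hG (by omega)
    rw [binomialMean, binomialMean]
    nlinarith [mul_le_mul_of_nonneg_left ha h0,
      mul_le_mul_of_nonneg_left hb (sub_nonneg.2 (h.trans h1)), mul_nonneg (sub_nonneg.2 h)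
        (sub_nonneg.2 hc)]

theorem sum_prod_eq_binomialMean {β : Type*} [Fintype β] (N : β → Prop) [DecidablePred N]
    (w : β → ℝ) (hw : ∑ b, w b = 1) (k : ℕ) (G : ℕ → ℝ) :
    ∑ a : Fin k → β, G (Finset.univ.filter fun i => N (a i)).card * ∏ i, w (a i) =
      binomialMean k G (∑ b with N b, w b) := by
  induction k generalizing G with
  | zero => simp [binomialMean]
  | succ k ih =>
    have hq : ∑ b with ¬ N b, w b = 1 - ∑ b with N b, w b := by
      rw [← hw, ← Finset.sum_filter_add_sum_filter_not Finset.univ N w]; ring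
    rw [← (Fin.consEquiv fun _ : Fin (k + 1) => β).sum_comp, Fintype.sum_prod_type,
      binomialMean, ← ih, ← ih, ← hq, ← Finset.sum_filter_add_sum_filter_not Finset.univ N,
      Finset.sum_mul, Finset.sum_mul]
    simp only [Finset.card_filter, Fin.sum_univ_succ, Fin.prod_univ_succ, Fin.consEquiv_apply,
      Fin.cons_zero, Fin.cons_succ]
    congr 1
    · refine Finset.sum_congr rfl fun b hb => ?_
      rw [Finset.mul_sum]
      refine Finset.sum_congr rfl fun a _ => ?_
      rw [if_pos (Finset.mem_filter.1 hb).2, add_comm 1]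
      ring
    · refine Finset.sum_congr rfl fun b hb => ?_
      rw [Finset.mul_sum]
      refine Finset.sum_congr rfl fun a _ => ?_
      rw [if_neg (Finset.mem_filter.1 hb).2, zero_add]
      ring

/-- The probability of a majority of successes in `k` trials with success probability `p`. -/
def majorityProb (k : ℕ) (p : ℝ) : ℝ := binomialMean k (fun j => if k < 2 * j then 1 else 0) p

theorem majorityProb_mono {k : ℕ} {p p' : ℝ} (h0 : 0 ≤ p) (h : p ≤ p') (h1 : p' ≤ 1) :
    majorityProb k p ≤ majorityProb k p' := by
  refine binomialMean_mono_right (fun i j hij => ?_) h0 h h1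
  split_ifs <;> first | omega | norm_num

theorem majorityProb_nonneg {k : ℕ} {p : ℝ} (h0 : 0 ≤ p) (h1 : p ≤ 1) : 0 ≤ majorityProb k p := by
  rw [← binomialMean_const k 0 p]
  exact binomialMean_mono h0 h1 fun j => by split_ifs <;> norm_num

theorem majorityProb_le_one {k : ℕ} {p : ℝ} (h0 : 0 ≤ p) (h1 : p ≤ 1) : majorityProb k p ≤ 1 := by
  rw [← binomialMean_const k 1 p]
  exact binomialMean_mono h0 h1 fun j => by split_ifs <;> norm_num

/-- Chernoff bound with base 4: the indicator of k < 2j is at most 4ʲ/2ᵏ. The complementary bound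
uses base 1/4. -/
theorem majorityProb_le {k : ℕ} {p : ℝ} (h0 : 0 ≤ p) (h1 : p ≤ 1) :
    majorityProb k p ≤ ((p * 4 + (1 - p)) / 2) ^ k := by
  rw [div_pow, ← binomialMean_pow, div_eq_inv_mul, ← binomialMean_mul_left]
  refine binomialMean_mono h0 h1 fun j => ?_
  split_ifs with h
  · rw [inv_mul_eq_div, le_div_iff₀ (by positivity), one_mul,
      show (4 : ℝ) = 2 ^ 2 by norm_num, ← pow_mul]
    exact pow_le_pow_right₀ (by norm_num) h.le
  · positivity

theorem one_sub_majorityProb_le {k : ℕ} {p : ℝ} (h0 : 0 ≤ p) (h1 : p ≤ 1) :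
    1 - majorityProb k p ≤ (2 * (p * (1 / 4) + (1 - p))) ^ k := by
  rw [mul_pow, ← binomialMean_pow, majorityProb, ← binomialMean_const_sub,
    ← binomialMean_mul_left]
  refine binomialMean_mono h0 h1 fun j => ?_
  split_ifs with h
  · rw [sub_self]; positivity
  · rw [sub_zero, one_div_pow, mul_one_div, le_div_iff₀ (by positivity), one_mul,
      show (4 : ℝ) = 2 ^ 2 by norm_num, ← pow_mul]
    exact pow_le_pow_right₀ (by norm_num) (by omega)

/-- For k = 1 and k = 2 the gap is exactly 0.62. From k = 7 on both error bounds are at most 0.785⁷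
< 0.19; the other values are computed. -/
theorem majorityProb_gap {k : ℕ} (hk : 1 ≤ k) :
    (0.62 : ℝ) ≤ majorityProb k 0.81 - majorityProb k 0.19 := by
  by_cases h : k < 7
  · interval_cases k <;> norm_num [majorityProb, binomialMean]
  · have h1 := majorityProb_le (k := k) (p := 0.19) (by norm_num) (by norm_num)
    have h2 := one_sub_majorityProb_le (k := k) (p := 0.81) (by norm_num) (by norm_num)
    have h3 : (0.785 : ℝ) ^ k ≤ 0.785 ^ 7 :=
      pow_le_pow_of_le_one (by norm_num) (by norm_num) (by omega)
    norm_num at h1 h2 h3 ⊢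
    linarith

end Binomial

/-! ### The outcome distribution of phase estimation -/

section Outcomes

theorem sum_bitsVal {E : Type*} [AddCommMonoid E] (m : ℕ) (F : ℕ → E) :
    ∑ b : Fin m → Bool, F (bitsVal b) = ∑ t ∈ Finset.range (2 ^ m), F t := by
  induction m generalizing F with
  | zero => simp [bitsVal]
  | succ m ih =>
    have h : ∀ (c : Bool) (b : Fin m → Bool),
        bitsVal (Fin.snocEquiv (fun _ : Fin (m + 1) => Bool) (c, b)) =
          bitsVal b + if c then 2 ^ m else 0 := fun c b => by
      simp [bitsVal, Fin.sum_univ_castSucc, Fin.snocEquiv]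
    rw [← (Fin.snocEquiv fun _ : Fin (m + 1) => Bool).sum_comp, Fintype.sum_prod_type]
    simp only [h, Fintype.univ_bool, Finset.sum_insert (show true ∉ ({false} : Finset Bool) by simp),
      Finset.sum_singleton, if_true, Bool.false_eq_true, if_false, add_zero]
    rw [ih, ih fun t => F (t + 2 ^ m), pow_succ, mul_two, Finset.sum_range_add, add_comm]
    simp only [add_comm]

/-- The probability with which phase estimation with `M` outcomes errs by `x`. -/
def fejer (M : ℕ) (x : ℝ) : ℝ := ‖∑ t ∈ Finset.range M, Complex.exp (Complex.I * x) ^ t‖ ^ 2 / M ^ 2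

theorem fejer_nonneg (M : ℕ) (x : ℝ) : 0 ≤ fejer M x := by unfold fejer; positivity

theorem fejer_le_one (M : ℕ) (x : ℝ) : fejer M x ≤ 1 := by
  unfold fejer
  refine div_le_one_of_le₀ ?_ (by positivity)
  refine pow_le_pow_left₀ (norm_nonneg _) ((norm_sum_le _ _).trans ?_) 2
  simp [mul_comm Complex.I, Complex.norm_exp_ofReal_mul_I]

theorem fejer_zero {M : ℕ} (hM : M ≠ 0) : fejer M 0 = 1 := by
  simp [fejer, hM]

theorem fejer_neg (M : ℕ) (x : ℝ) : fejer M (-x) = fejer M x := by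
  unfold fejer
  rw [← Complex.norm_conj]
  congr 3
  simp [← Complex.exp_conj]

theorem fejer_add_two_pi (M : ℕ) (x : ℝ) : fejer M (x + 2 * Real.pi) = fejer M x := by
  unfold fejer
  have : Complex.exp (Complex.I * ((x + 2 * Real.pi : ℝ) : ℂ)) = Complex.exp (Complex.I * x) := by
    rw [← Complex.exp_periodic (Complex.I * x)]
    congr 1; push_cast; ring
  rw [this]

/-- The geometric sum in product form, valid also where the sine in the denominator vanishes. -/
theorem fejer_mul_sin_sq {M : ℕ} (hM : M ≠ 0) (x : ℝ) :
    M ^ 2 * fejer M x * Real.sin (x / 2) ^ 2 = Real.sin (M * x / 2) ^ 2 := by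
  have h1 := geom_sum_mul (Complex.exp (Complex.I * x)) M
  have h2 : Complex.exp (Complex.I * x) ^ M = Complex.exp (Complex.I * ((M * x : ℝ) : ℂ)) := by
    rw [← Complex.exp_nat_mul]; congr 1; push_cast; ring
  have h3 := congrArg (fun u => ‖u‖ ^ 2) (h1.trans (by rw [h2]))
  simp only [norm_mul, mul_pow, Complex.norm_exp_I_mul_ofReal_sub_one, Real.norm_eq_abs,
    sq_abs] at h3
  have hM' : (M : ℝ) ^ 2 ≠ 0 := by positivity
  unfold fejer
  rw [mul_div_cancel₀ _ hM']
  linarith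

theorem norm_outcomeAmplitude_sq (m : ℕ) (α : ℝ) (b : Fin m → Bool) :
    ‖outcomeAmplitude m (Complex.exp (α * Complex.I)) b‖ ^ 2 =
      fejer (2 ^ m) (α - 2 * Real.pi * bitsVal b / 2 ^ m) := by
  unfold outcomeAmplitude fejer
  rw [norm_div, div_pow, ← sum_bitsVal]
  congr 1
  · congr 2
    refine Finset.sum_congr rfl fun b' _ => ?_
    rw [← Complex.exp_nat_mul, ← Complex.exp_nat_mul, ← Complex.exp_add]
    congr 1; push_cast; ring
  · simp

theorem sum_exp_range {M : ℕ} (t t' : ℕ) (ht : t < M) (ht' : t' < M) :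
    ∑ s ∈ Finset.range M, Complex.exp (2 * Real.pi * Complex.I * (t - t') / M) ^ s =
      if t = t' then (M : ℂ) else 0 := by
  split_ifs with h
  · subst h; simp
  · have hM : (M : ℂ) ≠ 0 := by norm_cast; omega
    have h1 := geom_sum_mul (Complex.exp (2 * Real.pi * Complex.I * (t - t') / M)) M
    have h2 : Complex.exp (2 * Real.pi * Complex.I * (t - t') / M) ^ M = 1 := by
      rw [← Complex.exp_nat_mul, Complex.exp_eq_one_iff]
      refine ⟨(t : ℤ) - t', ?_⟩
      push_cast; field_simp
    rw [h2, sub_self] at h1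
    refine (mul_eq_zero.1 h1).resolve_right fun h3 => ?_
    obtain ⟨r, hr⟩ := Complex.exp_eq_one_iff.1 (sub_eq_zero.1 h3)
    have h4 : ((t : ℂ) - t') = r * M := by
      have := Complex.two_pi_I_ne_zero
      field_simp at hr
      rw [hr, mul_comm]
    have h5 : (t : ℤ) - t' = r * M := by exact_mod_cast h4
    have h6 : r = 0 := by
      by_contra h0
      rcases lt_or_gt_of_ne h0 with h0 | h0 <;> nlinarith
    rw [h6] at h5
    omega

/-- Expanding the squared modulus, orthogonality of the M-th roots of unity leaves only the diagonal
terms. -/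
theorem sum_fejer {M : ℕ} (hM : M ≠ 0) (α : ℝ) :
    ∑ s ∈ Finset.range M, fejer M (α - 2 * Real.pi * s / M) = 1 := by
  have hM' : (M : ℂ) ≠ 0 := by exact_mod_cast hM
  have h : ((∑ s ∈ Finset.range M, fejer M (α - 2 * Real.pi * s / M) : ℝ) : ℂ) = 1 := by
    unfold fejer
    push_cast
    rw [← Finset.sum_div, div_eq_iff (by positivity), one_mul]
    have h1 : ∀ s : ℕ, ((‖∑ t ∈ Finset.range M,
        Complex.exp (Complex.I * (α - 2 * Real.pi * s / M)) ^ t‖ : ℝ) : ℂ) ^ 2 =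
        ∑ t ∈ Finset.range M, ∑ t' ∈ Finset.range M, Complex.exp (Complex.I * α * (t - t')) *
          Complex.exp (2 * Real.pi * Complex.I * (t' - t) / M) ^ s := fun s => by
      rw [← Complex.mul_conj', map_sum, Finset.sum_mul_sum]
      refine Finset.sum_congr rfl fun t _ => Finset.sum_congr rfl fun t' _ => ?_
      rw [map_pow, ← Complex.exp_conj, ← Complex.exp_nat_mul, ← Complex.exp_nat_mul,
        ← Complex.exp_nat_mul, ← Complex.exp_add, ← Complex.exp_add]
      congr 1
      simp only [map_mul, map_sub, map_div₀, map_natCast, Complex.conj_I, Complex.conj_ofReal,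
        map_ofNat]
      ring
    simp only [h1]
    rw [Finset.sum_comm]
    have h2 : ∀ t ∈ Finset.range M, ∑ s ∈ Finset.range M, ∑ t' ∈ Finset.range M,
        Complex.exp (Complex.I * α * (t - t')) *
          Complex.exp (2 * Real.pi * Complex.I * (t' - t) / M) ^ s = M := fun t ht => by
      rw [Finset.sum_comm, Finset.sum_eq_single_of_mem t ht]
      · simp
      · intro t' ht' hne
        rw [← Finset.mul_sum, sum_exp_range t' t (Finset.mem_range.1 ht') (Finset.mem_range.1 ht),
          if_neg hne, mul_zero]
    rw [Finset.sum_congr rfl h2]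
    simp [sq]
  exact_mod_cast h

/-- The probability that phase estimation with `M` outcomes gives a negative phase, on an
eigenvector of phase `α`. -/
def negativeProb (M : ℕ) (α : ℝ) : ℝ :=
  ∑ s ∈ (Finset.range M).filter (fun s => M < 2 * s), fejer M (α - 2 * Real.pi * s / M)

theorem negativeProb_nonneg (M : ℕ) (α : ℝ) : 0 ≤ negativeProb M α :=
  Finset.sum_nonneg fun _ _ => fejer_nonneg _ _

/-- Reflection s ↦ M - s of the outcomes. The outcomes 0 and M/2 lie in neither set, because the
estimates 0 and π are not negative. -/
theorem negativeProb_neg {M : ℕ} (hM : M ≠ 0) (α : ℝ) : negativeProb M (-α) =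
    ∑ s ∈ (Finset.range M).filter (fun s => 0 < s ∧ 2 * s < M),
      fejer M (α - 2 * Real.pi * s / M) := by
  unfold negativeProb
  refine Finset.sum_nbij' (fun s => M - s) (fun s => M - s) ?_ ?_ ?_ ?_ ?_
  · intro s hs; simp only [Finset.mem_filter, Finset.mem_range] at hs ⊢; omega
  · intro s hs; simp only [Finset.mem_filter, Finset.mem_range] at hs ⊢; omega
  · intro s hs; simp only [Finset.mem_filter, Finset.mem_range] at hs ⊢; omega
  · intro s hs; simp only [Finset.mem_filter, Finset.mem_range] at hs ⊢; omega
  · intro s hs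
    simp only [Finset.mem_filter, Finset.mem_range] at hs
    rw [Nat.cast_sub hs.1.le, ← fejer_neg, ← fejer_add_two_pi M (α - _)]
    congr 1
    have : (M : ℝ) ≠ 0 := by exact_mod_cast hM
    field_simp
    ring

theorem negativeProb_add_neg_le {M : ℕ} (hM : M ≠ 0) (α : ℝ) :
    negativeProb M α + negativeProb M (-α) ≤ 1 := by
  rw [negativeProb_neg hM, negativeProb, ← Finset.sum_union, ← sum_fejer hM α]
  · refine Finset.sum_le_sum_of_subset_of_nonneg (Finset.union_subset (Finset.filter_subset _ _)
      (Finset.filter_subset _ _)) fun _ _ _ => fejer_nonneg _ _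
  · rw [Finset.disjoint_filter]
    intro s _ h1 h2
    omega

theorem negativeProb_le_one {M : ℕ} (hM : M ≠ 0) (α : ℝ) : negativeProb M α ≤ 1 := by
  linarith [negativeProb_add_neg_le hM α, negativeProb_nonneg M (-α)]

theorem sin_sq_sub_int_mul_pi (x : ℝ) (n : ℕ) : Real.sin (x - n * Real.pi) ^ 2 = Real.sin x ^ 2 := by
  rw [Real.sin_sub_nat_mul_pi, mul_pow, ← pow_mul, mul_comm n, pow_mul]; simp

/-- For each negative outcome the kernels at α and -α have the same numerator sin²(Mα/2), and the
denominators compare because sin α ≥ 0 while the sine of the outcome's angle, in [π, 2π], is ≤ 0. -/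
theorem negativeProb_le_neg {M : ℕ} (hM : M ≠ 0) {α : ℝ} (h0 : 0 ≤ α) (h1 : α ≤ Real.pi) :
    negativeProb M α ≤ negativeProb M (-α) := by
  refine Finset.sum_le_sum fun s hs => ?_
  simp only [Finset.mem_filter, Finset.mem_range] at hs
  have hM0 : (0 : ℝ) < M := by positivity
  rw [← fejer_neg M (-α - _)]
  set x : ℝ := 2 * Real.pi * s / M with hx
  have hMx : M * x / 2 = s * Real.pi := by rw [hx]; field_simp
  have e1 := fejer_mul_sin_sq hM (α - x)
  have e2 := fejer_mul_sin_sq hM (-(-α - x))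
  have e3 : Real.sin (M * (α - x) / 2) ^ 2 = Real.sin (M * (-(-α - x)) / 2) ^ 2 := by
    rw [show M * (-(-α - x)) / 2 = M * α / 2 + s * Real.pi by rw [← hMx]; ring,
      show M * (α - x) / 2 = M * α / 2 - s * Real.pi by rw [← hMx]; ring,
      sin_sq_sub_int_mul_pi, ← sin_sq_sub_int_mul_pi (_ + _) s, add_sub_cancel_right]
  have e4 : Real.sin ((-(-α - x)) / 2) ^ 2 ≤ Real.sin ((α - x) / 2) ^ 2 := by
    have hxs : Real.sin x ≤ 0 := by
      have ha : Real.pi ≤ x := by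
        rw [hx, le_div_iff₀ hM0]
        have : (M : ℝ) ≤ 2 * s := by exact_mod_cast hs.2.le
        nlinarith [Real.pi_pos]
      have hb : x ≤ 2 * Real.pi := by
        rw [hx, div_le_iff₀ hM0]
        have : (s : ℝ) ≤ M := by exact_mod_cast hs.1.le
        nlinarith [Real.pi_pos]
      rw [← Real.sin_sub_two_pi]
      exact Real.sin_nonpos_of_nonpos_of_neg_pi_le (by linarith) (by linarith)
    have hαs := Real.sin_nonneg_of_nonneg_of_le_pi h0 h1
    rw [Real.sin_sq_eq_half_sub, Real.sin_sq_eq_half_sub,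
      show 2 * (-(-α - x) / 2) = α + x by ring, show 2 * ((α - x) / 2) = α - x by ring,
      Real.cos_add, Real.cos_sub]
    nlinarith [mul_nonneg hαs (neg_nonneg.2 hxs)]
  -- If the smaller denominator vanishes, the outcome is exact for -α and has probability 1.
  by_cases h : Real.sin ((-(-α - x)) / 2) = 0
  · have : fejer M (-(-α - x)) = 1 := by
      obtain ⟨n, hn⟩ := Real.sin_eq_zero_iff.1 h
      unfold fejer
      have : Complex.exp (Complex.I * ((-(-α - x) : ℝ) : ℂ)) = 1 := by
        rw [Complex.exp_eq_one_iff]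
        refine ⟨n, ?_⟩
        rw [show -(-α - x) = 2 * (n * Real.pi) by linarith]
        push_cast; ring
      rw [this]; simp [hM]
    rw [this]; exact fejer_le_one _ _
  · have h' : 0 < Real.sin ((-(-α - x)) / 2) ^ 2 := by positivity
    have hM2 : (0 : ℝ) < M ^ 2 := by positivity
    by_contra! hlt
    have := mul_lt_mul_of_pos_right (mul_lt_mul_of_pos_left hlt hM2) h'
    have := mul_le_mul_of_nonneg_left e4 (mul_nonneg hM2.le (fejer_nonneg M (α - x)))
    linarith

end Outcomes

/-! ### The signs applied by the majority vote -/

section Signs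

theorem sin_sq_ge_of_le {x : ℝ} (h0 : 0 < x) (h1 : x ≤ 0.6) : 0.81 * x ^ 2 ≤ Real.sin x ^ 2 := by
  have h := Real.sin_gt_sub_cube h0
  have h2 : 0.9 * x ≤ x - x ^ 3 / 6 := by
    nlinarith [mul_nonneg h0.le (mul_nonneg h0.le (sub_nonneg.2 h1)), mul_nonneg h0.le
      (sub_nonneg.2 h1)]
  have h3 : (0.9 * x) ^ 2 ≤ Real.sin x ^ 2 := pow_le_pow_left₀ (by positivity) (by linarith) 2
  nlinarith

/-- Here f and 1 - f are the distances, in grid units, from the phase to its two neighbouring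
outcomes. At f = 1/2 the sum is 8/π² ≈ 0.8106, so 0.81 leaves little room. For f ≤ 0.19 the nearer
outcome alone suffices, as sin x ≥ 0.9 x for 0 < x ≤ 0.6. -/
theorem two_outcomes_of_le_half {f : ℝ} (h0 : 0 < f) (h1 : f ≤ 1 / 2) :
    0.81 ≤ Real.sin (Real.pi * f) ^ 2 / (Real.pi * f) ^ 2 +
      Real.sin (Real.pi * f) ^ 2 / (Real.pi * (1 - f)) ^ 2 := by
  have hπ := Real.pi_gt_d4
  have hπ' := Real.pi_lt_d4
  have hf : 0 < Real.pi * f := by positivity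
  have hf1 : 0 < Real.pi * (1 - f) := by
    have : 0 < 1 - f := by linarith
    positivity
  by_cases h : f ≤ 0.19
  · have h2 := sin_sq_ge_of_le hf (by nlinarith)
    have h3 : 0 ≤ Real.sin (Real.pi * f) ^ 2 / (Real.pi * (1 - f)) ^ 2 := by positivity
    have h4 : 0.81 ≤ Real.sin (Real.pi * f) ^ 2 / (Real.pi * f) ^ 2 := by
      rw [le_div_iff₀ (by positivity)]; exact h2
    linarith
  · push Not at h
    obtain ⟨g, rfl⟩ : ∃ g, f = 1 / 2 - g := ⟨1 / 2 - f, by ring⟩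
    have hg0 : 0 ≤ g := by linarith
    have hg1 : g ≤ 0.31 := by linarith
    have hs : Real.sin (Real.pi * (1 / 2 - g)) = Real.cos (Real.pi * g) := by
      rw [← Real.sin_pi_div_two_sub]; congr 1; ring
    have hc := Real.one_sub_sq_div_two_le_cos (x := Real.pi * g)
    have hu : g ^ 2 ≤ 0.0961 := by nlinarith
    have hu0 : 0 ≤ g ^ 2 := sq_nonneg g
    have hp2 : Real.pi ^ 2 ≤ 9.87 := by nlinarith
    have hp0 : 0 < Real.pi ^ 2 := by positivity
    have hc1 : 1 - 4.935 * g ^ 2 ≤ Real.cos (Real.pi * g) := by nlinarith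
    have hc2 : (1 - 4.935 * g ^ 2) ^ 2 ≤ Real.cos (Real.pi * g) ^ 2 :=
      pow_le_pow_left₀ (by nlinarith) hc1 2
    rw [hs, show (1 : ℝ) - (1 / 2 - g) = 1 / 2 + g by ring, mul_pow, mul_pow]
    have ha : 0 < 1 / 2 - g := by linarith
    have hb : 0 < 1 / 2 + g := by linarith
    rw [div_add_div _ _ (by positivity) (by positivity), le_div_iff₀ (by positivity)]
    have key : 0.81 * 9.87 * (1 / 4 - g ^ 2) ^ 2 ≤ (1 - 4.935 * g ^ 2) ^ 2 * (1 / 2 + 2 * g ^ 2) := by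
      generalize g ^ 2 = u at hu hu0
      have h5 : 0 ≤ 1.06 - 15.57 * u + 48.7 * u ^ 2 := by nlinarith
      nlinarith [mul_nonneg hu0 h5, mul_nonneg hu0 hu0, mul_nonneg hu0 (mul_nonneg hu0 hu0)]
    have e1 : (0.81 : ℝ) * (Real.pi ^ 2 * (1 / 2 - g) ^ 2 * (Real.pi ^ 2 * (1 / 2 + g) ^ 2)) =
        Real.pi ^ 2 * (0.81 * Real.pi ^ 2 * (1 / 4 - g ^ 2) ^ 2) := by ring
    have e2 : Real.cos (Real.pi * g) ^ 2 * (Real.pi ^ 2 * (1 / 2 + g) ^ 2) +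
        Real.pi ^ 2 * (1 / 2 - g) ^ 2 * Real.cos (Real.pi * g) ^ 2 =
        Real.pi ^ 2 * (Real.cos (Real.pi * g) ^ 2 * (1 / 2 + 2 * g ^ 2)) := by ring
    rw [e1, e2]
    refine mul_le_mul_of_nonneg_left ?_ hp0.le
    calc 0.81 * Real.pi ^ 2 * (1 / 4 - g ^ 2) ^ 2 ≤ 0.81 * 9.87 * (1 / 4 - g ^ 2) ^ 2 := by
          gcongr
      _ ≤ _ := key
      _ ≤ _ := mul_le_mul_of_nonneg_right hc2 (by positivity)

theorem two_outcomes {f : ℝ} (h0 : 0 < f) (h1 : f < 1) :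
    0.81 ≤ Real.sin (Real.pi * f) ^ 2 / (Real.pi * f) ^ 2 +
      Real.sin (Real.pi * f) ^ 2 / (Real.pi * (1 - f)) ^ 2 := by
  rcases le_total f (1 / 2) with h | h
  · exact two_outcomes_of_le_half h0 h
  · have := two_outcomes_of_le_half (f := 1 - f) (by linarith) (by linarith)
    rw [show Real.pi * (1 - f) = Real.pi - Real.pi * f by ring, Real.sin_pi_sub,
      show Real.pi * (1 - (1 - f)) = Real.pi * f by ring] at this
    rw [show Real.pi * (1 - f) = Real.pi - Real.pi * f by ring]
    linarith

theorem fejer_ge {M : ℕ} (hM : M ≠ 0) {x : ℝ} (hx : x ≠ 0) :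
    Real.sin (M * x / 2) ^ 2 / (M * x / 2) ^ 2 ≤ fejer M x := by
  have h := fejer_mul_sin_sq hM x
  have hM0 : (0 : ℝ) < M := by positivity
  rw [div_le_iff₀ (by positivity), ← h, show ((M : ℝ) * x / 2) ^ 2 = M ^ 2 * (x / 2) ^ 2 by ring]
  have h1 : Real.sin (x / 2) ^ 2 ≤ (x / 2) ^ 2 := by
    rw [sq_le_sq]; exact Real.abs_sin_le_abs
  nlinarith [mul_le_mul_of_nonneg_left h1 (mul_nonneg (sq_nonneg (M : ℝ)) (fejer_nonneg M x))]

/-- With t = Mα/2π, both neighbours of t lie strictly between 0 and M/2: t > 1 on one side, and t ≤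
3M/8 with M ≥ 8 on the other. They already have probability 0.81. -/
theorem negativeProb_neg_ge {M : ℕ} (hM : 8 ≤ M) {α : ℝ} (h1 : 2 * Real.pi < M * α)
    (h2 : α ≤ 3 * Real.pi / 4) : 0.81 ≤ negativeProb M (-α) := by
  have hM' : M ≠ 0 := by omega
  have hM0 : (0 : ℝ) < M := by positivity
  have hM8 : (8 : ℝ) ≤ M := by exact_mod_cast hM
  have hπ := Real.pi_pos
  rw [negativeProb_neg hM']
  set t : ℝ := M * α / (2 * Real.pi) with ht
  have ht1 : 1 < t := by rw [ht, lt_div_iff₀ (by positivity)]; linarith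
  have ht2 : t ≤ 3 * M / 8 := by
    rw [ht, div_le_iff₀ (by positivity)]; nlinarith
  obtain ⟨c, hc⟩ : ∃ c, c = ⌈t⌉₊ := ⟨_, rfl⟩
  have hct : t ≤ c := hc ▸ Nat.le_ceil t
  have hct' : (c : ℝ) < t + 1 := hc ▸ Nat.ceil_lt_add_one (by linarith)
  have hc1 : 1 < c := by exact_mod_cast ht1.trans_le hct
  have hcM : 2 * c < M + 2 := by
    have : (2 * c : ℝ) < M + 2 := by nlinarith
    exact_mod_cast this
  have hα : α = 2 * Real.pi * t / M := by rw [ht]; field_simp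
  have hcm : 2 * c < M := by
    by_contra! h
    have : (M : ℝ) ≤ 2 * c := by exact_mod_cast h
    nlinarith
  have hmem : c ∈ (Finset.range M).filter (fun s => 0 < s ∧ 2 * s < M) := by
    simp only [Finset.mem_filter, Finset.mem_range]; omega
  have hmem' : c - 1 ∈ (Finset.range M).filter (fun s => 0 < s ∧ 2 * s < M) := by
    simp only [Finset.mem_filter, Finset.mem_range]; omega
  have hcast : ((c - 1 : ℕ) : ℝ) = c - 1 := by rw [Nat.cast_sub hc1.le]; simp
  rcases hct.eq_or_lt with h | h
  · have : fejer M (α - 2 * Real.pi * c / M) = 1 := by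
      rw [hα, h, sub_self, fejer_zero hM']
    have := Finset.single_le_sum (f := fun s : ℕ => fejer M (α - 2 * Real.pi * s / M))
      (fun _ _ => fejer_nonneg _ _) hmem
    norm_num at this ⊢
    linarith
  · have hsub : ({c, c - 1} : Finset ℕ) ⊆ (Finset.range M).filter (fun s => 0 < s ∧ 2 * s < M) := by
      intro s hs
      rcases Finset.mem_insert.1 hs with rfl | hs
      · exact hmem
      · rw [Finset.mem_singleton.1 hs]; exact hmem'
    have h3 := Finset.sum_le_sum_of_subset_of_nonneg
      (f := fun s : ℕ => fejer M (α - 2 * Real.pi * s / M)) hsub fun _ _ _ => fejer_nonneg _ _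
    rw [Finset.sum_pair (by omega)] at h3
    refine le_trans ?_ h3
    have e1 : α - 2 * Real.pi * c / M = -(2 * Real.pi * (c - t) / M) := by rw [hα]; ring
    have e2 : α - 2 * Real.pi * ((c - 1 : ℕ) : ℝ) / M = 2 * Real.pi * (1 - (c - t)) / M := by
      rw [hα, hcast]; ring
    rw [e1, e2, fejer_neg]
    have hf : 0 < (c : ℝ) - t := by linarith
    have hf1 : 0 < 1 - ((c : ℝ) - t) := by linarith
    have g1 := fejer_ge hM' (x := 2 * Real.pi * (c - t) / M) (by positivity)
    have g2 := fejer_ge hM' (x := 2 * Real.pi * (1 - (c - t)) / M) (by positivity)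
    have g3 := two_outcomes hf (by linarith)
    rw [show M * (2 * Real.pi * (c - t) / M) / 2 = Real.pi * (c - t) by field_simp] at g1
    rw [show M * (2 * Real.pi * (1 - (c - t)) / M) / 2 = Real.pi * (1 - (c - t)) by field_simp] at g2
    rw [show Real.pi * (1 - (c - t)) = Real.pi - Real.pi * (c - t) by ring, Real.sin_pi_sub,
      ← show Real.pi * (1 - (c - t)) = Real.pi - Real.pi * (c - t) by ring] at g2
    linarith

theorem estimatedPhase_neg_iff {m : ℕ} (b : Fin m → Bool) (hb : bitsVal b < 2 ^ m) :
    estimatedPhase b < 0 ↔ 2 ^ m < 2 * bitsVal b := by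
  unfold estimatedPhase
  have hπ := Real.pi_pos
  split_ifs with h
  · have : 0 ≤ 2 * Real.pi * bitsVal b / 2 ^ m := by positivity
    constructor
    · intro h'; linarith
    · intro h'; omega
  · refine iff_of_true ?_ (by omega)
    have : (bitsVal b : ℝ) < 2 ^ m := by exact_mod_cast hb
    rw [sub_neg, div_lt_iff₀ (by positivity)]
    nlinarith

theorem bitsVal_lt {m : ℕ} (b : Fin m → Bool) : bitsVal b < 2 ^ m := by
  unfold bitsVal
  calc ∑ j : Fin m, (if b j then 2 ^ (j : ℕ) else 0) ≤ ∑ j : Fin m, 2 ^ (j : ℕ) :=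
        Finset.sum_le_sum fun j _ => by split_ifs <;> simp
    _ = ∑ j ∈ Finset.range m, 2 ^ j := Fin.sum_univ_eq_sum_range (fun j => 2 ^ j) m
    _ < 2 ^ m := by
      have := Nat.geomSum_eq (le_refl 2) m
      rw [this]; have : 0 < 2 ^ m := by positivity
      omega

theorem rotateSign_eq (k m : ℕ) (α : ℝ) :
    rotateSign k m (Complex.exp (α * Complex.I)) =
      1 - 2 * majorityProb k (negativeProb (2 ^ m) α) := by
  have hM : (2 : ℕ) ^ m ≠ 0 := by positivity
  have hw : ∑ b : Fin m → Bool, ‖outcomeAmplitude m (Complex.exp (α * Complex.I)) b‖ ^ 2 = 1 := by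
    simp only [norm_outcomeAmplitude_sq]
    rw [sum_bitsVal m fun s : ℕ => fejer (2 ^ m) (α - 2 * Real.pi * s / 2 ^ m), ← sum_fejer hM α]
    simp
  have hp : ∑ b : Fin m → Bool with estimatedPhase b < 0,
      ‖outcomeAmplitude m (Complex.exp (α * Complex.I)) b‖ ^ 2 = negativeProb (2 ^ m) α := by
    simp only [norm_outcomeAmplitude_sq]
    rw [Finset.sum_filter, negativeProb, Finset.sum_filter, ← sum_bitsVal]
    refine Finset.sum_congr rfl fun b _ => ?_
    rw [if_congr (estimatedPhase_neg_iff b (bitsVal_lt b)) rfl rfl]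
    push_cast; rfl
  have h := sum_prod_eq_binomialMean (fun b : Fin m → Bool => estimatedPhase b < 0) _ hw k
    (fun j => if k < 2 * j then -1 else 1)
  rw [hp] at h
  have hG : (fun j : ℕ => if k < 2 * j then (-1 : ℝ) else 1) =
      fun j => 1 - 2 * (if k < 2 * j then 1 else 0) := by
    ext j; split_ifs <;> norm_num
  rw [rotateSign, h, hG, binomialMean_const_sub, binomialMean_mul_left]
  rfl

/-- The difference of the signs that `rotate` applies to the phases `α` and `-α`. -/
def signGap (k m : ℕ) (α : ℝ) : ℝ :=
  rotateSign k m (Complex.exp (α * Complex.I)) -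
    rotateSign k m (Complex.exp ((-α : ℝ) * Complex.I))

theorem signGap_eq (k m : ℕ) (α : ℝ) : signGap k m α =
    2 * (majorityProb k (negativeProb (2 ^ m) (-α)) - majorityProb k (negativeProb (2 ^ m) α)) := by
  rw [signGap, rotateSign_eq, rotateSign_eq]; ring

theorem signGap_nonneg (k m : ℕ) {α : ℝ} (h0 : 0 ≤ α) (h1 : α ≤ Real.pi) : 0 ≤ signGap k m α := by
  have hM : (2 : ℕ) ^ m ≠ 0 := by positivity
  have := majorityProb_mono (k := k) (negativeProb_nonneg (2 ^ m) α) (negativeProb_le_neg hM h0 h1)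
    (negativeProb_le_one hM _)
  rw [signGap_eq]; linarith

theorem signGap_le_two (k m : ℕ) (α : ℝ) : signGap k m α ≤ 2 := by
  have hM : (2 : ℕ) ^ m ≠ 0 := by positivity
  have h1 := majorityProb_le_one (k := k) (negativeProb_nonneg (2 ^ m) (-α))
    (negativeProb_le_one hM _)
  have h2 := majorityProb_nonneg (k := k) (negativeProb_nonneg (2 ^ m) α) (negativeProb_le_one hM _)
  rw [signGap_eq]; linarith

theorem signGap_ge {k m : ℕ} (hk : 1 ≤ k) (hm : 8 ≤ 2 ^ m) {α : ℝ}
    (h1 : 2 * Real.pi < 2 ^ m * α) (h2 : α ≤ 3 * Real.pi / 4) : 1.24 ≤ signGap k m α := by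
  have hM : (2 : ℕ) ^ m ≠ 0 := by positivity
  have h3 := negativeProb_neg_ge hm (α := α) (by exact_mod_cast h1) h2
  have h4 : negativeProb (2 ^ m) α ≤ 0.19 := by
    have := negativeProb_add_neg_le hM α
    norm_num at h3 ⊢; linarith
  have h5 := majorityProb_mono (k := k) (by norm_num) h3 (negativeProb_le_one hM _)
  have h6 := majorityProb_mono (k := k) (negativeProb_nonneg (2 ^ m) α) h4 (by norm_num)
  have h7 := majorityProb_gap hk
  rw [signGap_eq]
  norm_num at h5 h6 h7 ⊢
  linarith

end Signs

/-! ### Parameters of the rotation -/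

section Parameters

theorem one_le_repetitions {κ : ℝ} (hκ : 0 < κ) : 1 ≤ repetitions κ (1 / 4) := by
  rw [repetitions, Nat.one_le_ceil_iff]
  have : 0 < Real.log (1 / (1 / 4)) := Real.log_pos (by norm_num)
  positivity

theorem two_pi_mul_le_two_pow (T : ℝ) : 2 * Real.pi * T ≤ 2 ^ precisionBits (1 / T) := by
  have h1 : ⌈2 * Real.pi / (1 / T)⌉₊ ≤ 2 ^ precisionBits (1 / T) := Nat.le_pow_clog (by norm_num) _
  have h2 := Nat.le_ceil (2 * Real.pi / (1 / T))
  rw [div_div_eq_mul_div, div_one] at h1 h2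
  exact h2.trans (by exact_mod_cast h1)

theorem eight_le_two_pow {T : ℝ} (hT : 0.7 ≤ T) : 8 ≤ 2 ^ precisionBits (1 / T) := by
  have h1 := two_pi_mul_le_two_pow T
  have h2 : (4 : ℝ) < 2 ^ precisionBits (1 / T) := by nlinarith [Real.pi_gt_three]
  have h3 : 2 ^ 2 < 2 ^ precisionBits (1 / T) := by
    have : (2 : ℕ) ^ 2 = 4 := by norm_num
    rw [this]; exact_mod_cast h2
  have h4 := (Nat.pow_lt_pow_iff_right (by norm_num)).1 h3
  calc 8 = 2 ^ 3 := by norm_num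
    _ ≤ _ := Nat.pow_le_pow_right (by norm_num) h4

/-- Minimality of m gives 2ᵐ < 2(2πT + 1), and T ≥ 0.7 absorbs the additive constant. -/
theorem two_pow_le {T : ℝ} (hT : 0.7 ≤ T) : (2 : ℝ) ^ precisionBits (1 / T) ≤ 16 * T := by
  have hT0 : 0 < T := by norm_num at hT; linarith
  have h0 : 2 * Real.pi / (1 / T) = 2 * Real.pi * T := by field_simp
  have h3 := Nat.ceil_lt_add_one (a := 2 * Real.pi * T) (by positivity)
  have h4 := Nat.le_ceil (2 * Real.pi * T)
  have hN : 1 < ⌈2 * Real.pi * T⌉₊ := by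
    have : (1 : ℝ) < ⌈2 * Real.pi * T⌉₊ := by nlinarith [Real.pi_gt_three]
    exact_mod_cast this
  have h1 : 2 ^ (precisionBits (1 / T)).pred < ⌈2 * Real.pi * T⌉₊ := by
    rw [precisionBits, h0]; exact Nat.pow_pred_clog_lt_self (by norm_num) hN
  have h2 : 0 < precisionBits (1 / T) := by
    rw [precisionBits, h0]; exact Nat.clog_pos (by norm_num) hN
  obtain ⟨m, hm⟩ : ∃ m, precisionBits (1 / T) = m + 1 := ⟨_, (Nat.succ_pred_eq_of_pos h2).symm⟩
  rw [hm] at h1 ⊢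
  have h5 : (2 : ℝ) ^ m < ⌈2 * Real.pi * T⌉₊ := by exact_mod_cast h1
  have := Real.pi_lt_d2
  have h6 : (2 : ℝ) ^ m + 0 ≤ 2 * Real.pi * T + 1 := by linarith
  rw [pow_succ]
  norm_num at hT
  nlinarith

variable {k m : ℕ}

theorem OracleCircuit.calls_append (c d : OracleCircuit k m) :
    OracleCircuit.calls (c ++ d) = OracleCircuit.calls c + OracleCircuit.calls d := by
  simp [OracleCircuit.calls]

theorem OracleCircuit.calls_inv (c : OracleCircuit k m) : c.inv.calls = c.calls := by
  have h : OracleGate.calls ∘ OracleGate.inv = (OracleGate.calls : OracleGate k m → ℕ) := by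
    ext g; cases g <;> rfl
  rw [OracleCircuit.calls, OracleCircuit.inv, List.map_reverse, List.sum_reverse, List.map_map, h,
    OracleCircuit.calls]

theorem OracleCircuit.calls_flatMap {β : Type*} (L : List β) (F : β → OracleCircuit k m) :
    OracleCircuit.calls (L.flatMap F) = (L.map fun b => (F b).calls).sum := by
  induction L with
  | nil => rfl
  | cons b L ih => rw [List.flatMap_cons, OracleCircuit.calls_append, ih]; simp

theorem calls_estimate_le (i : Fin k) : OracleCircuit.calls (estimate (m := m) i) ≤ 2 ^ m := by
  have h : OracleCircuit.calls (estimate (m := m) i) = ∑ j : Fin m, 2 ^ (j : ℕ) := by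
    rw [estimate, OracleCircuit.calls_append, OracleCircuit.calls_append,
      OracleCircuit.calls_flatMap, ← List.ofFn_eq_map, List.sum_ofFn]
    simp [OracleCircuit.calls, OracleGate.calls]
  rw [h, Fin.sum_univ_eq_sum_range (fun j => 2 ^ j) m, Nat.geomSum_eq (le_refl 2) m]
  simp

theorem calls_rotate_le (κ Δ ε : ℝ) :
    OracleCircuit.calls (rotate κ Δ ε) ≤ 2 * (repetitions κ ε * 2 ^ precisionBits Δ) := by
  have h : ∀ k m : ℕ, OracleCircuit.calls (estimates k m) ≤ k * 2 ^ m := fun k m => by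
    rw [estimates, OracleCircuit.calls_flatMap]
    refine (List.sum_le_card_nsmul _ (2 ^ m) ?_).trans (by simp)
    intro x hx
    obtain ⟨i, _, rfl⟩ := List.mem_map.1 hx
    exact calls_estimate_le i
  rw [rotate, OracleCircuit.calls_append, OracleCircuit.calls_append, OracleCircuit.calls_inv]
  have := h (repetitions κ ε) (precisionBits Δ)
  have h2 : OracleCircuit.calls [OracleGate.onAncilla
    (majorityFlip (repetitions κ ε) (precisionBits Δ))] = 0 := rfl
  rw [h2]
  omega

theorem calls_rotate_le_mul (κ : ℝ) {T : ℝ} (hT : 0.7 ≤ T) :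
    (OracleCircuit.calls (rotate κ (1 / T) (1 / 4)) : ℝ) ≤ 32 * repetitions κ (1 / 4) * T := by
  have h1 : (OracleCircuit.calls (rotate κ (1 / T) (1 / 4)) : ℝ) ≤
      2 * (repetitions κ (1 / 4) * 2 ^ precisionBits (1 / T)) := by
    exact_mod_cast calls_rotate_le κ (1 / T) (1 / 4)
  nlinarith [mul_le_mul_of_nonneg_left (two_pow_le hT) (Nat.cast_nonneg (α := ℝ)
    (repetitions κ (1 / 4)))]

end Parameters

/-! ### Lower bounds for the overlap -/

section LinearProgram

/-- Weak duality for the linear program in the weights: `A`, `b`, `c` are multipliers of the three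
constraints, and the pointwise inequality `h` is dual feasibility. -/
theorem weighted_gap_ge {κ : Type*} {J : Finset κ} {p y σ : κ → ℝ} {A b c W : ℝ}
    (hp : ∀ j ∈ J, 0 ≤ p j) (h1 : ∑ j ∈ J, p j = 1) (hy : ∑ j ∈ J, p j * y j ^ 2 ≤ 1)
    (hW : ∑ j ∈ J, p j * (1 / y j ^ 2 - 1) = W) (hA : 0 ≤ A)
    (h : ∀ j ∈ J, A * (1 - y j ^ 2) - b + c * (1 / y j ^ 2 - 1) ≤ σ j * (1 / y j - y j)) :
    c * W - b ≤ ∑ j ∈ J, p j * (σ j * (1 / y j - y j)) := by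
  have h2 := Finset.sum_le_sum fun j hj => mul_le_mul_of_nonneg_left (h j hj) (hp j hj)
  refine le_trans ?_ h2
  have e : ∑ j ∈ J, p j * (A * (1 - y j ^ 2) - b + c * (1 / y j ^ 2 - 1)) =
      A * (∑ j ∈ J, p j - ∑ j ∈ J, p j * y j ^ 2) - b * ∑ j ∈ J, p j +
        c * ∑ j ∈ J, p j * (1 / y j ^ 2 - 1) := by
    rw [← Finset.sum_sub_distrib, Finset.mul_sum, Finset.mul_sum, Finset.mul_sum,
      ← Finset.sum_sub_distrib, ← Finset.sum_add_distrib]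
    exact Finset.sum_congr rfl fun j _ => by ring
  rw [e, h1, hW]
  nlinarith [mul_nonneg hA (sub_nonneg.2 hy)]

variable {y y0 σ t : ℝ}

theorem gap_le_of_sq_mul {A b c : ℝ} (hy : 0 < y)
    (h : A * (1 - y ^ 2) * y ^ 2 - b * y ^ 2 + c * (1 - y ^ 2) ≤ σ * ((1 - y ^ 2) * y)) :
    A * (1 - y ^ 2) - b + c * (1 / y ^ 2 - 1) ≤ σ * (1 / y - y) := by
  have e1 : A * (1 - y ^ 2) - b + c * (1 / y ^ 2 - 1) =
      (A * (1 - y ^ 2) * y ^ 2 - b * y ^ 2 + c * (1 - y ^ 2)) / y ^ 2 := by field_simp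
  have e2 : σ * (1 / y - y) = σ * ((1 - y ^ 2) * y) / y ^ 2 := by field_simp
  rw [e1, e2]
  exact div_le_div_of_nonneg_right h (by positivity)

/-- In this regime all y ≤ 1 have reliable signs. Here 0.992 is 0.8 · 1.24; below y = 0.155 the
bound y₀ ≤ y suffices, above it the numerical bound on y₀. For y > 1 the loss is limited by σ ≤ 2
and the quadratic penalty. -/
theorem gap_ge_of_large_angle (h0 : 0 < y0) (hy0 : y0 ≤ 0.0572) (hy : y0 ≤ y) (hσ : σ ≤ 2)
    (hs : y ≤ 1 → 1.24 ≤ σ) :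
    1.6 * (1 - y ^ 2) - 0.08 + 0.992 * y0 * (1 / y ^ 2 - 1) ≤ σ * (1 / y - y) := by
  have hy' : 0 < y := h0.trans_le hy
  refine gap_le_of_sq_mul hy' ?_
  rcases le_total y 1 with h | h
  · have hu : 0 ≤ 1 - y ^ 2 := by nlinarith
    have h1 := mul_le_mul_of_nonneg_right (hs h) (mul_nonneg hu hy'.le)
    refine le_trans ?_ h1
    rcases le_total y 0.155 with h2 | h2
    · have : 0 ≤ 0.248 * y - 1.6 * y ^ 2 := by nlinarith
      nlinarith [mul_nonneg hu this, mul_nonneg hu (sub_nonneg.2 hy), sq_nonneg y]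
    · have h3 : 0 ≤ 1.6 * y ^ 2 + 1.496 * y - 0.075 := by nlinarith
      have h4 := mul_nonneg (sq_nonneg (y - 0.855)) h3
      have h5 := mul_nonneg hu (sub_nonneg.2 hy0)
      norm_num at h2 h3 h4 h5 ⊢
      nlinarith
  · have hu : 0 ≤ y ^ 2 - 1 := by nlinarith
    have h1 := mul_le_mul_of_nonneg_right hσ (mul_nonneg hu hy'.le)
    have h2 := mul_nonneg h0.le hu
    have h3 : 0 ≤ 1.6 * (y ^ 2 - 1) * y ^ 2 + 0.08 * y ^ 2 - 2 * ((y ^ 2 - 1) * y) := by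
      have h4 : 0 ≤ 1.6 * (y ^ 2 - 1) * y + 0.08 * y - 2 * (y ^ 2 - 1) := by
        nlinarith [mul_nonneg (sub_nonneg.2 h) (sq_nonneg (y - 1.12)),
          mul_nonneg (sub_nonneg.2 h) (sub_nonneg.2 h), sq_nonneg (y - 1.12)]
      nlinarith [mul_nonneg h4 hy'.le]
    nlinarith

/-- For t < y² ≤ 1 the sign is unreliable and only σ ≥ 0 is available. The term 1.24 y₀/t in `b`
pays for this range, since 1.24 y₀/y² is at most that much there. -/
theorem gap_ge_of_small_angle (h0 : 0 < y0) (hy : y0 ≤ y) (hσ0 : 0 ≤ σ) (hσ : σ ≤ 2)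
    (ht : 0 < t) (ht1 : t ≤ 1) (hs : y ^ 2 ≤ t → 1.24 ≤ σ) :
    0.78 * (1 - y ^ 2) - (0.78 + 1.24 * y0 / t) + 1.24 * y0 * (1 / y ^ 2 - 1) ≤
      σ * (1 / y - y) := by
  have hy' : 0 < y := h0.trans_le hy
  have hq : 0 ≤ 1.24 * y0 / t := by positivity
  have hqt : 1.24 * y0 / t * t = 1.24 * y0 := div_mul_cancel₀ _ ht.ne'
  refine gap_le_of_sq_mul hy' ?_
  generalize 1.24 * y0 / t = q at hq hqt
  have hq2 := mul_nonneg hq (sq_nonneg y)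
  rcases le_total (y ^ 2) t with h | h
  · have hu : 0 ≤ 1 - y ^ 2 := by linarith
    have h1 := mul_le_mul_of_nonneg_right (hs h) (mul_nonneg hu hy'.le)
    nlinarith [mul_nonneg hu (sub_nonneg.2 hy), mul_nonneg (sq_nonneg y) (sq_nonneg y)]
  · have h2 : 1.24 * y0 ≤ q * y ^ 2 := by
      rw [← hqt]; exact mul_le_mul_of_nonneg_left h hq
    rcases le_total (y ^ 2) 1 with h3 | h3
    · have hu : 0 ≤ 1 - y ^ 2 := by linarith
      have h4 := mul_nonneg hσ0 (mul_nonneg hu hy'.le)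
      nlinarith [mul_nonneg (sq_nonneg y) (sq_nonneg y), mul_nonneg h0.le (sq_nonneg y)]
    · have hu : 0 ≤ y ^ 2 - 1 := by linarith
      have h1 := mul_le_mul_of_nonneg_right hσ (mul_nonneg hu hy'.le)
      have h5 : 0 ≤ 0.78 * y ^ 3 - 2 * y ^ 2 + 2 := by
        nlinarith [mul_nonneg hy'.le (sq_nonneg (y - 1.72)), sq_nonneg (y - 1.72)]
      nlinarith [mul_nonneg h5 hy'.le, mul_nonneg h0.le hu]

/-- The factor 0.62 is half of 1.24: for y ≤ 0.3 the other half covers the term 2y². For y ≥ 1 the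
multiplier 2 matches σ ≤ 2. -/
theorem gap_ge_of_two_states (h0 : 0 < y0) (hy : y0 ≤ y) (hσ : σ ≤ 2)
    (hs : (y ≤ 0.3 ∧ 1.24 ≤ σ) ∨ 1 ≤ y) :
    2 * (1 - y ^ 2) - 0 + 0.62 * y0 * (1 / y ^ 2 - 1) ≤ σ * (1 / y - y) := by
  have hy' : 0 < y := h0.trans_le hy
  refine gap_le_of_sq_mul hy' ?_
  rcases hs with ⟨h, h'⟩ | h
  · have hu : 0 ≤ 1 - y ^ 2 := by nlinarith
    have h1 := mul_le_mul_of_nonneg_right h' (mul_nonneg hu hy'.le)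
    nlinarith [mul_nonneg hu (sub_nonneg.2 hy), mul_nonneg hu (mul_nonneg hy'.le (sub_nonneg.2 h))]
  · have hu : 0 ≤ y ^ 2 - 1 := by nlinarith
    have h1 := mul_le_mul_of_nonneg_right hσ (mul_nonneg hu hy'.le)
    nlinarith [mul_nonneg h0.le hu, mul_nonneg hu (mul_nonneg hy'.le (sub_nonneg.2 h))]

set_option maxHeartbeats 1600000 in
/-- The lower bound for the overlap in terms of the weights `p`, the scaled phases `y` and the
sign gaps `σ` of the eigenvectors of the modified walk. -/
theorem overlap_ge {κ : Type*} {J : Finset κ} {p y σ : κ → ℝ} {n : ℕ} {δ s τ y0 : ℝ}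
    (hn : 2 ≤ n) (hδ : 0 < δ) (hδn : δ ^ 2 = 1 / n) (hs : 0 < s) (hs1 : s ≤ 1) (hτ : 0 < τ)
    (hsτ : s ^ 2 * (1 + τ ^ 2) = τ ^ 2) (hy0 : 0 < y0) (hy0δ : y0 ^ 2 = 0.0098 * δ ^ 2)
    (hp : ∀ j ∈ J, 0 ≤ p j) (h1 : ∑ j ∈ J, p j = 1) (hy : ∑ j ∈ J, p j * y j ^ 2 ≤ 1)
    (hW : ∑ j ∈ J, p j * (1 / y j ^ 2 - 1) = (n - 1) / s ^ 2)
    (hle : ∀ j ∈ J, y0 ≤ y j) (hσ0 : ∀ j ∈ J, 0 ≤ σ j) (hσ : ∀ j ∈ J, σ j ≤ 2)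
    (hσs : ∀ j ∈ J, y j ^ 2 ≤ 5.82 * τ ^ 2 → 1.24 ≤ σ j)
    (h2 : n = 2 → ∀ j ∈ J, (y j ≤ 0.3 ∧ 1.24 ≤ σ j) ∨ 1 ≤ y j) :
    0.004 ≤ δ * s / 2 * ∑ j ∈ J, p j * (σ j * (1 / y j - y j)) := by
  have hy0' : 0.0989 * δ ≤ y0 := by
    refine (pow_le_pow_iff_left₀ (by positivity) hy0.le two_ne_zero).1 ?_
    rw [hy0δ]; nlinarith [sq_nonneg δ]
  have hδy : 0.0989 * (1 / n) ≤ δ * y0 := by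
    rw [← hδn]; nlinarith
  have hn0 : (0 : ℝ) < n := by positivity
  have hnR : (2 : ℝ) ≤ n := by exact_mod_cast hn
  have hss : s ^ 2 ≤ 1 := by nlinarith
  rcases Nat.lt_or_ge n 3 with h3 | h3
  · have hn2 : n = 2 := by omega
    have h := weighted_gap_ge (σ := σ) hp h1 hy hW (by norm_num : (0 : ℝ) ≤ 2) fun j hj =>
      gap_ge_of_two_states hy0 (hle j hj) (hσ j hj) (h2 hn2 j hj)
    have h4 := mul_le_mul_of_nonneg_left h (by positivity : 0 ≤ δ * s / 2)
    refine le_trans ?_ h4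
    subst hn2
    have e : δ * s / 2 * (0.62 * y0 * (((2 : ℕ) - 1 : ℝ) / s ^ 2) - 0) = 0.31 * (δ * y0) / s := by
      field_simp; norm_num; ring
    rw [e, le_div_iff₀ hs]
    norm_num at hδy ⊢
    nlinarith
  · have hnR3 : (3 : ℝ) ≤ n := by exact_mod_cast h3
    have hδ3 : δ ^ 2 ≤ 1 / 3 := by
      rw [hδn]; exact one_div_le_one_div_of_le (by norm_num) hnR3
    -- The worst case is n = 3, where δ(n - 1) = 2/√3; likewise δ²(n - 1) = 1 - 1/n ≥ 2/3.
    have hδn1 : 1.154 ≤ δ * (n - 1) := by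
      refine (pow_le_pow_iff_left₀ (by positivity) (mul_nonneg hδ.le (by linarith)) two_ne_zero).1 ?_
      rw [mul_pow, hδn, div_mul_eq_mul_div, le_div_iff₀ hn0]
      nlinarith
    have hδδ : 0.66 ≤ δ ^ 2 * (n - 1) := by
      rw [hδn, div_mul_eq_mul_div, le_div_iff₀ hn0]
      nlinarith
    have hy0W : 0.0989 * (δ * (n - 1)) ≤ y0 * (n - 1) := by nlinarith
    -- The question is whether the phases with reliable sign include all y ≤ 1.
    rcases le_total 1 (5.82 * τ ^ 2) with hτ1 | hτ1
    · have hy03 : y0 ≤ 0.0572 := by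
        refine (pow_le_pow_iff_left₀ (by positivity) (by norm_num) two_ne_zero).1 ?_
        rw [hy0δ]; norm_num; linarith
      have h := weighted_gap_ge (σ := σ) hp h1 hy hW (by norm_num : (0 : ℝ) ≤ 1.6) fun j hj =>
        gap_ge_of_large_angle hy0 hy03 (hle j hj) (hσ j hj) fun hle1 => hσs j hj <|
          le_trans (by have := hy0.trans_le (hle j hj); nlinarith) hτ1
      have h4 := mul_le_mul_of_nonneg_left h (by positivity : 0 ≤ δ * s / 2)
      refine le_trans ?_ h4
      have e : δ * s / 2 * (0.992 * y0 * ((n - 1) / s ^ 2) - 0.08) =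
          δ * (0.992 * (y0 * (n - 1)) - 0.08 * s ^ 2) / (2 * s) := by
        field_simp
      rw [e, le_div_iff₀ (by positivity)]
      have h5 : 0.02 * (δ * (n - 1)) ≤ 0.992 * (y0 * (n - 1)) - 0.08 * s ^ 2 := by
        norm_num at hy0W hδn1 ⊢; nlinarith
      have h6 := mul_le_mul_of_nonneg_left h5 hδ.le
      norm_num at h6 hδδ ⊢
      nlinarith
    · have hs2 : s ^ 2 ≤ 0.1467 := by
        norm_num at hτ1 ⊢; nlinarith
      have h := weighted_gap_ge (σ := σ) hp h1 hy hW (by norm_num : (0 : ℝ) ≤ 0.78) fun j hj =>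
        gap_ge_of_small_angle hy0 (hle j hj) (hσ0 j hj) (hσ j hj) (by positivity) hτ1 (hσs j hj)
      have h4 := mul_le_mul_of_nonneg_left h (by positivity : 0 ≤ δ * s / 2)
      refine le_trans ?_ h4
      have hτs : 1 / τ ^ 2 ≤ 1 / s ^ 2 :=
        one_div_le_one_div_of_le (by positivity) (by nlinarith [sq_nonneg (s * τ)])
      have e0 : 1.24 * y0 / (5.82 * τ ^ 2) ≤ 1.24 * y0 * 0.172 / s ^ 2 := by
        have : 1.24 * y0 / (5.82 * τ ^ 2) = 1.24 * y0 / 5.82 * (1 / τ ^ 2) := by field_simp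
        rw [this]
        have h7 : 1.24 * y0 / 5.82 ≤ 1.24 * y0 * 0.172 := by
          rw [div_le_iff₀ (by norm_num)]; nlinarith
        calc 1.24 * y0 / 5.82 * (1 / τ ^ 2) ≤ 1.24 * y0 * 0.172 * (1 / s ^ 2) := by
              gcongr
          _ = _ := by ring
      have e : δ * s / 2 * (1.24 * y0 * ((n - 1) / s ^ 2) - (0.78 + 1.24 * y0 * 0.172 / s ^ 2)) =
          δ * (1.24 * (y0 * (n - 1 - 0.172)) - 0.78 * s ^ 2) / (2 * s) := by
        field_simp; ring
      have h8 : δ * s / 2 * (1.24 * y0 * ((n - 1) / s ^ 2) - (0.78 + 1.24 * y0 * 0.172 / s ^ 2)) ≤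
          δ * s / 2 * (1.24 * y0 * ((n - 1) / s ^ 2) - (0.78 + 1.24 * y0 / (5.82 * τ ^ 2))) := by
        gcongr
      refine le_trans ?_ h8
      rw [e, le_div_iff₀ (by positivity)]
      have h9 : 0.914 * (y0 * (n - 1)) ≤ y0 * (n - 1 - 0.172) := by norm_num; nlinarith
      have h5 : 0.0128 * (δ * (n - 1)) ≤ 1.24 * (y0 * (n - 1 - 0.172)) - 0.78 * s ^ 2 := by
        norm_num at hy0W hδn1 h9 hs2 ⊢; nlinarith
      have h6 := mul_le_mul_of_nonneg_left h5 hδ.le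
      have hs3 : s ≤ 0.39 := by
        refine (pow_le_pow_iff_left₀ (by positivity) (by norm_num) two_ne_zero).1 ?_
        norm_num at hs2 ⊢; linarith
      norm_num at h6 hδδ hs3 ⊢
      nlinarith

end LinearProgram

/-! ### Angles -/

section Angles

/-- With 1 - cos a = 2 sin²(a/2) and sin(a/2) ≥ 0.448 a on this range, it suffices that 1.98 ·
0.448² exceeds 0.78²/2. -/
theorem cos_lt_of_one_sub_le {a x : ℝ} (h0 : 0 < a) (h1 : a ≤ Real.pi / 2)
    (hx : 99 / 100 * (1 - Real.cos a) ≤ 1 - x) : x < Real.cos (0.78 * a) := by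
  have h2 := Real.one_sub_sq_div_two_le_cos (x := 0.78 * a)
  have h3 := Real.sin_gt_sub_cube (x := a / 2) (by positivity)
  have hπ := Real.pi_lt_d2
  have ha : a ≤ 1.575 := by norm_num at hπ ⊢; linarith
  have h4 : 0.448 * a ≤ Real.sin (a / 2) := by
    have : 0 ≤ a * (1.575 - a) := mul_nonneg h0.le (by linarith)
    norm_num at ha this ⊢
    nlinarith [mul_nonneg h0.le this]
  have h5 : (0.448 * a) ^ 2 ≤ Real.sin (a / 2) ^ 2 := pow_le_pow_left₀ (by positivity) h4 2
  have h6 : Real.sin (a / 2) ^ 2 = 1 / 2 - Real.cos a / 2 := by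
    rw [Real.sin_sq_eq_half_sub]; congr 2; congr 1; ring
  have h7 : 0 < a ^ 2 := by positivity
  norm_num at h2 h5 hx ⊢
  nlinarith

theorem lt_arccos {a x : ℝ} (ha : a ≤ Real.pi) (hx : -1 ≤ x) (hx1 : x ≤ 1) (h : x < Real.cos a) :
    a < Real.arccos x := by
  by_contra! hle
  have := Real.cos_le_cos_of_nonneg_of_le_pi (Real.arccos_nonneg x) ha hle
  rw [Real.cos_arccos hx hx1] at this
  linarith

theorem arccos_le_three_pi_div_four {x : ℝ} (h : -0.707 ≤ x) : Real.arccos x ≤ 3 * Real.pi / 4 := by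
  have hcos : Real.cos (3 * Real.pi / 4) ≤ x := by
    rw [show 3 * Real.pi / 4 = Real.pi - Real.pi / 4 by ring, Real.cos_pi_sub,
      Real.cos_pi_div_four]
    have : 1.414 ≤ Real.sqrt 2 := Real.le_sqrt_of_sq_le (by norm_num)
    norm_num at this h ⊢
    linarith
  have hπ := Real.pi_pos
  rw [← Real.arccos_cos (x := 3 * Real.pi / 4) (by positivity) (by linarith)]
  exact Real.arccos_le_arccos hcos

theorem cot_half_arccos_sq {ℓ : ℝ} (h0 : -1 ≤ ℓ) (h1 : ℓ < 1) :
    Real.cot (Real.arccos ℓ / 2) ^ 2 = (1 + ℓ) / (1 - ℓ) := by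
  have hs : Real.sin (Real.arccos ℓ / 2) ^ 2 = (1 - ℓ) / 2 := by
    rw [Real.sin_sq_eq_half_sub, mul_div_cancel₀ _ two_ne_zero, Real.cos_arccos h0 h1.le]; ring
  have hc : Real.cos (Real.arccos ℓ / 2) ^ 2 = (1 + ℓ) / 2 := by
    rw [Real.cos_sq, mul_div_cancel₀ _ two_ne_zero, Real.cos_arccos h0 h1.le]; ring
  rw [Real.cot_eq_cos_div_sin, div_pow, hs, hc]
  have : 1 - ℓ ≠ 0 := by linarith
  field_simp

end Angles

/-! ### The overlap with the target state -/

section Main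

variable {X : Type*} [Fintype X] [DecidableEq X] {P : Matrix X X ℝ} {v : X → X → ℝ} {l : X → ℝ}
  {i₀ : X}

/-- The overlap of the final state with the target, as a linear functional of the initial work
state. -/
def targetOverlap (P : Matrix X X ℝ) (z : X) (θ κ Δ ε : ℝ) : (Fin 2 × (X × X) → ℂ) →ₗ[ℂ] ℂ where
  toFun f := bra (tensorVec (ancZero _ _) (tensorVec ![0, 1] (edgeVec P z)))
    (OracleCircuit.eval (tulsiWalk (markedReflection (edgeVec P z)) (quantumAnalogue P) θ)
      (rotate κ Δ ε) *ᵥ tensorVec (ancZero _ _) f)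
  map_add' f g := by rw [tensorVec_add_right, Matrix.mulVec_add, bra_add_right]
  map_smul' a f := by
    rw [tensorVec_smul_right, Matrix.mulVec_smul, bra_smul_right]; rfl

theorem targetOverlap_realLift (h0 : ∀ x y, 0 ≤ P x y) (h1 : ∀ x, ∑ y, P x y = 1)
    (hs : P.IsSymm) {z : X} {θ x r : ℝ} {q : X ⊕ X → ℝ}
    (h : IsCompressedEigen P z (Real.cos θ) (Real.sin θ) q x r) (hx0 : -1 < x) (hx1 : x < 1)
    (κ Δ ε : ℝ) :
    targetOverlap P z θ κ Δ ε (realLift P θ q) =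
      ((signGap (repetitions κ ε) (precisionBits Δ) (Real.arccos x) * r / Real.sqrt (1 - x ^ 2) : ℝ)
        : ℂ) / (2 * Complex.I) := by
  rw [functional_realLift h0 h1 hs h hx0 hx1 (targetOverlap P z θ κ Δ ε)
    (fun α => (rotateSign (repetitions κ ε) (precisionBits Δ) (Complex.exp (α * Complex.I)) : ℂ))
    fun α f hf hf' => bra_rotate hf hf' (star_exp_phase α) κ Δ ε, signGap]
  push_cast
  rw [div_div, mul_comm (2 * Complex.I)]

theorem realLift_sumElim_zero (θ : ℝ) (a : X → ℝ) :
    realLift P θ (Sum.elim (0 : X → ℝ) a) =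
      tensorVec (thetaPerp θ) (edgeLift P fun y => (a y : ℂ)) := by
  ext ⟨i, p⟩
  simp [realLift, pairVec, tensorVec, edgeLift]

theorem bra_edgeVec_stationaryVec (h0 : ∀ x y, 0 ≤ P x y) (h1 : ∀ x, ∑ y, P x y = 1)
    (π : X → ℝ) (z : X) : bra (edgeVec P z) (stationaryVec P π) = (Real.sqrt (π z) : ℂ) := by
  rw [stationaryVec_eq, bra_edgeVec, edgeProj_edgeLift h0 h1]

namespace SpectralChain

/-- The substitution y = τ √((1 - x)/(1 + x)), p = r²/(1 - x²) turns the spectral sum into the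
linear program and its three moment identities into the constraints. -/
theorem overlap_sum_ge (H : SpectralChain P v l i₀) (hn : 2 ≤ Fintype.card X) {ℓ : ℝ}
    (hℓ : IsPrincipalRoot l i₀ ℓ) (hℓ0 : 0 ≤ ℓ) {z : X} {c s δ : ℝ} (hc : 0 < c) (hs : 0 < s)
    (hcs : c ^ 2 + s ^ 2 = 1) (hδ : δ ^ 2 = 1 / Fintype.card X) (hδ0 : 0 < δ)
    (hτ : Fintype.card X * (s / c) ^ 2 = (1 + ℓ) / (1 - ℓ) / 100) {k m : ℕ} (hk : 1 ≤ k)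
    (hm : 8 ≤ 2 ^ m) (hM : 2 * Real.pi ≤ 2 ^ m * (0.78 * Real.arccos ℓ))
    {J : Finset (X ⊕ X)} {q : X ⊕ X → X ⊕ X → ℝ} {x r : X ⊕ X → ℝ}
    (hJ : ∀ j ∈ J, IsCompressedEigen P z c s (q j) (x j) (r j) ∧ r j ≠ 0 ∧ -1 < x j ∧ x j < 1)
    (h1 : ∑ j ∈ J, r j ^ 2 / (1 - x j ^ 2) = 1)
    (h2 : ∑ j ∈ J, r j ^ 2 / (1 + x j) ^ 2 ≤ c ^ 2 / s ^ 2)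
    (h3 : ∑ j ∈ J, r j ^ 2 / (1 - x j) ^ 2 = (1 - δ ^ 2 * c ^ 2) / (δ ^ 2 * c ^ 2)) :
    0.004 ≤ 1 / 2 * ∑ j ∈ J, (δ * c * r j * (1 / (1 - x j) - (s / c) ^ 2 / (1 + x j))) *
      (signGap k m (Real.arccos (x j)) * r j / Real.sqrt (1 - x j ^ 2)) := by
  have hn0 : (0 : ℝ) < Fintype.card X := by positivity
  have hℓ1 := hℓ.lt_one
  set τ : ℝ := s / c with hτd
  have hτ0 : 0 < τ := div_pos hs hc
  have hcτ : c * τ = s := by rw [hτd]; field_simp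
  set y : X ⊕ X → ℝ := fun j => τ * Real.sqrt (1 - x j) / Real.sqrt (1 + x j) with hy
  set p : X ⊕ X → ℝ := fun j => r j ^ 2 / (1 - x j ^ 2) with hp
  set σ : X ⊕ X → ℝ := fun j => signGap k m (Real.arccos (x j)) with hσ
  have hysq : ∀ j ∈ J, y j ^ 2 = τ ^ 2 * (1 - x j) / (1 + x j) := fun j hj => by
    obtain ⟨_, _, ha, hb⟩ := hJ j hj
    rw [hy]
    simp only
    rw [div_pow, mul_pow, Real.sq_sqrt (by linarith), Real.sq_sqrt (by linarith)]
  have hy0 : ∀ j ∈ J, 0 < y j := fun j hj => by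
    obtain ⟨_, _, ha, hb⟩ := hJ j hj
    have : 0 < 1 - x j := by linarith
    have : 0 < 1 + x j := by linarith
    simp only [hy]; positivity
  have hgap : ∀ j ∈ J, 99 / 100 * (1 - ℓ) ≤ 1 - x j := fun j hj =>
    H.compressed_eigenvalue_le hℓ hℓ0 (hJ j hj).1 hc.ne' (hJ j hj).2.1 (hJ j hj).2.2.2 hτ
  have harc0 : 0 < Real.arccos ℓ := Real.arccos_pos.2 hℓ1
  have hphase : ∀ j ∈ J, 2 * Real.pi < 2 ^ m * Real.arccos (x j) := fun j hj => by
    obtain ⟨_, _, ha, hb⟩ := hJ j hj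
    refine hM.trans_lt ((mul_lt_mul_iff_right₀ (by positivity)).2 ?_)
    refine lt_arccos (by norm_num; linarith [Real.arccos_le_pi ℓ, Real.pi_pos]) ha.le hb.le (cos_lt_of_one_sub_le harc0
      (Real.arccos_le_pi_div_two.2 hℓ0) ?_)
    rw [Real.cos_arccos (by linarith) hℓ1.le]
    exact hgap j hj
  have hsig : ∀ j ∈ J, -0.707 ≤ x j → 1.24 ≤ σ j := fun j hj hx =>
    signGap_ge hk hm (hphase j hj) (arccos_le_three_pi_div_four hx)
  have hnτ : (Fintype.card X : ℝ) * τ ^ 2 * (1 - ℓ) * 100 = 1 + ℓ := by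
    rw [hτ]; have : 1 - ℓ ≠ 0 := by linarith
    field_simp
  have e : ∀ j ∈ J, (δ * c * r j * (1 / (1 - x j) - τ ^ 2 / (1 + x j))) *
      (signGap k m (Real.arccos (x j)) * r j / Real.sqrt (1 - x j ^ 2)) =
      δ * s * (p j * (σ j * (1 / y j - y j))) := fun j hj => by
    obtain ⟨_, _, ha, hb⟩ := hJ j hj
    have hA : 0 < 1 - x j := by linarith
    have hB : 0 < 1 + x j := by linarith
    have hsq : (1 - x j ^ 2) = (1 - x j) * (1 + x j) := by ring
    simp only [hp, hy, hσ]
    rw [hsq, Real.sqrt_mul hA.le, ← hcτ]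
    have hA' := Real.sq_sqrt hA.le
    have hB' := Real.sq_sqrt hB.le
    have hA0 := Real.sqrt_pos.2 hA
    have hB0 := Real.sqrt_pos.2 hB
    generalize Real.sqrt (1 - x j) = A at *
    generalize Real.sqrt (1 + x j) = B at *
    rw [← hA', ← hB']
    field_simp
  rw [Finset.sum_congr rfl e, ← Finset.mul_sum, ← mul_assoc, one_div_mul_eq_div]
  -- The gap 1 - x ≥ 0.99 (1 - ℓ) gives 1 + x ≤ 1.01 (1 + ℓ). With nτ² = (1 + ℓ)/(100(1 - ℓ)), y² ≥
  -- (0.99/1.01) δ²/100 > 0.0098 δ².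
  refine overlap_ge hn hδ0 hδ hs (by nlinarith) hτ0 ?_ (y0 := Real.sqrt 0.0098 * δ)
    (by positivity) ?_ ?_ h1 ?_ ?_ ?_ ?_ ?_ ?_ ?_
  · rw [← hcτ] at hcs ⊢
    linear_combination τ ^ 2 * hcs
  · rw [mul_pow, Real.sq_sqrt (by norm_num)]
  · intro j hj
    obtain ⟨_, _, ha, hb⟩ := hJ j hj
    exact div_nonneg (sq_nonneg _) (by nlinarith)
  · have : ∑ j ∈ J, p j * y j ^ 2 = τ ^ 2 * ∑ j ∈ J, r j ^ 2 / (1 + x j) ^ 2 := by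
      rw [Finset.mul_sum]
      refine Finset.sum_congr rfl fun j hj => ?_
      obtain ⟨_, _, ha, hb⟩ := hJ j hj
      have hA : 1 - x j ≠ 0 := by linarith
      have hB : 1 + x j ≠ 0 := by linarith
      rw [hysq j hj]
      simp only [hp]
      rw [show (1 - x j ^ 2) = (1 - x j) * (1 + x j) by ring]
      field_simp
    rw [this]
    refine (mul_le_mul_of_nonneg_left h2 (sq_nonneg τ)).trans_eq ?_
    rw [hτd]; field_simp
  · have : ∀ j ∈ J, p j * (1 / y j ^ 2 - 1) =
        1 / τ ^ 2 * (r j ^ 2 / (1 - x j) ^ 2) - r j ^ 2 / (1 - x j ^ 2) := fun j hj => by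
      obtain ⟨_, _, ha, hb⟩ := hJ j hj
      have hA : 1 - x j ≠ 0 := by linarith
      have hB : 1 + x j ≠ 0 := by linarith
      rw [hysq j hj]
      simp only [hp]
      rw [show (1 - x j ^ 2) = (1 - x j) * (1 + x j) by ring]
      field_simp
    rw [Finset.sum_congr rfl this, Finset.sum_sub_distrib, ← Finset.mul_sum, h1, h3, hδ,
      ← hcτ, mul_pow]
    have : s ^ 2 = c ^ 2 * τ ^ 2 := by rw [← hcτ]; ring
    rw [this] at hcs
    field_simp
    linarith
  · intro j hj
    obtain ⟨_, _, ha, hb⟩ := hJ j hj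
    refine (pow_le_pow_iff_left₀ (by positivity) (hy0 j hj).le two_ne_zero).1 ?_
    rw [hysq j hj, mul_pow, Real.sq_sqrt (by norm_num), hδ, mul_one_div,
      div_le_div_iff₀ hn0 (by linarith)]
    have h4 := mul_le_mul_of_nonneg_left (hgap j hj)
      (by positivity : 0 ≤ (Fintype.card X : ℝ) * τ ^ 2)
    norm_num at h4 ⊢
    nlinarith
  · intro j hj
    exact signGap_nonneg k m (Real.arccos_nonneg _) (Real.arccos_le_pi _)
  · intro j _
    exact signGap_le_two k m _
  · intro j hj hyj
    obtain ⟨_, _, ha, hb⟩ := hJ j hj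
    refine hsig j hj ?_
    rw [hysq j hj, div_le_iff₀ (by linarith)] at hyj
    -- 5.82 lies just below tan²(3π/8) = 3 + 2√2, and yields x ≥ -4.82/6.82 > -0.707.
    have h4 : 1 - x j ≤ 5.82 * (1 + x j) := by
      have : 0 < τ ^ 2 := by positivity
      refine le_of_mul_le_mul_left ?_ this
      linarith
    norm_num at h4 ⊢
    linarith
  · intro hn2 j hj
    obtain ⟨hq, _, ha, hb⟩ := hJ j hj
    rcases H.compressed_two_states hn2 hℓ hq hc.ne' (hJ j hj).2.1 ha hb with h4 | h4
    · left
      refine ⟨?_, hsig j hj (by norm_num; linarith)⟩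
      refine (pow_le_pow_iff_left₀ (hy0 j hj).le (by norm_num) two_ne_zero).1 ?_
      rw [hn2] at hnτ
      rw [hysq j hj, div_le_iff₀ (by linarith)]
      have h5 : τ ^ 2 * (1 - x j) ≤ τ ^ 2 * (1 - ℓ) :=
        mul_le_mul_of_nonneg_left (by linarith) (sq_nonneg τ)
      norm_num at hnτ ⊢
      linarith
    · right
      refine (pow_le_pow_iff_left₀ (by norm_num) (hy0 j hj).le two_ne_zero).1 ?_
      rw [hysq j hj, le_div_iff₀ (by linarith)]
      linarith

/-- The overlap of the final state of the rotation with the target state. -/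
theorem norm_targetOverlap_ge (H : SpectralChain P v l i₀) (hn : 2 ≤ Fintype.card X) {ℓ : ℝ}
    (hℓ : IsPrincipalRoot l i₀ ℓ) (z : X) {θ δ κ T : ℝ} (hκ : 0 < κ) (hθ0 : 0 ≤ θ)
    (hθ : θ < Real.pi / 2) (hδ : δ ^ 2 = 1 / Fintype.card X) (hδ0 : 0 < δ)
    (htan : Real.tan θ = δ * Real.cot (Real.arccos ℓ / 2) / 10)
    (hT : 1 / Real.arccos ℓ / 0.78 ≤ T) (hT' : 0.7 ≤ T) :
    0.004 ≤ ‖targetOverlap P z θ κ (1 / T) (1 / 4) (tensorVec (thetaPerp θ)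
      (edgeLift P fun y => ((if y = z then 0 else δ : ℝ) : ℂ)))‖ := by
  have hn0 : (0 : ℝ) < Fintype.card X := by positivity
  have hℓ0 := H.principalRoot_nonneg hn hℓ
  have hℓ1 := hℓ.lt_one
  have hcot := cot_half_arccos_sq (by linarith) hℓ1
  have hc : 0 < Real.cos θ := Real.cos_pos_of_mem_Ioo ⟨by linarith [Real.pi_pos], hθ⟩
  have hτsq : (Real.sin θ / Real.cos θ) ^ 2 = δ ^ 2 * ((1 + ℓ) / (1 - ℓ)) / 100 := by
    rw [← Real.tan_eq_sin_div_cos, htan, ← hcot]; ring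
  have hτ : Fintype.card X * (Real.sin θ / Real.cos θ) ^ 2 = (1 + ℓ) / (1 - ℓ) / 100 := by
    rw [hτsq, hδ]; field_simp
  have hs : 0 < Real.sin θ := by
    refine (Real.sin_nonneg_of_nonneg_of_le_pi hθ0 (by linarith [Real.pi_pos])).lt_of_ne' ?_
    intro h
    rw [h, zero_div] at hτ
    have : 0 < (1 + ℓ) / (1 - ℓ) / 100 := by
      have : 0 < 1 - ℓ := by linarith
      positivity
    rw [← hτ] at this; simp at this
  have harc0 : 0 < Real.arccos ℓ := Real.arccos_pos.2 hℓ1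
  -- The grid spacing is at most 1/T ≤ 0.78 α₁, below every phase of the modified walk that occurs
  -- in the start state.
  have hM : 2 * Real.pi ≤ 2 ^ precisionBits (1 / T) * (0.78 * Real.arccos ℓ) := by
    have h1 := two_pi_mul_le_two_pow T
    rw [div_div, div_le_iff₀ (by positivity)] at hT
    have h2 := mul_le_mul_of_nonneg_right h1 (by positivity : 0 ≤ 0.78 * Real.arccos ℓ)
    have h3 := mul_le_mul_of_nonneg_left hT (by positivity : 0 ≤ 2 * Real.pi)
    linarith
  obtain ⟨J, q, x, r, hJ, hstart, h1, h2, h3⟩ := H.exists_modified_spectrum z hc hs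
    (Real.cos_sq_add_sin_sq θ) hδ hδ0
  have hmain := H.overlap_sum_ge hn hℓ hℓ0 hc hs (Real.cos_sq_add_sin_sq θ) hδ hδ0 hτ
    (one_le_repetitions hκ) (eight_le_two_pow hT') hM hJ h1 h2 h3
  rw [← realLift_sumElim_zero, hstart _ rfl, realLift_sum, map_sum]
  have hterm : ∀ j ∈ J, targetOverlap P z θ κ (1 / T) (1 / 4)
      (((δ * Real.cos θ * r j * (1 / (1 - x j) - (Real.sin θ / Real.cos θ) ^ 2 / (1 + x j)) : ℝ) : ℂ)
        • realLift P θ (q j)) =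
      (((δ * Real.cos θ * r j * (1 / (1 - x j) - (Real.sin θ / Real.cos θ) ^ 2 / (1 + x j))) *
        (signGap (repetitions κ (1 / 4)) (precisionBits (1 / T)) (Real.arccos (x j)) * r j /
          Real.sqrt (1 - x j ^ 2)) : ℝ) : ℂ) / (2 * Complex.I) := fun j hj => by
    rw [map_smul, targetOverlap_realLift H.nonneg H.row_sum H.symm (hJ j hj).1 (hJ j hj).2.2.1
      (hJ j hj).2.2.2, smul_eq_mul, ← mul_div_assoc, ← Complex.ofReal_mul]
  rw [Finset.sum_congr rfl hterm, ← Finset.sum_div, ← Complex.ofReal_sum, norm_div,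
    Complex.norm_real, norm_mul, Complex.norm_I, mul_one, Complex.norm_ofNat]
  refine hmain.trans ?_
  rw [one_div_mul_eq_div]
  exact div_le_div_of_nonneg_right (le_abs_self _) (by norm_num)

end SpectralChain

end Main

end

theorem mainTheorem4 (κ : ℝ) (hκ : 0 < κ) :
    ∃ c > (0 : ℝ), ∃ C > (0 : ℝ),
      ∀ (n : ℕ) (P : Matrix (Fin n) (Fin n) ℝ) (π : Fin n → ℝ) (z : Fin n),
        2 ≤ n →
        IsErgodicChain P → IsStationaryDistribution P π → IsReversibleChain P π →
        IsStateTransitive P →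
        ∀ (U₁ U₂ : Matrix (Fin n × Fin n) (Fin n × Fin n) ℂ) (μ φ₀ : Fin n × Fin n → ℂ),
          μ = edgeVec P z → φ₀ = stationaryVec P π →
          U₁ = markedReflection μ → U₂ = quantumAnalogue P →
        ∀ θ : ℝ, 0 ≤ θ → θ < Real.pi / 2 →
          Real.tan θ = (bra μ φ₀).re * Real.cot (principalPhase (U₂ * U₁) / 2) / 10 →
        ∀ ε : ℝ, 0 < ε → ε ≤ 1 / 2 → (n = 2 → ε < 1 / 2) →
        ∀ T : ℝ, quantumHittingTime U₂ φ₀ μ ε / 0.78 ≤ T →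
          c ≤ ‖bra (tensorVec (ancZero _ _) (tensorVec ![0, 1] μ))
                (OracleCircuit.eval (tulsiWalk U₁ U₂ θ) (rotate κ (1 / T) (1 / 4)) *ᵥ
                  tensorVec (ancZero _ _) (tensorVec (thetaPerp θ) (startState φ₀ μ)))‖ ∧
          ((rotate κ (1 / T) (1 / 4)).calls : ℝ) ≤ C * T := by
  have hk : (0 : ℝ) < repetitions κ (1 / 4) := by exact_mod_cast one_le_repetitions hκ
  -- The 32 is 16, from 2ᵐ ≤ 16 T, times 2 for making and undoing each estimate.
  refine ⟨0.004, by norm_num, 32 * repetitions κ (1 / 4), by positivity, ?_⟩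
  intro n P π z hn hP hπ hr ht U₁ U₂ μ φ₀ hμ hφ hU₁ hU₂ θ hθ0 hθ htan ε hε0 hε1 hε2 T hT
  subst hμ hφ hU₁ hU₂
  have : Nonempty (Fin n) := ⟨z⟩
  have hcard : 2 ≤ Fintype.card (Fin n) := by rwa [Fintype.card_fin]
  have hu := stationary_uniform hP ht hπ
  obtain ⟨v, l, i₀, H⟩ := exists_spectralChain hP ht (isSymm_of_reversible hP ht hπ hr)
  obtain ⟨ℓ, hℓ⟩ := H.exists_principalRoot hcard
  have hℓ0 := H.principalRoot_nonneg hcard hℓ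
  have hphase := H.principalPhase_eq hcard hℓ z
  have hδ0 : 0 < Real.sqrt (1 / Fintype.card (Fin n)) := Real.sqrt_pos.2 (by positivity)
  have hQ : 1 / Real.arccos ℓ ≤ _ := H.le_hittingTime hcard hℓ hu z hε0 hε1
    fun h => hε2 (by rwa [Fintype.card_fin] at h)
  have hT1 : 1 / Real.arccos ℓ / 0.78 ≤ T :=
    (div_le_div_of_nonneg_right hQ (by norm_num)).trans hT
  -- As α₁ ≤ π/2, T is at least 2/(0.78 π) > 0.8.
  have hT2 : 0.7 ≤ T := by
    refine le_trans ?_ hT1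
    have h1 := Real.arccos_le_pi_div_two.2 hℓ0
    have h2 := Real.pi_lt_d2
    have h3 : 0 < Real.arccos ℓ := Real.arccos_pos.2 hℓ.lt_one
    rw [div_div, le_div_iff₀ (by positivity)]
    norm_num at h2 ⊢
    linarith
  rw [show quantumAnalogue P * markedReflection (edgeVec P z) = markedWalk P z from rfl, hphase,
    bra_edgeVec_stationaryVec H.nonneg H.row_sum, hu, Complex.ofReal_re] at htan
  refine ⟨?_, calls_rotate_le_mul κ hT2⟩
  have hmain := H.norm_targetOverlap_ge hcard hℓ z hκ hθ0 hθ (Real.sq_sqrt (by positivity)) hδ0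
    htan hT1 hT2
  rw [startState_uniform H.nonneg H.row_sum hu]
  have hfun : (fun x => if x = z then 0 else (Real.sqrt (1 / Fintype.card (Fin n)) : ℂ)) =
      fun y => ((if y = z then 0 else Real.sqrt (1 / Fintype.card (Fin n)) : ℝ) : ℂ) := by
    ext y; split_ifs <;> simp
  rw [hfun]
  exact hmain
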